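/- Let $k$ be an uncountable algebraically closed field of characteristic $\ne 2$, and write $\mathbf{P}^1=k\cup\{\infty\}$. All vector spaces below have dimension at most $\aleph_0$. An $r$-quadratic space is a $k$-vector space $V$ with symmetric bilinear forms $\omega_1,\dots,\omega_r$; embeddings (isomorphisms) are injective (bijective) linear maps respecting all the forms, and $\mathrm{Aut}(V)$ is the group of automorphisms. A biquadratic space is a $2$-quadratic space $(V,\omega,\omega')$. A space is *universal* if every finite-dimensional $r$-quadratic space embeds into it, *homogeneous* if any two embeddings of a finite-dimensional $r$-quadratic space into it differ by an automorphism. The *length* of $V$ is its length as a representation of $G=\mathrm{Aut}(V)$; $V$ is *irreducible* if the length is one. $\mathrm{End}_G(V)$ is the $k$-algebra of linear endomorphisms of $V$ commuting with $G$. Put $\omega_x=\omega(x,-)$ and $\ker\omega=\{x:\omega_x=0\}$. For biquadratic $V$ put $\ker V=\ker\omega\cap\ker\omega'$, let $W^\perp$ be the set of vectors orthogonal to a subspace $W$ under both $\omega$ and $\omega'$, and let $\omega(a)=\omega+a\omega'$ for $a\in k$ and $\omega(\infty)=\omega'$. For $p\in\mathbf{P}^1$ let $N_p=\ker\omega(p)$.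 The biquadratic space $V$ is of - **Type Ia** with parameter $\{p,q\}$ (where $p\neq q$ in $\mathbf{P}^1$) if $N_p$ and $N_q$ are infinite-dimensional and $V=N_p\oplus N_q$; - **Type Ib** with parameter $(d,p)$ if $N_p\ne0$, $N_p^\perp$ (with the restricted forms) is universal and homogeneous, $V=N_p^\perp\oplus N_p$, and $d=\dim N_p$; - **Type Ic** with parameter $d$ if $\ker V\neq0$, $V/\ker V$ (with the induced forms) is universal and homogeneous, and $d=\dim\ker V$; - **Type IIa** with parameter $p$ if $V$ is universal, $N_p\neq0$, $N_p^\perp=N_p$, and for every $q\neq p$ there is a linear isomorphism $T\colon V/N_p\to N_p$ with $\omega(q)_{T(x)}=\omega(p)_x$ for all $x\in V$; - **Type IIb** with parameter $p$ if $V$ is universal, $N_p\ne0$ and $N_p^\perp=0$; - **Type IIc** with parameter $p$ if $V$ is universal, $N_p\neq0$, $N_p^\perp=N_p$, $\omega_x+\omega'_y=0$ only if $x,y$ are linearly dependent, and $\ker V=0$; - **Type III** with parameter $E\subset k^4$ if there are a decomposition $V=U\oplus U'$ and a linear isomorphism $T\colon U\to U'$ such that for $x,y\in V$ one has $\omega_x=\omega'_y$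 if and only if $x\in U$ and $y=T(x)$, and such that $U$ with the four forms $\eta_1=\omega|_U$, $\eta_2=\omega'|_U$, $\eta_3=T^*(\omega|_{U'})$, $\eta_4=T^*(\omega'|_{U'})$ is an irreducible $4$-quadratic space, and $E=\{\alpha\in k^4:\sum_i\alpha_i\eta_i=0\}$. Then: 1. A biquadratic space is universal of length two if and only if it belongs to one of the seven families Ia, Ib, Ic, IIa, IIb, IIc, III. 2. The $k$-algebra $\mathrm{End}_G(V)$ is isomorphic to $k\oplus k$ for Types Ia and Ib, to $k$ for Types Ic, IIb and IIc, to $k[x]/(x^2)$ for Type IIa, and to $\mathrm{M}_2(k)$ for Type III. 3. Two spaces in the same family are isomorphic if and only if their parameters coincide (in particular, the parameter of a space in a family is well defined). 4. Every parameter occurs: all $\{p,q\}$ with $p\ne q$ for Ia; all $(d,p)$ with $d\in\{1,2,\dots,\infty\}$ and $p\in\mathbf{P}^1$ for Ib; all $d\in\{1,2,\dots,\infty\}$ for Ic; all $p\in\mathbf{P}^1$ for IIa, IIb and IIc. A subspace $E\subset k^4$ is the parameter of a Type III space if and only if, for $a,b,c\in k$, $(a,c,0,b)\in E$ and $(c,0,b,a)\in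 E$ imply $a=b=c=0$. -/

import Mathlib

universe u v w

open scoped MonoidAlgebra OnePoint

noncomputable section

/-- The structure of a multi-quadratic space on `V`: a family of symmetric bilinear forms indexed
by `ι`. For `ι = Fin 2` this is a biquadratic space, with `ω = form 0` and `ω' = form 1`. -/
structure MultiQuad (ι : Type*) (k : Type*) (V : Type*) [Field k] [AddCommGroup V] [Module k V] where
  /-- The forms. -/
  form : ι → LinearMap.BilinForm k V
  /-- Each form is symmetric. -/
  symm : ∀ i, (form i).IsSymm

namespace MultiQuad

variable {ι k V W : Type*} [Field k] [AddCommGroup V] [Module k V] [AddCommGroup W] [Module k W]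

/-- Pull back all the forms along a linear map. -/
def comap (ω : MultiQuad ι k V) (f : W →ₗ[k] V) : MultiQuad ι k W where
  form i := (ω.form i).comp f f
  symm i := ⟨fun x y => (ω.symm i).eq (f x) (f y)⟩

/-- The induced structure on a subspace. -/
def restrict (ω : MultiQuad ι k V) (U : Submodule k V) : MultiQuad ι k U := ω.comap U.subtype

/-- An embedding of multi-quadratic spaces: an injective linear map respecting all the forms. -/
def IsEmbedding (η : MultiQuad ι k W) (ω : MultiQuad ι k V) (f : W →ₗ[k] V) : Prop :=
  Function.Injective f ∧ ∀ i x y, ω.form i (f x) (f y) = η.form i x y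

/-- Isomorphism of multi-quadratic spaces. -/
def Isomorphic (η : MultiQuad ι k W) (ω : MultiQuad ι k V) : Prop :=
  ∃ e : W ≃ₗ[k] V, ∀ i x y, ω.form i (e x) (e y) = η.form i x y

/-- The automorphism group of a multi-quadratic space. -/
def Aut (ω : MultiQuad ι k V) : Subgroup (V ≃ₗ[k] V) where
  carrier := {g | ∀ i x y, ω.form i (g x) (g y) = ω.form i x y}
  one_mem' := fun _ _ _ => rfl
  mul_mem' := fun {a b} ha hb i x y => (ha i (b x) (b y)).trans (hb i x y)
  inv_mem' := fun {a} ha i x y => by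
    have h := ha i (a⁻¹ x) (a⁻¹ y)
    rw [← LinearEquiv.mul_apply, ← LinearEquiv.mul_apply, mul_inv_cancel] at h
    exact h.symm

/-- The tautological representation of the automorphism group on `V`. -/
def rep (ω : MultiQuad ι k V) : Representation k ω.Aut V where
  toFun g := (g : V ≃ₗ[k] V).toLinearMap
  map_one' := rfl
  map_mul' _ _ := rfl

/-- The length of a multi-quadratic space: its length as a representation of its
automorphism group. -/
def length (ω : MultiQuad ι k V) : ℕ∞ := Module.length k[ω.Aut] ω.rep.asModule

/-- The `k`-algebra of linear endomorphisms of `V` commuting with the automorphism group. -/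
abbrev Commutant (ω : MultiQuad ι k V) : Type _ := Representation.IntertwiningMap ω.rep ω.rep

/-- Every finite-dimensional multi-quadratic space embeds. (It suffices to let the underlying vector
space of the source run over the spaces `k ^ n`.) -/
def Universal (ω : MultiQuad ι k V) : Prop :=
  ∀ (n : ℕ) (η : MultiQuad ι k (Fin n → k)), ∃ f : (Fin n → k) →ₗ[k] V, IsEmbedding η ω f

/-- Any two embeddings of a finite-dimensional multi-quadratic space differ by an automorphism. -/
def Homogeneous (ω : MultiQuad ι k V) : Prop :=
  ∀ (n : ℕ) (η : MultiQuad ι k (Fin n → k)) (f g : (Fin n → k) →ₗ[k] V),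
    IsEmbedding η ω f → IsEmbedding η ω g → ∃ a ∈ ω.Aut, ∀ x, f x = a (g x)

/-- The linear relations between the forms. -/
def relations [Fintype ι] (ω : MultiQuad ι k V) : Submodule k (ι → k) where
  carrier := {α | ∑ i, α i • ω.form i = 0}
  zero_mem' := by simp
  add_mem' := fun {a b} ha hb => by
    simp only [Set.mem_ofPred_eq, Pi.add_apply, add_smul, Finset.sum_add_distrib] at *
    rw [ha, hb, add_zero]
  smul_mem' := fun c a ha => by
    simp only [Set.mem_ofPred_eq, Pi.smul_apply, smul_assoc, ← Finset.smul_sum] at *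
    rw [ha, smul_zero]

/-- The total orthogonal complement of a subspace: the vectors orthogonal to it under all forms. -/
def perp (ω : MultiQuad ι k V) (U : Submodule k V) : Submodule k V where
  carrier := {x | ∀ i, ∀ y ∈ U, ω.form i x y = 0}
  zero_mem' := by simp
  add_mem' := fun {a b} ha hb i y hy => by simp [ha i y hy, hb i y hy]
  smul_mem' := fun c a ha i y hy => by simp [ha i y hy]

/-- The common nullspace of all the forms. -/
def totalKer (ω : MultiQuad ι k V) : Submodule k V := ⨅ i, LinearMap.ker (ω.form i)

theorem totalKer_le (ω : MultiQuad ι k V) (i : ι) : ω.totalKer ≤ LinearMap.ker (ω.form i) :=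
  iInf_le _ i

theorem totalKer_le_flip (ω : MultiQuad ι k V) (i : ι) : ω.totalKer ≤
    LinearMap.ker (LinearMap.flip (ω.totalKer.liftQ (ω.form i) (ω.totalKer_le i))) := by
  intro x hx
  have hx' : ω.form i x = 0 := LinearMap.mem_ker.1 (ω.totalKer_le i hx)
  rw [LinearMap.mem_ker]
  apply LinearMap.ext
  intro y
  induction y using Submodule.Quotient.induction_on with | _ y => ?_
  have h : ω.form i y x = ω.form i x y := (ω.symm i).eq y x
  rw [hx'] at h
  exact h

/-- The structure induced on the quotient by the common nullspace. -/
def quotTotalKer (ω : MultiQuad ι k V) : MultiQuad ι k (V ⧸ ω.totalKer) where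
  form i := ω.totalKer.liftQ
    (LinearMap.flip (ω.totalKer.liftQ (ω.form i) (ω.totalKer_le i))) (ω.totalKer_le_flip i)
  symm i := ⟨fun x y => by
    induction x using Submodule.Quotient.induction_on with | _ x => ?_
    induction y using Submodule.Quotient.induction_on with | _ y => ?_
    exact (ω.symm i).eq y x⟩

/-! ### Biquadratic spaces -/

/-- The form `ω(p)` of the pencil, for `p ∈ P¹ = k ∪ {∞}`: it is `ω + p ω'` for `p ∈ k`, and `ω'` for
`p = ∞`. -/
def pencil (ω : MultiQuad (Fin 2) k V) (p : OnePoint k) : LinearMap.BilinForm k V :=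
  p.elim (ω.form 1) (fun a => ω.form 0 + a • ω.form 1)

/-- The nullspace of `ω(p)`. -/
def nullspace (ω : MultiQuad (Fin 2) k V) (p : OnePoint k) : Submodule k V :=
  LinearMap.ker (ω.pencil p)

/-- Type Ia, with parameter the two-element set `S = {p, q}` of points of `P¹`. -/
def TypeIa (ω : MultiQuad (Fin 2) k V) (S : Set (OnePoint k)) : Prop :=
  ∃ p q : OnePoint k, p ≠ q ∧ S = {p, q} ∧
    ¬ FiniteDimensional k (ω.nullspace p) ∧ ¬ FiniteDimensional k (ω.nullspace q) ∧
    IsCompl (ω.nullspace p) (ω.nullspace q)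

/-- Type Ib, with parameter `(d, p)`. -/
def TypeIb (ω : MultiQuad (Fin 2) k V) (d : ℕ∞) (p : OnePoint k) : Prop :=
  ω.nullspace p ≠ ⊥ ∧
  (ω.restrict (ω.perp (ω.nullspace p))).Universal ∧
  (ω.restrict (ω.perp (ω.nullspace p))).Homogeneous ∧
  IsCompl (ω.perp (ω.nullspace p)) (ω.nullspace p) ∧
  d = Cardinal.toENat (Module.rank k (ω.nullspace p))

/-- Type Ic, with parameter `d`. -/
def TypeIc (ω : MultiQuad (Fin 2) k V) (d : ℕ∞) : Prop :=
  ω.totalKer ≠ ⊥ ∧ ω.quotTotalKer.Universal ∧ ω.quotTotalKer.Homogeneous ∧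
  d = Cardinal.toENat (Module.rank k ω.totalKer)

/-- Type IIa, with parameter `p`. -/
def TypeIIa (ω : MultiQuad (Fin 2) k V) (p : OnePoint k) : Prop :=
  ω.Universal ∧ ω.nullspace p ≠ ⊥ ∧ ω.perp (ω.nullspace p) = ω.nullspace p ∧
  ∀ q : OnePoint k, q ≠ p → ∃ T : (V ⧸ ω.nullspace p) ≃ₗ[k] ω.nullspace p,
    ∀ x : V, ω.pencil q (T (Submodule.Quotient.mk x)) = ω.pencil p x

/-- Type IIb, with parameter `p`. -/
def TypeIIb (ω : MultiQuad (Fin 2) k V) (p : OnePoint k) : Prop :=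
  ω.Universal ∧ ω.nullspace p ≠ ⊥ ∧ ω.perp (ω.nullspace p) = ⊥

/-- Type IIc, with parameter `p`. -/
def TypeIIc (ω : MultiQuad (Fin 2) k V) (p : OnePoint k) : Prop :=
  ω.Universal ∧ ω.nullspace p ≠ ⊥ ∧ ω.perp (ω.nullspace p) = ω.nullspace p ∧
  (∀ x y : V, ω.form 0 x + ω.form 1 y = 0 → ¬ LinearIndependent k ![x, y]) ∧
  ω.totalKer = ⊥

/-- Given subspaces `U`, `U'` and an isomorphism `T : U → U'`, the four quadratic forms
`ω|U`, `ω'|U`, `T^*(ω|U')`, `T^*(ω'|U')` on `U`. -/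
def fourForms (ω : MultiQuad (Fin 2) k V) {U U' : Submodule k V} (T : U ≃ₗ[k] U') :
    MultiQuad (Fin 4) k U where
  form := ![(ω.restrict U).form 0, (ω.restrict U).form 1,
    ((ω.restrict U').comap T.toLinearMap).form 0, ((ω.restrict U').comap T.toLinearMap).form 1]
  symm i := by
    fin_cases i
    · exact (ω.restrict U).symm 0
    · exact (ω.restrict U).symm 1
    · exact ((ω.restrict U').comap T.toLinearMap).symm 0
    · exact ((ω.restrict U').comap T.toLinearMap).symm 1

/-- Type III, with parameter the subspace `E` of `k ^ 4`. -/
def TypeIII (ω : MultiQuad (Fin 2) k V) (E : Submodule k (Fin 4 → k)) : Prop :=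
  ∃ (U U' : Submodule k V) (T : U ≃ₗ[k] U'), IsCompl U U' ∧
    (∀ x y : V, ω.form 0 x = ω.form 1 y ↔ ∃ hx : x ∈ U, y = T ⟨x, hx⟩) ∧
    (ω.fourForms T).rep.IsIrreducible ∧
    E = (ω.fourForms T).relations

end MultiQuad

/-- The subspaces of `k ^ 4` that occur as parameters in Type III. -/
def GoodSubspace {k : Type*} [Field k] (E : Submodule k (Fin 4 → k)) : Prop :=
  ∀ a b c : k, ![a, c, 0, b] ∈ E → ![c, 0, b, a] ∈ E → a = 0 ∧ b = 0 ∧ c = 0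

end

/-! The nullspaces `N_p`, their orthogonal complements, and conditions such as "`ω_x` is of the form
`ω'_y`" all define subspaces stable under `Aut(V)`. When the length is two, two nested stable
subspaces that are both nonzero and proper must coincide (`eq_of_le_of_length_eq_two`), so each of
these subspaces is forced to be trivial or equal to another one.

The central notion is joint nondegeneracy (`Nondeg`): the map `(x_i) ↦ ∑ ω_i(x_i, -)` is injective.
In an infinite-dimensional such space, the values of all forms against finitely many vectors,
together with the diagonal values, can be prescribed freely (`Nondeg.realize`). A back-and-forth
argument then shows that in countable dimension the space is unique, universal, homogeneous and
irreducible, with scalar commutant. Conversely, a universal homogeneous space is jointly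
nondegenerate. So is an irreducible space with linearly independent forms (`Irred.nondeg`), because
over an uncountable algebraically closed field, in countable dimension, Schur's lemma holds in
Dixmier's form.

For the classification, suppose first that some `N_p ≠ 0`. Then `N_p ∩ N_p^⊥` is `0` or `N_p`. If it
is `0`, then either `N_p^⊥ = 0` (IIb) or `V = N_p^⊥ ⊕ N_p`. In the latter case the forms on the
irreducible summand `N_p^⊥` are either independent (Ib) or dependent, and then `N_p^⊥` is another
nullspace (Ia). If `N_p ⊆ N_p^⊥`, then `N_p^⊥` is `V` (Ic) or `N_p`; in the last case the subspace
of `x` with `ω(p)_x ∈ ω(q)(N_p)` is `V` (IIa) or `N_p` (IIc). Suppose now that every `N_p` vanishes.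
The equation `ω_x = ω'_y` defines an isomorphism `T : U → U'` of stable subspaces. If `U = 0`, the
space is jointly nondegenerate, hence irreducible, which is excluded. If `U = V`, `U' = V` or `U =
U'`, then `T` or its inverse is an equivariant endomorphism, and Dixmier's argument produces a
vector of some `N_p`. So `V = U ⊕ U'` (III).

For the other direction, Types Ia, Ib, Ic split into pieces with well understood automorphisms.
Types IIb and IIc are handled by a back-and-forth that keeps track of `N_p` (`TwoStep`). Type IIa
has a normal form, two copies of `k^(ℕ)` built from the dot product (`TypeIIa.exists_coordinates`).
A Type III space is encoded by four forms on `U` (`IsDouble`); after dividing out their relations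
`E`, these become a jointly nondegenerate system, so `E` determines everything. Parameters are
recovered from the points with `N_p ≠ 0`, from dimensions, and from the equation `ω_x = ω'_y`.
Examples are assembled from the explicit nondegenerate system `free`. -/

noncomputable section

namespace MultiQuad
open Submodule

/-! ### Linear algebra with subspaces of finite codimension (`CoFG`) -/

section LinearAlgebra

variable {ι k L A : Type*} [Field k] [AddCommGroup L] [Module k L] [AddCommGroup A] [Module k A]

/-- Since `A` is finite-dimensional, the image of `L` in the dual of `A` is its own double
annihilator, so compatible linear conditions on `x` are solvable. This is the source of all vectors
with prescribed values against finitely many others. -/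
theorem exists_eval_eq [FiniteDimensional k A] (f : A →ₗ[k] Module.Dual k L) (c : Module.Dual k A)
    (hc : LinearMap.ker f ≤ LinearMap.ker c) : ∃ x : L, ∀ a, f a x = c a := by
  have h : c ∈ (LinearMap.range f.flip).dualCoannihilator.dualAnnihilator := by
    rw [Submodule.mem_dualAnnihilator]
    intro a ha
    refine hc ?_
    rw [LinearMap.mem_ker]
    ext x
    exact (Submodule.mem_dualCoannihilator a).1 ha _ ⟨x, rfl⟩
  have : FiniteDimensional k (LinearMap.range f.flip) := inferInstance
  rw [Subspace.dualCoannihilator_dualAnnihilator_eq] at h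
  obtain ⟨x, hx⟩ := h
  exact ⟨x, fun a => by rw [← hx]; rfl⟩

theorem cofg_perp (B : LinearMap.BilinForm k L) (F : Submodule k L) [FiniteDimensional k F] :
    ∃ C : Submodule k L, C.CoFG ∧ ∀ x ∈ C, ∀ y ∈ F, B y x = 0 := by
  refine ⟨LinearMap.ker ((B.domRestrict F).flip), Submodule.CoFG.ker _, fun x hx y hy => ?_⟩
  rw [LinearMap.mem_ker] at hx
  exact LinearMap.congr_fun hx ⟨y, hy⟩

theorem not_cofg_of_finiteDimensional (hL : ¬ FiniteDimensional k L) (F : Submodule k L)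
    [FiniteDimensional k F] : ¬ F.CoFG := by
  intro hF
  obtain ⟨D, hD⟩ := F.exists_isCompl
  have hDf : D.FG := Submodule.CoFG.fg_of_isCompl hD hF
  have : FiniteDimensional k D := (D.fg_iff_finiteDimensional).1 hDf
  have : FiniteDimensional k (⊤ : Submodule k L) := by
    rw [← hD.sup_eq_top]; infer_instance
  exact hL (Submodule.topEquiv (R := k) (M := L)).finiteDimensional

theorem not_cofg_sup {F N : Submodule k L} [FiniteDimensional k F] (hN : ¬ N.CoFG) :
    ¬ (F ⊔ N).CoFG := by
  intro h
  have h1 : FiniteDimensional k (L ⧸ (F ⊔ N)) := h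
  have h2 : FiniteDimensional k (F.map N.mkQ) := inferInstance
  refine not_cofg_of_finiteDimensional (L := L ⧸ N) hN (F.map N.mkQ) ?_
  have e := Submodule.quotientQuotientEquivQuotientSup N F
  rw [sup_comm] at e
  exact e.symm.finiteDimensional

theorem CoFG.exists_notMem {C F : Submodule k L} (hC : C.CoFG) (hF : ¬ F.CoFG) :
    ∃ x ∈ C, x ∉ F := by
  by_contra! h
  exact hF (hC.of_le h)

/-- If the diagonal of `B` vanished on `C`, polarization would make `B` zero on `C`. The vectors of
`C` orthogonal to a finite-dimensional complement of `C` would then lie in the kernel, which would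
have finite codimension. -/
theorem exists_apply_self_ne_zero (h2 : (2 : k) ≠ 0) {B : LinearMap.BilinForm k L} (hB : B.IsSymm)
    (hker : ¬ (LinearMap.ker B).CoFG) {C : Submodule k L} (hC : C.CoFG) :
    ∃ x ∈ C, B x x ≠ 0 := by
  by_contra! h
  apply hker
  have hpol : ∀ x ∈ C, ∀ y ∈ C, B x y = 0 := by
    intro x hx y hy
    have h1 := h _ (C.add_mem hx hy)
    have h3 : B y x = B x y := hB.eq y x
    simp only [map_add, LinearMap.add_apply, h x hx, h y hy, h3] at h1
    have : 2 * B x y = 0 := by linear_combination h1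
    exact (mul_eq_zero.1 this).resolve_left h2
  obtain ⟨D, hD⟩ := C.exists_isCompl
  have hDf : D.FG := Submodule.CoFG.fg_of_isCompl hD hC
  have : FiniteDimensional k D := (D.fg_iff_finiteDimensional).1 hDf
  obtain ⟨C', hC', hperp⟩ := cofg_perp B D
  refine Submodule.CoFG.of_le (S := C ⊓ C') ?_ (hC.inf hC')
  rintro x ⟨hx, hx'⟩
  rw [LinearMap.mem_ker]
  ext y
  have hy : y ∈ C ⊔ D := by rw [hD.sup_eq_top]; trivial
  obtain ⟨c, hc, d, hd, rfl⟩ := Submodule.mem_sup.1 hy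
  have hxd : B x d = 0 := (hB.eq x d).trans (hperp x hx' d hd)
  rw [map_add, hpol x hx c hc, hxd]
  simp

end LinearAlgebra

/-! ### Prescribing diagonal values of forms of infinite rank -/

section Strong

variable {ι k L : Type*} [Field k] [AddCommGroup L] [Module k L] [Fintype ι]

/-- The space is infinite-dimensional and every nontrivial combination of the forms has infinite
rank. -/
def Strong (ω : MultiQuad ι k L) : Prop :=
  ¬ FiniteDimensional k L ∧ ∀ c : ι → k, c ≠ 0 → ¬ (LinearMap.ker (∑ i, c i • ω.form i)).CoFG

theorem isSymm_sum (ω : MultiQuad ι k L) (c : ι → k) :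
    LinearMap.BilinForm.IsSymm (∑ i, c i • ω.form i) := by
  refine ⟨fun x y => ?_⟩
  simp only [LinearMap.sum_apply, LinearMap.smul_apply]
  exact Finset.sum_congr rfl fun i _ => by
    rw [show ω.form i x y = ω.form i y x from (ω.symm i).eq x y]

theorem cofg_perp_forms (ω : MultiQuad ι k L) (F : Submodule k L) [FiniteDimensional k F] :
    ∃ C : Submodule k L, C.CoFG ∧ ∀ x ∈ C, ∀ y ∈ F, ∀ i, ω.form i y x = 0 := by
  classical
  choose C hC hp using fun i => cofg_perp (ω.form i) F
  refine ⟨sInf ((Finset.univ.image C : Finset _) : Set (Submodule k L)), ?_, ?_⟩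
  · refine Submodule.CoFG.sInf fun S hS => ?_
    obtain ⟨i, -, rfl⟩ := Finset.mem_image.1 hS
    exact hC i
  · intro x hx y hy i
    refine hp i x ?_ y hy
    exact (Submodule.mem_sInf.1 hx) _ (by simp)

/-- The proof takes a maximal subspace `S` of `k^ι` all of whose elements are diagonal values of
vectors in one finite-dimensional `F ≤ C`. Adjoining to `F` a vector orthogonal to it enlarges `S`
as long as `S` is proper. -/
theorem Strong.exists_apply_self_eq [IsAlgClosed k] (h2 : (2 : k) ≠ 0) {ω : MultiQuad ι k L}
    (hω : ω.Strong) {C : Submodule k L} (hC : C.CoFG) (d : ι → k) :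
    ∃ x ∈ C, ∀ i, ω.form i x x = d i := by
  let P : Set (Submodule k (ι → k)) := {S | ∃ F : Submodule k L, FiniteDimensional k F ∧ F ≤ C ∧
    ∀ s ∈ S, ∃ x ∈ F, ∀ i, ω.form i x x = s i}
  have hP : P.Nonempty := ⟨⊥, ⊥, inferInstance, bot_le, fun s hs => ⟨0, Submodule.zero_mem _, by
    rw [(Submodule.mem_bot k).1 hs]; simp⟩⟩
  obtain ⟨S, ⟨F, hF, hFC, hS⟩, hmax⟩ := wellFounded_gt.has_min P hP
  suffices h : S = ⊤ by
    obtain ⟨x, hx, hx'⟩ := hS d (h ▸ Submodule.mem_top)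
    exact ⟨x, hFC hx, hx'⟩
  by_contra hne
  obtain ⟨f, hf, hSf⟩ := Submodule.exists_le_ker_of_lt_top S (lt_top_iff_ne_top.2 hne)
  classical
  -- The functional `f` killing `S` is read as a combination of the forms. Its infinite rank gives
  -- `v` orthogonal to `F` whose diagonal values `t` satisfy `f t ≠ 0`, so `t` lies outside `S`.
  let c : ι → k := fun i => f (Pi.single i 1)
  have hfc : ∀ s, f s = ∑ i, c i * s i := by
    intro s
    conv_lhs => rw [pi_eq_sum_univ s]
    rw [map_sum]
    refine Finset.sum_congr rfl fun i _ => ?_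
    rw [map_smul, smul_eq_mul, mul_comm]
    congr 2
    funext j
    simp [Pi.single_apply, eq_comm]
  have hc : c ≠ 0 := by
    rintro h
    apply hf
    refine LinearMap.ext fun s => ?_
    rw [hfc, h]
    simp
  obtain ⟨C', hC', hperp⟩ := ω.cofg_perp_forms F
  obtain ⟨v, ⟨hvC, hvC'⟩, hv⟩ := exists_apply_self_ne_zero h2 (ω.isSymm_sum c) (hω.2 c hc)
    (hC.inf hC')
  let t : ι → k := fun i => ω.form i v v
  have ht : f t ≠ 0 := by
    rw [hfc]
    simpa [LinearMap.sum_apply] using hv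
  refine hmax (S ⊔ Submodule.span k {t}) ⟨F ⊔ Submodule.span k {v}, inferInstance, ?_, ?_⟩ ?_
  · rw [sup_le_iff, Submodule.span_singleton_le_iff_mem]
    exact ⟨hFC, hvC⟩
  · intro s hs
    obtain ⟨s', hs', r, hr, rfl⟩ := Submodule.mem_sup.1 hs
    obtain ⟨a, rfl⟩ := Submodule.mem_span_singleton.1 hr
    obtain ⟨x, hx, hxs⟩ := hS s' hs'
    -- Orthogonal vectors have additive diagonal values, and scaling `v` by `b` multiplies its
    -- values by `b * b = a`.
    obtain ⟨b, rfl⟩ := IsAlgClosed.exists_eq_mul_self a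
    refine ⟨x + b • v, Submodule.add_mem_sup hx (Submodule.smul_mem _ _
      (Submodule.mem_span_singleton_self v)), fun i => ?_⟩
    have h1 := hperp v hvC' x hx i
    have h3 : ω.form i v x = 0 := by rw [← h1]; exact (ω.symm i).eq v x
    simp [hxs, h1, h3, t]
    ring
  · refine lt_of_le_of_ne le_sup_left fun h => ht ?_
    have : t ∈ S := by
      rw [h]
      exact Submodule.mem_sup_right (Submodule.mem_span_singleton_self t)
    exact hSf this

/-- The correction `x` is taken orthogonal to `v`, so it only has to supply the difference of
diagonal values. It is also taken in the kernel of a functional separating `v` from `F`, so the sum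
stays outside `F`. -/
theorem Strong.exists_add_apply_self_eq [IsAlgClosed k] (h2 : (2 : k) ≠ 0) {ω : MultiQuad ι k L}
    (hω : ω.Strong) {C : Submodule k L} (hC : C.CoFG) (v : L) (d : ι → k)
    {F : Submodule k L} (hF : ¬ F.CoFG) :
    ∃ x ∈ C, v + x ∉ F ∧ ∀ i, ω.form i (v + x) (v + x) = d i := by
  suffices h : ∀ v, v ∉ F → ∃ x ∈ C, v + x ∉ F ∧ ∀ i, ω.form i (v + x) (v + x) = d i by
    by_cases hv : v ∈ F
    · obtain ⟨y, hy, hyF⟩ := CoFG.exists_notMem hC hF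
      obtain ⟨x, hx, hx'⟩ := h (v + y) fun h => hyF ((Submodule.add_mem_iff_right F hv).1 h)
      refine ⟨y + x, C.add_mem hy hx, ?_⟩
      rwa [← add_assoc]
    · exact h v hv
  intro v hv
  obtain ⟨C₁, hC₁, hp⟩ := ω.cofg_perp_forms (Submodule.span k {v})
  obtain ⟨f, hfv, hfF⟩ := Submodule.exists_le_ker_of_notMem hv
  obtain ⟨x, ⟨⟨hx, hx₁⟩, hx₂⟩, hxd⟩ := hω.exists_apply_self_eq h2
    ((hC.inf hC₁).inf (Submodule.CoFG.ker f)) (fun i => d i - ω.form i v v)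
  refine ⟨x, hx, fun h => hfv ?_, fun i => ?_⟩
  · have h1 : f (v + x) = 0 := hfF h
    rwa [map_add, LinearMap.mem_ker.1 hx₂, add_zero] at h1
  · have h1 := hp x hx₁ v (Submodule.mem_span_singleton_self v) i
    have h3 : ω.form i x v = 0 := by rw [← h1]; exact (ω.symm i).eq x v
    simp [hxd, h1, h3]

end Strong
end MultiQuad

namespace MultiQuad
open Submodule

/-! ### Partial isomorphisms and the back-and-forth method -/

section BackAndForth

variable {ι k V V' : Type*} [Field k] [AddCommGroup V] [Module k V] [AddCommGroup V'] [Module k V']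

theorem form_comm (ω : MultiQuad ι k V) (i : ι) (x y : V) : ω.form i x y = ω.form i y x :=
  (ω.symm i).eq x y

/-- `Γ` is the graph of an isomorphism between subspaces of `V` and `V'` which respects all forms
and the marked subspaces `N` and `N'`. -/
structure IsPartialIso (ω : MultiQuad ι k V) (N : Submodule k V) (ω' : MultiQuad ι k V')
    (N' : Submodule k V') (Γ : Submodule k (V × V')) : Prop where
  form_eq : ∀ p ∈ Γ, ∀ q ∈ Γ, ∀ i, ω.form i p.1 q.1 = ω'.form i p.2 q.2
  zero_iff : ∀ p ∈ Γ, p.1 = 0 ↔ p.2 = 0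
  mem_iff : ∀ p ∈ Γ, p.1 ∈ N ↔ p.2 ∈ N'

/-- One-point extension property for partial isomorphisms from `V` to `V'`. -/
def ExtProp (ω : MultiQuad ι k V) (N : Submodule k V) (ω' : MultiQuad ι k V')
    (N' : Submodule k V') : Prop :=
  ∀ Γ : Submodule k (V × V'), FiniteDimensional k Γ → IsPartialIso ω N ω' N' Γ →
    ∀ v, v ∉ Γ.map (LinearMap.fst k V V') → ∀ F : Submodule k V', FiniteDimensional k F →
      ∃ v' ∉ F, IsPartialIso ω N ω' N' (Γ ⊔ span k {(v, v')})

variable {ω : MultiQuad ι k V} {N : Submodule k V} {ω' : MultiQuad ι k V'} {N' : Submodule k V'}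
  {Γ : Submodule k (V × V')}

/-- The graph of the inverse. -/
def swapGraph (Γ : Submodule k (V × V')) : Submodule k (V' × V) :=
  Γ.map (LinearEquiv.prodComm k V V').toLinearMap

theorem mem_swapGraph {p : V' × V} : p ∈ swapGraph Γ ↔ p.swap ∈ Γ := by
  constructor
  · rintro ⟨q, hq, rfl⟩
    exact hq
  · intro h
    exact ⟨p.swap, h, rfl⟩

theorem IsPartialIso.swap (h : IsPartialIso ω N ω' N' Γ) :
    IsPartialIso ω' N' ω N (swapGraph Γ) where
  form_eq _ hp _ hq i := (h.form_eq _ (mem_swapGraph.1 hp) _ (mem_swapGraph.1 hq) i).symm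
  zero_iff _ hp := (h.zero_iff _ (mem_swapGraph.1 hp)).symm
  mem_iff _ hp := (h.mem_iff _ (mem_swapGraph.1 hp)).symm

theorem isPartialIso_bot : IsPartialIso ω N ω' N' ⊥ where
  form_eq p hp q hq i := by
    rw [Submodule.mem_bot] at hp hq
    simp [hp, hq]
  zero_iff p hp := by
    rw [Submodule.mem_bot] at hp
    simp [hp]
  mem_iff p hp := by
    rw [Submodule.mem_bot] at hp
    simp [hp]

theorem IsPartialIso.extend (h : IsPartialIso ω N ω' N' Γ) {v : V} {v' : V'}
    (hv : v ∉ Γ.map (LinearMap.fst k V V')) (hv' : v' ∉ Γ.map (LinearMap.snd k V V'))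
    (h1 : ∀ p ∈ Γ, ∀ i, ω.form i v p.1 = ω'.form i v' p.2)
    (h2 : ∀ i, ω.form i v v = ω'.form i v' v')
    (h3 : ∀ p ∈ Γ, v + p.1 ∈ N ↔ v' + p.2 ∈ N') :
    IsPartialIso ω N ω' N' (Γ ⊔ span k {(v, v')}) := by
  have hmem : ∀ {p}, p ∈ Γ ⊔ span k {(v, v')} → ∃ q ∈ Γ, ∃ c : k, p = q + c • (v, v') := by
    intro p hp
    obtain ⟨q, hq, r, hr, rfl⟩ := mem_sup.1 hp
    obtain ⟨c, rfl⟩ := mem_span_singleton.1 hr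
    exact ⟨q, hq, c, rfl⟩
  refine ⟨fun a ha b hb i => ?_, fun a ha => ?_, fun a ha => ?_⟩
  · obtain ⟨p, hp, c, rfl⟩ := hmem ha
    obtain ⟨q, hq, d, rfl⟩ := hmem hb
    have e1 := h1 p hp i
    rw [form_comm, form_comm ω'] at e1
    simp [h.form_eq p hp q hq i, h1 q hq i, h2 i, e1]
  · obtain ⟨p, hp, c, rfl⟩ := hmem ha
    rcases eq_or_ne c 0 with rfl | hc
    · simpa using h.zero_iff p hp
    · refine iff_of_false (fun h0 => hv ?_) (fun h0 => hv' ?_)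
      · refine ⟨-c⁻¹ • p, Γ.smul_mem _ hp, ?_⟩
        simp only [Prod.fst_add, Prod.smul_fst] at h0
        have : p.1 = - (c • v) := eq_neg_of_add_eq_zero_left h0
        simp [this, smul_smul, hc]
      · refine ⟨-c⁻¹ • p, Γ.smul_mem _ hp, ?_⟩
        simp only [Prod.snd_add, Prod.smul_snd] at h0
        have : p.2 = - (c • v') := eq_neg_of_add_eq_zero_left h0
        simp [this, smul_smul, hc]
  · obtain ⟨p, hp, c, rfl⟩ := hmem ha
    rcases eq_or_ne c 0 with rfl | hc
    · simpa using h.mem_iff p hp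
    · have := h3 (c⁻¹ • p) (Γ.smul_mem _ hp)
      have e1 : (p + c • (v, v')).1 = c • (v + (c⁻¹ • p).1) := by
        simp [smul_smul, hc, add_comm]
      have e2 : (p + c • (v, v')).2 = c • (v' + (c⁻¹ • p).2) := by
        simp [smul_smul, hc, add_comm]
      rw [e1, e2, N.smul_mem_iff hc, N'.smul_mem_iff hc, this]

/-- Transports a functional along the graph: `Γ` projects injectively to `V'`, and a linear left
inverse extends the transported functional to all of `V'`. It turns the values of a new vector
against the domain into values to be realized in `V'`. -/
theorem IsPartialIso.exists_dual (h : IsPartialIso ω N ω' N' Γ) (f : Module.Dual k V) :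
    ∃ c : Module.Dual k V', ∀ p ∈ Γ, c p.2 = f p.1 := by
  obtain ⟨g, hg⟩ := LinearMap.exists_leftInverse_of_injective
    ((LinearMap.snd k V V').comp Γ.subtype) (by
      rw [LinearMap.ker_eq_bot']
      rintro ⟨p, hp⟩ h0
      have h2 : p.2 = 0 := h0
      have h1 := (h.zero_iff p hp).2 h2
      exact Subtype.ext (Prod.ext h1 h2))
  refine ⟨f.comp ((LinearMap.fst k V V').comp (Γ.subtype.comp g)), fun p hp => ?_⟩
  have := LinearMap.congr_fun hg ⟨p, hp⟩
  simp only [LinearMap.comp_apply] at this ⊢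
  erw [this]
  rfl

theorem IsPartialIso.mono {Δ : Submodule k (V × V')} (h : IsPartialIso ω N ω' N' Δ) (hle : Γ ≤ Δ) :
    IsPartialIso ω N ω' N' Γ :=
  ⟨fun p hp q hq => h.form_eq p (hle hp) q (hle hq), fun p hp => h.zero_iff p (hle hp),
    fun p hp => h.mem_iff p (hle hp)⟩

theorem ExtProp.exists_extension (h : ExtProp ω N ω' N') (hΓ : FiniteDimensional k Γ)
    (hi : IsPartialIso ω N ω' N' Γ) (v : V) :
    ∃ Γ' : Submodule k (V × V'), Γ ≤ Γ' ∧ FiniteDimensional k Γ' ∧ IsPartialIso ω N ω' N' Γ' ∧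
      v ∈ Γ'.map (LinearMap.fst k V V') := by
  by_cases hv : v ∈ Γ.map (LinearMap.fst k V V')
  · exact ⟨Γ, le_rfl, hΓ, hi, hv⟩
  · obtain ⟨v', -, h'⟩ := h Γ hΓ hi v hv ⊥ inferInstance
    exact ⟨_, le_sup_left, inferInstance, h',
      ⟨(v, v'), mem_sup_right (mem_span_singleton_self _), rfl⟩⟩

/-- The Rasiowa–Sikorski form of back-and-forth: each spanning vector gives a cofinal set of
finite-dimensional partial isomorphisms, an ideal meets all these countably many sets, and the union
of the ideal is the required graph. -/
theorem exists_generic (hΓ : FiniteDimensional k Γ) (hi : IsPartialIso ω N ω' N' Γ)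
    {s : Set V} {t : Set V'} (hs : s.Countable) (ht : t.Countable)
    (forth : ∀ Γ : Submodule k (V × V'), FiniteDimensional k Γ → IsPartialIso ω N ω' N' Γ → ∀ v ∈ s,
      ∃ Γ' : Submodule k (V × V'), Γ ≤ Γ' ∧ FiniteDimensional k Γ' ∧ IsPartialIso ω N ω' N' Γ' ∧
        v ∈ Γ'.map (LinearMap.fst k V V'))
    (back : ∀ Γ : Submodule k (V × V'), FiniteDimensional k Γ → IsPartialIso ω N ω' N' Γ → ∀ v ∈ t,
      ∃ Γ' : Submodule k (V × V'), Γ ≤ Γ' ∧ FiniteDimensional k Γ' ∧ IsPartialIso ω N ω' N' Γ' ∧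
        v ∈ Γ'.map (LinearMap.snd k V V')) :
    ∃ Δ : Submodule k (V × V'), Γ ≤ Δ ∧ IsPartialIso ω N ω' N' Δ ∧
      span k s ≤ Δ.map (LinearMap.fst k V V') ∧ span k t ≤ Δ.map (LinearMap.snd k V V') := by
  let P := {Γ : Submodule k (V × V') // FiniteDimensional k Γ ∧ IsPartialIso ω N ω' N' Γ}
  have : Countable s := hs
  have : Countable t := ht
  let _ : Encodable (s ⊕ t) := Encodable.ofCountable _
  let D : s ⊕ t → Order.Cofinal P := Sum.elim
    (fun v : s => ⟨{Γ | (v : V) ∈ Γ.1.map (LinearMap.fst k V V')}, fun Γ => by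
      obtain ⟨Γ', h1, h2, h3, h4⟩ := forth Γ.1 Γ.2.1 Γ.2.2 v v.2
      exact ⟨⟨Γ', h2, h3⟩, h4, h1⟩⟩)
    (fun v : t => ⟨{Γ | (v : V') ∈ Γ.1.map (LinearMap.snd k V V')}, fun Γ => by
      obtain ⟨Γ', h1, h2, h3, h4⟩ := back Γ.1 Γ.2.1 Γ.2.2 v v.2
      exact ⟨⟨Γ', h2, h3⟩, h4, h1⟩⟩)
  let I := Order.idealOfCofinals (⟨Γ, hΓ, hi⟩ : P) D
  let S : Set (Submodule k (V × V')) := Subtype.val '' (I : Set P)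
  have hdir : DirectedOn (· ≤ ·) S := by
    rintro _ ⟨a, ha, rfl⟩ _ ⟨b, hb, rfl⟩
    obtain ⟨c, hc, hac, hbc⟩ := I.directed a ha b hb
    exact ⟨c.1, ⟨c, hc, rfl⟩, hac, hbc⟩
  have hne : S.Nonempty := ⟨Γ, ⟨_, Order.mem_idealOfCofinals _ D, rfl⟩⟩
  have hmem : ∀ {p}, p ∈ sSup S → ∃ a ∈ I, p ∈ a.1 := by
    intro p hp
    obtain ⟨_, ⟨a, ha, rfl⟩, hp⟩ := (mem_sSup_of_directed hne hdir).1 hp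
    exact ⟨a, ha, hp⟩
  have hle : ∀ a ∈ I, a.1 ≤ sSup S := fun a ha => le_sSup ⟨a, ha, rfl⟩
  refine ⟨sSup S, hle _ (Order.mem_idealOfCofinals _ D), ⟨fun p hp q hq i => ?_, fun p hp => ?_,
    fun p hp => ?_⟩, span_le.2 fun v hv => ?_, span_le.2 fun v hv => ?_⟩
  · obtain ⟨a, ha, hp⟩ := hmem hp
    obtain ⟨b, hb, hq⟩ := hmem hq
    obtain ⟨c, hc, hac, hbc⟩ := I.directed a ha b hb
    exact c.2.2.form_eq p (hac hp) q (hbc hq) i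
  · obtain ⟨a, ha, hp⟩ := hmem hp
    exact a.2.2.zero_iff p hp
  · obtain ⟨a, ha, hp⟩ := hmem hp
    exact a.2.2.mem_iff p hp
  · obtain ⟨a, ha, haI⟩ := Order.cofinal_meets_idealOfCofinals (⟨Γ, hΓ, hi⟩ : P) D (.inl ⟨v, hv⟩)
    exact Submodule.map_mono (hle a haI) ha
  · obtain ⟨a, ha, haI⟩ := Order.cofinal_meets_idealOfCofinals (⟨Γ, hΓ, hi⟩ : P) D (.inr ⟨v, hv⟩)
    exact Submodule.map_mono (hle a haI) ha

theorem exists_countable_span (h : Module.rank k V ≤ Cardinal.aleph0) :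
    ∃ s : Set V, s.Countable ∧ span k s = ⊤ := by
  let b := Module.Basis.ofVectorSpace k V
  refine ⟨Set.range b, ?_, b.span_eq⟩
  rw [← b.mk_eq_rank'', Cardinal.mk_le_aleph0_iff] at h
  exact Set.countable_range _

theorem IsPartialIso.exists_linearMap {Δ : Submodule k (V × V')} (h : IsPartialIso ω N ω' N' Δ)
    (h1 : Δ.map (LinearMap.fst k V V') = ⊤) :
    ∃ f : V →ₗ[k] V', IsEmbedding ω ω' f ∧ (∀ x, x ∈ N ↔ f x ∈ N') ∧ (∀ x, (x, f x) ∈ Δ) ∧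
      ∀ p ∈ Δ, f p.1 = p.2 := by
  let g := (LinearMap.fst k V V').comp Δ.subtype
  have hz : ∀ p ∈ Δ, p.1 = 0 → p = 0 := fun p hp h0 => Prod.ext h0 ((h.zero_iff p hp).1 h0)
  have hg : Function.Bijective g := by
    constructor
    · rw [← LinearMap.ker_eq_bot, LinearMap.ker_eq_bot']
      rintro ⟨p, hp⟩ h0
      exact Subtype.ext (hz p hp h0)
    · intro x
      obtain ⟨p, hp, rfl⟩ : x ∈ Δ.map (LinearMap.fst k V V') := h1 ▸ mem_top
      exact ⟨⟨p, hp⟩, rfl⟩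
  let e := LinearEquiv.ofBijective g hg
  let f : V →ₗ[k] V' := (LinearMap.snd k V V').comp (Δ.subtype.comp e.symm.toLinearMap)
  have hgraph : ∀ x, (x, f x) ∈ Δ := by
    intro x
    have hx : (e.symm x).1.1 = x := e.apply_symm_apply x
    have : ((e.symm x).1.1, (e.symm x).1.2) ∈ Δ := (e.symm x).2
    rw [hx] at this
    exact this
  have hfun : ∀ p ∈ Δ, f p.1 = p.2 := by
    intro p hp
    have := hz _ (Δ.sub_mem (hgraph p.1) hp) (by simp)
    exact sub_eq_zero.1 (congrArg Prod.snd this)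
  refine ⟨f, ⟨?_, fun i x y => (h.form_eq _ (hgraph x) _ (hgraph y) i).symm⟩,
    fun x => h.mem_iff _ (hgraph x), hgraph, hfun⟩
  rw [← LinearMap.ker_eq_bot, LinearMap.ker_eq_bot']
  exact fun x hx => (h.zero_iff _ (hgraph x)).2 hx

/-- Only the "forth" half is needed for an embedding, so the target may have any dimension. -/
theorem ExtProp.exists_embedding (h : ExtProp ω N ω' N') (hΓ : FiniteDimensional k Γ)
    (hi : IsPartialIso ω N ω' N' Γ) (hV : Module.rank k V ≤ Cardinal.aleph0) :
    ∃ f : V →ₗ[k] V', IsEmbedding ω ω' f ∧ (∀ x, x ∈ N ↔ f x ∈ N') ∧ ∀ p ∈ Γ, f p.1 = p.2 := by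
  obtain ⟨s, hs, hs'⟩ := exists_countable_span hV
  obtain ⟨Δ, hΔ, hi', h1, -⟩ := exists_generic (s := s) (t := ∅) hΓ hi hs Set.countable_empty
    (fun Γ hΓ hi v _ => h.exists_extension hΓ hi v) (fun _ _ _ _ hv => hv.elim)
  rw [hs', top_le_iff] at h1
  obtain ⟨f, hf, hN, -, hf'⟩ := hi'.exists_linearMap h1
  exact ⟨f, hf, hN, fun p hp => hf' p (hΔ hp)⟩

theorem ExtProp.exists_equiv (h : ExtProp ω N ω' N') (h' : ExtProp ω' N' ω N)
    (hΓ : FiniteDimensional k Γ) (hi : IsPartialIso ω N ω' N' Γ)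
    (hV : Module.rank k V ≤ Cardinal.aleph0) (hV' : Module.rank k V' ≤ Cardinal.aleph0) :
    ∃ e : V ≃ₗ[k] V', (∀ i x y, ω'.form i (e x) (e y) = ω.form i x y) ∧ (∀ x, x ∈ N ↔ e x ∈ N') ∧
      ∀ p ∈ Γ, e p.1 = p.2 := by
  obtain ⟨s, hs, hs'⟩ := exists_countable_span hV
  obtain ⟨t, ht, ht'⟩ := exists_countable_span hV'
  obtain ⟨Δ, hΔ, hi', h1, h2⟩ := exists_generic (s := s) (t := t) hΓ hi hs ht
    (fun Γ hΓ hi v _ => h.exists_extension hΓ hi v) (fun Γ hΓ hi v _ => by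
      have : FiniteDimensional k (swapGraph Γ) := by unfold swapGraph; infer_instance
      obtain ⟨Γ', h1, h2, h3, p, hp, rfl⟩ := h'.exists_extension this hi.swap v
      refine ⟨swapGraph Γ', fun q hq => mem_swapGraph.2 (h1 (mem_swapGraph.2 hq)), ?_, h3.swap,
        ⟨p.swap, mem_swapGraph.2 hp, rfl⟩⟩
      unfold swapGraph
      infer_instance)
  rw [hs', top_le_iff] at h1
  rw [ht', top_le_iff] at h2
  obtain ⟨f, hf, hN, -, hf'⟩ := hi'.exists_linearMap h1
  have hsurj : Function.Surjective f := by
    intro y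
    obtain ⟨p, hp, rfl⟩ : y ∈ Δ.map (LinearMap.snd k V V') := h2 ▸ mem_top
    exact ⟨p.1, hf' p hp⟩
  exact ⟨LinearEquiv.ofBijective f ⟨hf.1, hsurj⟩, hf.2, hN, fun p hp => hf' p (hΔ hp)⟩

end BackAndForth

end MultiQuad

namespace MultiQuad
open Submodule

/-! ### Stable subspaces and equivariant endomorphisms -/

section Invariant

variable {ι k V : Type*} [Field k] [AddCommGroup V] [Module k V]

theorem mem_Aut {ω : MultiQuad ι k V} {g : V ≃ₗ[k] V} :
    g ∈ ω.Aut ↔ ∀ i x y, ω.form i (g x) (g y) = ω.form i x y := Iff.rfl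

/-- The subspace is stable under the automorphism group. -/
def Inv (ω : MultiQuad ι k V) (N : Submodule k V) : Prop :=
  ∀ g ∈ ω.Aut, ∀ x ∈ N, g x ∈ N

/-- The linear map commutes with the automorphism group. -/
def Commutes (ω : MultiQuad ι k V) (φ : V →ₗ[k] V) : Prop :=
  ∀ g ∈ ω.Aut, ∀ x, φ (g x) = g (φ x)

/-- The space is nonzero and has no proper nonzero invariant subspace. -/
def Irred (ω : MultiQuad ι k V) : Prop :=
  Nontrivial V ∧ ∀ N, ω.Inv N → N = ⊥ ∨ N = ⊤

end Invariant

section ExtSelf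

variable {ι k V V' W : Type*} [Field k] [AddCommGroup V] [Module k V] [AddCommGroup V']
    [Module k V']
  [AddCommGroup W] [Module k W] {ω : MultiQuad ι k V} {ω' : MultiQuad ι k V'}

/-- The graph relating two embeddings. -/
theorem isPartialIso_range {N : Submodule k V} {N' : Submodule k V'} {η : MultiQuad ι k W}
    {f : W →ₗ[k] V} {g : W →ₗ[k] V'} (hf : IsEmbedding η ω f) (hg : IsEmbedding η ω' g)
    (hN : ∀ x, f x ∈ N ↔ g x ∈ N') :
    IsPartialIso ω N ω' N' (LinearMap.range (f.prod g)) where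
  form_eq := by
    rintro _ ⟨x, rfl⟩ _ ⟨y, rfl⟩ i
    exact (hf.2 i x y).trans (hg.2 i x y).symm
  zero_iff := by
    rintro _ ⟨x, rfl⟩
    exact (map_eq_zero_iff f hf.1).trans (map_eq_zero_iff g hg.1).symm
  mem_iff := by
    rintro _ ⟨x, rfl⟩
    exact hN x

theorem isPartialIso_singleton {N : Submodule k V} {N' : Submodule k V'} {v : V} {v' : V'}
    (hv : v ≠ 0) (hv' : v' ≠ 0) (h : ∀ i, ω.form i v v = ω'.form i v' v') (hN : v ∈ N ↔ v' ∈ N') :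
    IsPartialIso ω N ω' N' (span k {(v, v')}) := by
  have := (isPartialIso_bot (ω := ω) (N := N) (ω' := ω') (N' := N')).extend (v := v) (v' := v')
    (by simpa using hv) (by simpa using hv') (by simp) h (by simpa using hN)
  rwa [bot_sup_eq] at this

variable {N : Submodule k V}

theorem ExtProp.exists_aut (h : ExtProp ω N ω N) (hr : Module.rank k V ≤ Cardinal.aleph0) {v v' : V}
    (hv : v ≠ 0) (hv' : v' ≠ 0) (hvv : ∀ i, ω.form i v v = ω.form i v' v') (hN : v ∈ N ↔ v' ∈ N) :
    ∃ g ∈ ω.Aut, g v = v' := by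
  obtain ⟨e, he, -, he'⟩ := h.exists_equiv h (Γ := span k {(v, v')}) inferInstance
    (isPartialIso_singleton hv hv' hvv hN) hr hr
  exact ⟨e, he, he' _ (mem_span_singleton_self _)⟩

/-- If `φ v` is not a multiple of `v`, the extension property gives an automorphism fixing `v` and
moving `φ v` off its own line, whereas equivariance forces it to fix `φ v`. So every vector is an
eigenvector and `φ` is a scalar. -/
theorem ExtProp.exists_smul_of_commutes (h : ExtProp ω N ω N)
    (hr : Module.rank k V ≤ Cardinal.aleph0) {φ : V →ₗ[k] V} (hφ : ω.Commutes φ) :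
    ∃ c : k, ∀ v, φ v = c • v := by
  have key : ∀ v, φ v ∈ span k {v} := by
    intro v
    rcases eq_or_ne v 0 with rfl | hv
    · simp
    by_contra hw
    have hi := isPartialIso_singleton (ω := ω) (ω' := ω) (N := N) (N' := N) hv hv (fun _ => rfl)
      Iff.rfl
    obtain ⟨w', hw', hi'⟩ := h _ inferInstance hi (φ v) (by
      rw [Submodule.map_span]
      simpa using hw) (span k {φ v}) inferInstance
    obtain ⟨e, he, -, he'⟩ := h.exists_equiv h inferInstance hi' hr hr
    have e1 : e v = v := he' (v, v) (mem_sup_left (mem_span_singleton_self _))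
    have e2 : e (φ v) = w' := he' (φ v, w') (mem_sup_right (mem_span_singleton_self _))
    have e3 := hφ e he v
    rw [e1, e2] at e3
    apply hw'
    rw [← e3]
    exact mem_span_singleton_self _
  by_cases hV : Nontrivial V
  · simp only [mem_span_singleton] at key
    choose c hc using key
    obtain ⟨v, hv⟩ := exists_ne (0 : V)
    refine ⟨c v, fun w => ?_⟩
    by_cases hli : LinearIndependent k ![v, w]
    · rw [LinearIndependent.pair_iff] at hli
      have h1 := hc (v + w)
      rw [map_add, ← hc v, ← hc w, smul_add] at h1
      have := hli (c (v + w) - c v) (c (v + w) - c w) (by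
        rw [← sub_eq_zero.2 h1]
        module)
      rw [← hc w, ← sub_eq_zero.1 this.1, sub_eq_zero.1 this.2]
    · rw [LinearIndependent.pair_iff' hv] at hli
      push Not at hli
      obtain ⟨a, rfl⟩ := hli
      rw [map_smul, ← hc v, smul_comm]
  · rw [not_nontrivial_iff_subsingleton] at hV
    exact ⟨0, fun v => Subsingleton.elim _ _⟩

end ExtSelf

/-! ### Jointly nondegenerate spaces -/

section Nondeg

variable {ι k V V' W : Type*} [Field k] [AddCommGroup V] [Module k V] [AddCommGroup V']
    [Module k V']
  [AddCommGroup W] [Module k W] [Fintype ι]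

/-- The forms are jointly nondegenerate: `(xᵢ) ↦ ∑ ωᵢ(xᵢ, -)` is injective. -/
def Nondeg (ω : MultiQuad ι k V) : Prop := ∀ x : ι → V, ∑ i, ω.form i (x i) = 0 → x = 0

variable {ω : MultiQuad ι k V} {ω' : MultiQuad ι k V'}

/-- A vector `x` in the kernel of `∑ c_i ω_i` gives the relation `(c_i x)_i`, so such kernels
vanish. -/
theorem Nondeg.strong (h : ω.Nondeg) (hV : ¬ FiniteDimensional k V) : ω.Strong := by
  refine ⟨hV, fun c hc hker => hV ?_⟩
  obtain ⟨i, hi⟩ := Function.ne_iff.1 hc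
  have : LinearMap.ker (∑ i, c i • ω.form i) = ⊥ := by
    rw [LinearMap.ker_eq_bot']
    intro x hx
    have := congrFun (h (fun i => c i • x) (by simpa [LinearMap.sum_apply] using hx)) i
    exact (smul_eq_zero.1 this).resolve_left hi
  rw [this] at hker
  exact (Module.Finite.iff_cofg_bot k V).1 hker

/-- Joint nondegeneracy says that the conditions imposed by the various forms on `F` are
independent, so linear duality solves them. A further vector orthogonal to `F` adjusts the diagonal.
-/
theorem Nondeg.realize [IsAlgClosed k] (h2 : (2 : k) ≠ 0) (h : ω.Nondeg)
    (hV : ¬ FiniteDimensional k V) (F : Submodule k V) [FiniteDimensional k F]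
    (c : ι → Module.Dual k V) (d : ι → k) :
    ∃ v ∉ F, (∀ i, ∀ a ∈ F, ω.form i v a = c i a) ∧ ∀ i, ω.form i v v = d i := by
  classical
  let f : (ι → F) →ₗ[k] Module.Dual k V :=
    ∑ i, (ω.form i) ∘ₗ F.subtype ∘ₗ LinearMap.proj i
  let c' : (ι → F) →ₗ[k] k := ∑ i, (c i).comp (F.subtype.comp (LinearMap.proj i))
  have hf : LinearMap.ker f = ⊥ := by
    rw [LinearMap.ker_eq_bot']
    intro x hx
    have := h (fun i => x i) (by simpa [f, LinearMap.sum_apply] using hx)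
    funext i
    exact Subtype.ext (congrFun this i)
  obtain ⟨v₀, hv₀⟩ := exists_eval_eq f c' (by rw [hf]; exact bot_le)
  have hv : ∀ i, ∀ a ∈ F, ω.form i v₀ a = c i a := by
    intro i a ha
    have := hv₀ (Pi.single i ⟨a, ha⟩)
    simp only [f, c', LinearMap.sum_apply, LinearMap.comp_apply, LinearMap.proj_apply,
      Submodule.subtype_apply] at this
    rw [Finset.sum_eq_single i, Finset.sum_eq_single i] at this
    · rw [form_comm]
      simpa using this
    · intro j _ hj
      simp [hj]
    · simp
    · intro j _ hj
      simp [hj]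
    · simp
  obtain ⟨C, hC, hp⟩ := ω.cofg_perp_forms F
  obtain ⟨x, hx, hxF, hxd⟩ := (h.strong hV).exists_add_apply_self_eq h2 hC v₀ d
    (not_cofg_of_finiteDimensional hV F)
  refine ⟨v₀ + x, hxF, fun i a ha => ?_, hxd⟩
  rw [map_add, LinearMap.add_apply, hv i a ha, form_comm, hp x hx a ha, add_zero]

/-- The marked subspaces are `⊥`, so they carry no information beyond injectivity. Nothing is asked
of the source `ω`, hence universality follows as well as uniqueness. -/
theorem Nondeg.extProp [IsAlgClosed k] (h2 : (2 : k) ≠ 0) (h : ω'.Nondeg)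
    (hV : ¬ FiniteDimensional k V') (ω : MultiQuad ι k V) : ExtProp ω ⊥ ω' ⊥ := by
  intro Γ hΓ hi v hv F hF
  choose c hc using fun i => hi.exists_dual (ω.form i v)
  obtain ⟨v', hv', h1, h3⟩ := h.realize h2 hV (F ⊔ Γ.map (LinearMap.snd k V V')) c
    (fun i => ω.form i v v)
  have hmem : ∀ p ∈ Γ, p.2 ∈ F ⊔ Γ.map (LinearMap.snd k V V') := fun p hp =>
    mem_sup_right ⟨p, hp, rfl⟩
  refine ⟨v', fun h => hv' (mem_sup_left h), hi.extend hv (fun h => hv' (mem_sup_right h))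
    (fun p hp i => ?_) (fun i => (h3 i).symm) (fun p hp => ?_)⟩
  · rw [h1 i _ (hmem p hp), hc i p hp]
  · refine iff_of_false (fun h0 => hv ?_) (fun h0 => hv' ?_)
    · refine ⟨-p, Γ.neg_mem hp, ?_⟩
      simpa using (eq_neg_of_add_eq_zero_left ((mem_bot k).1 h0)).symm
    · rw [eq_neg_of_add_eq_zero_left ((mem_bot k).1 h0)]
      exact Submodule.neg_mem _ (hmem p hp)

theorem rank_le_aleph0_of_finite (k V : Type*) [Field k] [AddCommGroup V] [Module k V]
    [FiniteDimensional k V] : Module.rank k V ≤ Cardinal.aleph0 :=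
  (Module.rank_lt_aleph0 k V).le

theorem Nondeg.exists_embedding [IsAlgClosed k] (h2 : (2 : k) ≠ 0) (h : ω.Nondeg)
    (hV : ¬ FiniteDimensional k V) (η : MultiQuad ι k W) (hW : Module.rank k W ≤ Cardinal.aleph0) :
    ∃ f : W →ₗ[k] V, IsEmbedding η ω f := by
  obtain ⟨f, hf, -⟩ := (h.extProp h2 hV η).exists_embedding (Γ := ⊥) inferInstance isPartialIso_bot
    hW
  exact ⟨f, hf⟩

theorem Nondeg.universal [IsAlgClosed k] (h2 : (2 : k) ≠ 0) (h : ω.Nondeg)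
    (hV : ¬ FiniteDimensional k V) : ω.Universal :=
  fun _ η => h.exists_embedding h2 hV η (rank_le_aleph0_of_finite _ _)

theorem Nondeg.exists_equiv [IsAlgClosed k] (h2 : (2 : k) ≠ 0) (h : ω.Nondeg) (h' : ω'.Nondeg)
    (hV : ¬ FiniteDimensional k V) (hV' : ¬ FiniteDimensional k V')
    (hr : Module.rank k V ≤ Cardinal.aleph0) (hr' : Module.rank k V' ≤ Cardinal.aleph0) :
    Isomorphic ω ω' := by
  obtain ⟨e, he, -⟩ := (h'.extProp h2 hV' ω).exists_equiv (h.extProp h2 hV ω') (Γ := ⊥)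
    inferInstance isPartialIso_bot hr hr'
  exact ⟨e, he⟩

theorem Nondeg.homogeneous [IsAlgClosed k] (h2 : (2 : k) ≠ 0) (h : ω.Nondeg)
    (hV : ¬ FiniteDimensional k V) (hr : Module.rank k V ≤ Cardinal.aleph0) : ω.Homogeneous := by
  intro n η f g hf hg
  obtain ⟨e, he, -, he'⟩ := (h.extProp h2 hV ω).exists_equiv (h.extProp h2 hV ω)
    (Γ := LinearMap.range (g.prod f)) inferInstance
    (isPartialIso_range hg hf fun x => by
      simp [map_eq_zero_iff f hf.1, map_eq_zero_iff g hg.1]) hr hr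
  exact ⟨e, he, fun x => (he' _ ⟨x, rfl⟩).symm⟩

/-- Nonzero vectors with equal diagonal values are conjugate, and any `u` is a difference of two
conjugates of a given nonzero `v`. -/
theorem Nondeg.irred [IsAlgClosed k] (h2 : (2 : k) ≠ 0) (h : ω.Nondeg)
    (hV : ¬ FiniteDimensional k V) (hr : Module.rank k V ≤ Cardinal.aleph0) : ω.Irred := by
  refine ⟨not_subsingleton_iff_nontrivial.1 fun _ => hV inferInstance, fun N hN => ?_⟩
  rw [or_iff_not_imp_left]
  intro hne
  obtain ⟨v, hvN, hv⟩ := (Submodule.ne_bot_iff N).1 hne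
  rw [eq_top_iff]
  rintro u -
  -- With `ω_i(w, u) = ω_i(u, u) / 2`, the vectors `w` and `w - u` have the same diagonal values,
  -- here those of `v`.
  obtain ⟨w, hw, h1, h3⟩ := h.realize h2 hV (span k {u}) (fun i => (2 : k)⁻¹ • ω.form i u)
    (fun i => ω.form i v v)
  have hw0 : w ≠ 0 := fun h0 => hw (h0 ▸ Submodule.zero_mem _)
  have hwu : w - u ≠ 0 := fun h0 => hw (sub_eq_zero.1 h0 ▸ mem_span_singleton_self _)
  obtain ⟨g, hg, rfl⟩ := (h.extProp h2 hV ω).exists_aut hr hv hw0 (fun i => (h3 i).symm)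
    (by simp [hv, hw0])
  obtain ⟨g', hg', hgu⟩ := (h.extProp h2 hV ω).exists_aut hr hv hwu (fun i => by
    have e1 := h1 i u (mem_span_singleton_self _)
    have e2 := form_comm ω i (g v) u
    simp only [map_sub, LinearMap.sub_apply, ← e2, h3, e1, LinearMap.smul_apply, smul_eq_mul]
    field_simp
    ring) (by simp [hv, hwu])
  have : u = g v - g' v := by rw [hgu]; abel
  rw [this]
  exact N.sub_mem (hN g hg v hvN) (hN g' hg' v hvN)

theorem Nondeg.exists_smul_of_commutes [IsAlgClosed k] (h2 : (2 : k) ≠ 0) (h : ω.Nondeg)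
    (hV : ¬ FiniteDimensional k V) (hr : Module.rank k V ≤ Cardinal.aleph0) {φ : V →ₗ[k] V}
    (hφ : ω.Commutes φ) : ∃ c : k, ∀ v, φ v = c • v :=
  (h.extProp h2 hV ω).exists_smul_of_commutes hr hφ

end Nondeg

/-! ### Universal homogeneous spaces are jointly nondegenerate -/

section UniversalHomogeneous

variable {ι k V W : Type*} [Field k] [AddCommGroup V] [Module k V] [AddCommGroup W] [Module k W]
  {ω : MultiQuad ι k V}

theorem Universal.exists_embedding (h : ω.Universal) [FiniteDimensional k W]
    (η : MultiQuad ι k W) : ∃ f : W →ₗ[k] V, IsEmbedding η ω f := by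
  let e := (Module.finBasis k W).equivFun
  obtain ⟨f, hf, hf'⟩ := h _ (η.comap e.symm.toLinearMap)
  refine ⟨f.comp e.toLinearMap, hf.comp e.injective, fun i x y => ?_⟩
  refine (hf' i _ _).trans ?_
  change η.form i (e.symm (e x)) (e.symm (e y)) = _
  simp

theorem Homogeneous.exists_aut (h : ω.Homogeneous) [FiniteDimensional k W]
    {η : MultiQuad ι k W} {f g : W →ₗ[k] V} (hf : IsEmbedding η ω f) (hg : IsEmbedding η ω g) :
    ∃ a ∈ ω.Aut, ∀ x, f x = a (g x) := by
  let e := (Module.finBasis k W).equivFun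
  obtain ⟨a, ha, ha'⟩ := h _ (η.comap e.symm.toLinearMap) (f.comp e.symm.toLinearMap)
    (g.comp e.symm.toLinearMap) ⟨hf.1.comp e.symm.injective, fun i x y => hf.2 i _ _⟩
    ⟨hg.1.comp e.symm.injective, fun i x y => hg.2 i _ _⟩
  exact ⟨a, ha, fun x => by simpa using ha' (e x)⟩

theorem Universal.not_finiteDimensional (h : ω.Universal) : ¬ FiniteDimensional k V := by
  intro hV
  obtain ⟨f, hf, -⟩ := h (Module.finrank k V + 1) ⟨fun _ => 0, fun _ => ⟨fun x y => by simp⟩⟩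
  have := LinearMap.finrank_le_finrank_of_injective hf
  simp at this

/-- A relation among the `x_i` constrains the pairings of every vector of `V` with the span of the
`x_i`. Universality supplies a configuration containing this span and a vector violating the
constraint, and homogeneity moves it onto the given `x_i`. -/
theorem Universal.nondeg [Fintype ι] (hu : ω.Universal) (hh : ω.Homogeneous) : ω.Nondeg := by
  classical
  intro x hx
  by_contra hne
  obtain ⟨j, hj⟩ := Function.ne_iff.1 hne
  obtain ⟨f, hf⟩ : ∃ f : Module.Dual k V, f (x j) = 1 :=
    Module.Projective.exists_dual_ne_zero k hj |>.elim fun f hf =>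
      ⟨(f (x j))⁻¹ • f, by simp [inv_mul_cancel₀ hf]⟩
  let c : ι → Module.Dual k V := Pi.single j f
  let A : Submodule k V := span k (Set.range x)
  have : FiniteDimensional k A := FiniteDimensional.span_of_finite k (Set.finite_range x)
  -- `A` keeps its forms; the new vector `(0, 1)` is isotropic and pairs with `A` through `f`, in
  -- the `j`-th form only.
  let η : MultiQuad ι k (A × k) :=
    { form := fun i => ((ω.form i).comp A.subtype A.subtype).comp (.fst _ _ _) (.fst _ _ _) +
        ((LinearMap.mul k k).comp (LinearMap.snd k A k)).compl₂
          ((c i).comp (A.subtype.comp (LinearMap.fst k A k))) +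
        (((LinearMap.mul k k).comp (LinearMap.snd k A k)).compl₂
          ((c i).comp (A.subtype.comp (LinearMap.fst k A k)))).flip
      symm := fun i => ⟨fun x y => by
        simp [form_comm ω i x.1 y.1]
        ring⟩ }
  obtain ⟨g, hg, hg'⟩ := hu.exists_embedding η
  obtain ⟨a, ha, ha'⟩ := hh.exists_aut (η := ω.restrict A) (f := A.subtype)
    (g := g.comp (LinearMap.inl k A k)) ⟨Subtype.val_injective, fun _ _ _ => rfl⟩
    ⟨hg.comp LinearMap.inl_injective, fun i x y => by
      refine (hg' i _ _).trans ?_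
      simp [η, restrict, comap]⟩
  have key : ∀ i, ω.form i (x i) (a (g (0, 1))) = c i (x i) := by
    intro i
    have h1 := ha' ⟨x i, subset_span ⟨i, rfl⟩⟩
    have h3 : x i = a (g (⟨x i, subset_span ⟨i, rfl⟩⟩, 0)) := h1
    conv_lhs => rw [h3]
    rw [ha, hg']
    simp [η]
  have h0 := LinearMap.congr_fun hx (a (g (0, 1)))
  rw [LinearMap.sum_apply, Finset.sum_congr rfl fun i _ => key i,
    Finset.sum_eq_single j (fun i _ hi => by simp [c, hi]) (by simp)] at h0
  simp [c, hf] at h0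

end UniversalHomogeneous

end MultiQuad

theorem Module.length_eq_two_of_isAtom_of_isCoatom {R M : Type*} [Ring R] [AddCommGroup M]
    [Module R M] {N : Submodule R M} (h1 : IsAtom N) (h2 : IsCoatom N) :
    Module.length R M = 2 := by
  rw [Module.length_eq_add_of_exact N.subtype N.mkQ Subtype.val_injective N.mkQ_surjective
    (LinearMap.exact_subtype_mkQ N), Module.length_eq_one_iff.2 (isSimpleModule_iff_isAtom.2 h1),
    Module.length_eq_one_iff.2 (isSimpleModule_iff_isCoatom.2 h2)]
  norm_num

theorem Module.length_eq_two_iff {R M : Type*} [Ring R] [AddCommGroup M] [Module R M] :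
    Module.length R M = 2 ↔ (∃ N : Submodule R M, N ≠ ⊥ ∧ N ≠ ⊤) ∧
      ∀ N N' : Submodule R M, N < N' → N = ⊥ ∨ N' = ⊤ := by
  constructor
  · intro h
    refine ⟨?_, fun N N' hlt => ?_⟩
    · by_contra! hN
      have : Nontrivial M := by
        rw [← Module.length_pos_iff (R := R), h]
        norm_num
      have hs : IsSimpleModule R M := by
        rw [isSimpleModule_iff]
        exact ⟨fun N => or_iff_not_imp_left.2 (hN N)⟩
      rw [Module.length_eq_one_iff.2 hs] at h
      norm_num at h
    -- A chain `⊥ < N < N' < ⊤` would give `⊤` height at least three.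
    · by_contra! hN
      rw [Module.length_eq_height] at h
      have htop : Order.height (⊤ : Submodule R M) < ⊤ := by rw [h]; exact ENat.natCast_lt_top 2
      have h3 := Order.height_strictMono (lt_top_iff_ne_top.2 hN.2)
        ((Order.height_mono le_top).trans_lt htop)
      have h2 := Order.height_strictMono hlt ((Order.height_mono le_top).trans_lt htop)
      have h1 := Order.height_strictMono (bot_lt_iff_ne_bot.2 hN.1)
        ((Order.height_mono le_top).trans_lt htop)
      rw [h] at h3
      have e1 := Order.add_one_le_of_lt h1
      have e2 := Order.add_one_le_of_lt h2
      have e3 : (1 : ℕ∞) + 1 ≤ Order.height N' :=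
        (add_le_add_left ((le_add_of_nonneg_left bot_le).trans e1) 1).trans e2
      rw [one_add_one_eq_two] at e3
      exact absurd h3 (not_lt.2 e3)
  · rintro ⟨⟨N, hN, hN'⟩, h⟩
    exact Module.length_eq_two_of_isAtom_of_isCoatom
      ⟨hN, fun N' hlt => (h N' N hlt).resolve_right hN'⟩
      ⟨hN', fun N' hlt => (h N N' hlt).resolve_left hN⟩

namespace MultiQuad
open Submodule

/-! ### Length two in terms of stable subspaces -/

section Rep

variable {ι k V : Type*} [Field k] [AddCommGroup V] [Module k V] {ω : MultiQuad ι k V}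

/-- Invariant subspaces as subrepresentations. -/
def Inv.subrep {N : Submodule k V} (h : ω.Inv N) : Subrepresentation ω.rep :=
  ⟨N, fun g x hx => h g g.2 x hx⟩

theorem inv_subrep (σ : Subrepresentation ω.rep) : ω.Inv σ.toSubmodule :=
  fun g hg _ hx => σ.apply_mem_toSubmodule ⟨g, hg⟩ hx

theorem length_eq_two_iff : ω.length = 2 ↔ (∃ N, ω.Inv N ∧ N ≠ ⊥ ∧ N ≠ ⊤) ∧
    ∀ N N', ω.Inv N → ω.Inv N' → N < N' → N = ⊥ ∨ N' = ⊤ := by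
  let e : Subrepresentation ω.rep ≃o Submodule k[ω.Aut] ω.rep.asModule :=
    Subrepresentation.subrepresentationSubmoduleOrderIso
  have hbot : ∀ σ : Subrepresentation ω.rep, e σ = ⊥ ↔ σ.toSubmodule = ⊥ := fun σ => by
    rw [show (⊥ : Submodule k[ω.Aut] ω.rep.asModule) = e ⊥ from e.map_bot.symm, e.apply_eq_iff_eq]
    exact ⟨fun h => by rw [h]; rfl, fun h => Subrepresentation.toSubmodule_injective h⟩
  have htop : ∀ σ : Subrepresentation ω.rep, e σ = ⊤ ↔ σ.toSubmodule = ⊤ := fun σ => by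
    rw [show (⊤ : Submodule k[ω.Aut] ω.rep.asModule) = e ⊤ from e.map_top.symm, e.apply_eq_iff_eq]
    exact ⟨fun h => by rw [h]; rfl, fun h => Subrepresentation.toSubmodule_injective h⟩
  rw [length, Module.length_eq_two_iff]
  refine and_congr ⟨?_, ?_⟩ ⟨?_, ?_⟩
  · rintro ⟨N, hN, hN'⟩
    obtain ⟨σ, rfl⟩ := e.surjective N
    exact ⟨σ.toSubmodule, inv_subrep σ, fun h => hN ((hbot σ).2 h), fun h => hN' ((htop σ).2 h)⟩
  · rintro ⟨N, h, hN, hN'⟩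
    exact ⟨e h.subrep, fun h' => hN ((hbot _).1 h'), fun h' => hN' ((htop _).1 h')⟩
  · intro H N N' h h' hlt
    have := H (e h.subrep) (e h'.subrep) (e.lt_iff_lt.2 hlt)
    rwa [hbot, htop] at this
  · intro H N N' hlt
    obtain ⟨σ, rfl⟩ := e.surjective N
    obtain ⟨σ', rfl⟩ := e.surjective N'
    rw [hbot, htop]
    exact H _ _ (inv_subrep σ) (inv_subrep σ') (e.lt_iff_lt.1 hlt)

theorem length_eq_two_of {N : Submodule k V} (hN : ω.Inv N) (hbot : N ≠ ⊥) (htop : N ≠ ⊤)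
    (hmin : ∀ N', ω.Inv N' → N' ≤ N → N' ≠ ⊥ → N' = N)
    (hmax : ∀ N', ω.Inv N' → N ≤ N' → N' ≠ N → N' = ⊤) : ω.length = 2 := by
  let e : Subrepresentation ω.rep ≃o Submodule k[ω.Aut] ω.rep.asModule :=
    Subrepresentation.subrepresentationSubmoduleOrderIso
  have h1 : IsAtom hN.subrep := by
    refine ⟨fun h => hbot (congrArg Subrepresentation.toSubmodule h), fun σ hlt => ?_⟩
    by_contra hne
    exact hlt.ne (Subrepresentation.toSubmodule_injective (hmin _ (inv_subrep σ) hlt.le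
      fun h => hne (Subrepresentation.toSubmodule_injective h)))
  have h2 : IsCoatom hN.subrep := by
    refine ⟨fun h => htop (congrArg Subrepresentation.toSubmodule h), fun σ hlt => ?_⟩
    exact Subrepresentation.toSubmodule_injective (hmax _ (inv_subrep σ) hlt.le
      fun h => hlt.ne' (Subrepresentation.toSubmodule_injective h))
  exact Module.length_eq_two_of_isAtom_of_isCoatom ((OrderIso.isAtom_iff e _).2 h1)
    ((OrderIso.isCoatom_iff e _).2 h2)

theorem isIrreducible_iff : ω.rep.IsIrreducible ↔ ω.Irred := by
  constructor
  · intro h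
    refine ⟨?_, fun N hN => ?_⟩
    · obtain ⟨σ, τ, hne⟩ := h.exists_pair_ne
      by_contra hV
      rw [not_nontrivial_iff_subsingleton] at hV
      exact hne (Subrepresentation.toSubmodule_injective (Subsingleton.elim _ _))
    · rcases h.eq_bot_or_eq_top hN.subrep with h | h
      · exact .inl (congrArg Subrepresentation.toSubmodule h)
      · exact .inr (congrArg Subrepresentation.toSubmodule h)
  · rintro ⟨hV, h⟩
    refine { exists_pair_ne := ⟨⊥, ⊤, fun he => ?_⟩, eq_bot_or_eq_top := fun σ => ?_ }
    · exact bot_ne_top (α := Submodule k V) (congrArg Subrepresentation.toSubmodule he)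
    · exact (h _ (inv_subrep σ)).imp (fun h => Subrepresentation.toSubmodule_injective h)
        (fun h => Subrepresentation.toSubmodule_injective h)

theorem commutes_toLinearMap (φ : ω.Commutant) : ω.Commutes φ.toLinearMap :=
  fun g hg x => φ.isIntertwining _ _ ⟨g, hg⟩ x

/-- An endomorphism commuting with the automorphism group, as an element of the commutant. -/
def Commutes.toCommutant {φ : V →ₗ[k] V} (h : ω.Commutes φ) : ω.Commutant :=
  { toLinearMap := φ
    isIntertwining' := fun g => LinearMap.ext fun x => h g g.2 x }

theorem Commutes.inv_ker {φ : V →ₗ[k] V} (h : ω.Commutes φ) : ω.Inv (LinearMap.ker φ) :=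
  fun g hg x hx => by
    rw [LinearMap.mem_ker] at hx ⊢
    rw [h g hg, hx, map_zero]

theorem Commutes.inv_map {φ : V →ₗ[k] V} (h : ω.Commutes φ) {N : Submodule k V} (hN : ω.Inv N) :
    ω.Inv (N.map φ) := by
  rintro g hg _ ⟨x, hx, rfl⟩
  exact ⟨g x, hN g hg x hx, h g hg x⟩

theorem Commutes.sub_smul {φ : V →ₗ[k] V} (h : ω.Commutes φ) (c : k) :
    ω.Commutes (φ - c • LinearMap.id) := fun g hg x => by
  simp [h g hg x]

theorem Inv.inf {N N' : Submodule k V} (h : ω.Inv N) (h' : ω.Inv N') : ω.Inv (N ⊓ N') :=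
  fun g hg x hx => ⟨h g hg x hx.1, h' g hg x hx.2⟩

theorem Inv.sup {N N' : Submodule k V} (h : ω.Inv N) (h' : ω.Inv N') : ω.Inv (N ⊔ N') := by
  intro g hg x hx
  obtain ⟨a, ha, b, hb, rfl⟩ := mem_sup.1 hx
  rw [map_add]
  exact add_mem_sup (h g hg a ha) (h' g hg b hb)

theorem inv_top : ω.Inv ⊤ := fun _ _ _ _ => trivial

end Rep

/-! ### Schur's lemma over an uncountable field -/

section Dixmier

variable {ι k V : Type*} [Field k] [AddCommGroup V] [Module k V]

/-- Dixmier's argument: if all `T - c` were invertible, the uncountably many vectors `(T - c)⁻¹ s`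
would be dependent in a space of countable dimension. Clearing denominators gives a nonzero
polynomial `Q` with `Q(T) s = 0`, although `Q(T)` is a nonzero scalar times a product of invertible
factors `T - c`. -/
theorem exists_not_bijective_sub_smul [IsAlgClosed k] [Uncountable k] [Nontrivial V]
    (hr : Module.rank k V ≤ Cardinal.aleph0) (T : V →ₗ[k] V) :
    ∃ c : k, ¬ Function.Bijective (T - c • (LinearMap.id : V →ₗ[k] V)) := by
  classical
  by_contra! H
  obtain ⟨s, hs⟩ := exists_ne (0 : V)
  choose v hv using fun c : k => (H c).2 s
  have hli : ¬ LinearIndependent k v := by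
    intro hli
    have h1 := hli.cardinal_lift_le_rank
    have h2 : Cardinal.aleph0 < Cardinal.mk k := Cardinal.aleph0_lt_mk
    have h3 := (Cardinal.lift_le.2 hr).trans' h1
    rw [Cardinal.lift_aleph0, Cardinal.lift_le_aleph0] at h3
    exact absurd h2 (not_lt.2 h3)
  rw [linearIndependent_iff'] at hli
  push Not at hli
  obtain ⟨t, g, hg, c₀, hc₀, hgc⟩ := hli
  -- The numerator of `∑ g(c) / (X - c)`; it is nonzero because at `c₀` only the summand of `c₀`
  -- survives.
  let Q : Polynomial k := ∑ c ∈ t, Polynomial.C (g c) *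
    ∏ d ∈ t.erase c, (Polynomial.X - Polynomial.C d)
  have hQ : Q ≠ 0 := by
    intro h0
    have h1 := congrArg (Polynomial.eval c₀) h0
    simp only [Q, Polynomial.eval_finsetSum, Polynomial.eval_mul, Polynomial.eval_C,
      Polynomial.eval_prod, Polynomial.eval_sub, Polynomial.eval_X, Polynomial.eval_zero] at h1
    rw [Finset.sum_eq_single c₀ (fun c hc hne => ?_) (fun h => absurd hc₀ h)] at h1
    · refine (mul_ne_zero hgc (Finset.prod_ne_zero_iff.2 fun d hd => ?_)) h1
      exact sub_ne_zero.2 (Finset.ne_of_mem_erase hd).symm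
    · rw [Finset.prod_eq_zero (Finset.mem_erase.2 ⟨hne.symm, hc₀⟩) (sub_self c₀), mul_zero]
  have hQs : Polynomial.aeval T Q s = 0 := by
    have h1 := congrArg (Polynomial.aeval T (∏ d ∈ t, (Polynomial.X - Polynomial.C d))) hg
    rw [map_zero, map_sum] at h1
    rw [← h1]
    simp only [Q, map_sum, LinearMap.sum_apply]
    refine Finset.sum_congr rfl fun c hc => ?_
    rw [map_smul, ← Finset.prod_erase_mul _ _ hc, map_mul, map_mul, Module.End.mul_apply,
      Module.End.mul_apply, Polynomial.aeval_C, Module.algebraMap_end_apply]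
    congr 2
    rw [← hv c]
    simp [Algebra.algebraMap_eq_smul_one]
  have hunit : IsUnit (Polynomial.aeval T Q) := by
    rw [(IsAlgClosed.splits Q).eq_prod_roots, map_mul]
    refine IsUnit.mul ?_ ?_
    · rw [Polynomial.aeval_C]
      exact (IsUnit.mk0 _ (Polynomial.leadingCoeff_ne_zero.2 hQ)).map _
    · generalize Q.roots = m
      induction m using Multiset.induction with
      | empty => simp
      | cons a m ih =>
        rw [Multiset.map_cons, Multiset.prod_cons, map_mul]
        refine IsUnit.mul ?_ ih
        rw [Module.End.isUnit_iff]
        convert H a using 2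
        ext x
        simp [Module.algebraMap_end_apply]
  rw [Module.End.isUnit_iff] at hunit
  exact hs ((map_eq_zero_iff _ hunit.1).1 hQs)

theorem Irred.exists_smul_of_commutes [IsAlgClosed k] [Uncountable k] {ω : MultiQuad ι k V}
    (h : ω.Irred) (hr : Module.rank k V ≤ Cardinal.aleph0) {φ : V →ₗ[k] V} (hφ : ω.Commutes φ) :
    ∃ c : k, ∀ v, φ v = c • v := by
  have := h.1
  obtain ⟨c, hc⟩ := exists_not_bijective_sub_smul hr φ
  refine ⟨c, fun v => ?_⟩
  have hφ' := hφ.sub_smul c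
  suffices φ - c • LinearMap.id = 0 by
    have := LinearMap.congr_fun this v
    simpa [sub_eq_zero] using this
  rcases h.2 _ hφ'.inv_ker with hk | hk
  · rcases h.2 _ (hφ'.inv_map inv_top) with hm | hm
    · rwa [Submodule.map_top, LinearMap.range_eq_bot] at hm
    · rw [Submodule.map_top] at hm
      exact (hc ⟨LinearMap.ker_eq_bot.1 hk, LinearMap.range_eq_top.1 hm⟩).elim
  · exact LinearMap.ker_eq_top.1 hk

/-- Among the relations `∑ ω_i(x_i, -) = 0`, those of minimal support form a copy of `V`: a
coordinate determines the others, and these depend on it equivariantly, hence by scalars. Such a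
relation is a linear dependence between the forms. -/
theorem Irred.nondeg [IsAlgClosed k] [Uncountable k] [Fintype ι] {ω : MultiQuad ι k V}
    (h : ω.Irred) (hr : Module.rank k V ≤ Cardinal.aleph0)
    (hli : ∀ c : ι → k, ∑ i, c i • ω.form i = 0 → c = 0) :
    ω.Nondeg := by
  classical
  suffices H : ∀ J : Finset ι, ∀ x : ι → V, (∀ i ∉ J, x i = 0) → ∑ i, ω.form i (x i) = 0 → x = 0
    from fun x hx => H Finset.univ x (by simp) hx
  intro J
  induction J using Finset.induction with
  | empty => exact fun x hx _ => funext fun i => hx i (by simp)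
  | insert j J hj ih =>
    by_contra! hne
    obtain ⟨x, hxJ, hx, hx0⟩ := hne
    -- The relations supported on `insert j J`. By induction the `j`-th coordinate is injective on
    -- `K`; its image is stable and nonzero, hence all of `V`.
    let K : Submodule k (ι → V) :=
      { carrier := {x | (∀ i ∉ insert j J, x i = 0) ∧ ∑ i, ω.form i (x i) = 0}
        zero_mem' := by simp
        add_mem' := fun {a b} ha hb => ⟨fun i hi => by simp [ha.1 i hi, hb.1 i hi], by
          simp [Finset.sum_add_distrib, ha.2, hb.2]⟩
        smul_mem' := fun c a ha => ⟨fun i hi => by simp [ha.1 i hi], by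
          simp [← Finset.smul_sum, ha.2]⟩ }
    let π : ι → K →ₗ[k] V := fun i => (LinearMap.proj i).comp K.subtype
    have hinj : Function.Injective (π j) := by
      rw [← LinearMap.ker_eq_bot, LinearMap.ker_eq_bot']
      rintro ⟨y, hy⟩ h0
      refine Subtype.ext (ih y (fun i hi => ?_) hy.2)
      by_cases hij : i = j
      · rw [hij]; exact h0
      · exact hy.1 i (by simp [hij, hi])
    have hact : ∀ g ∈ ω.Aut, ∀ y ∈ K, (fun i => g (y i)) ∈ K := by
      refine fun g hg y hy => ⟨fun i hi => by simp [hy.1 i hi], ?_⟩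
      ext z
      have h1 := LinearMap.congr_fun hy.2 (g.symm z)
      simp only [LinearMap.sum_apply, LinearMap.zero_apply] at h1 ⊢
      rw [← h1]
      refine Finset.sum_congr rfl fun i _ => ?_
      rw [← hg i (y i) (g.symm z), LinearEquiv.apply_symm_apply]
    have hsurj : Function.Surjective (π j) := by
      rw [← LinearMap.range_eq_top]
      refine (h.2 _ ?_).resolve_left fun hb => hx0 ?_
      · rintro g hg _ ⟨y, rfl⟩
        exact ⟨⟨_, hact g hg y y.2⟩, rfl⟩
      · rw [LinearMap.range_eq_bot] at hb
        have := hinj (a₁ := ⟨x, hxJ, hx⟩) (a₂ := 0) (by rw [hb]; rfl)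
        exact congrArg Subtype.val this
    let e := LinearEquiv.ofBijective (π j) ⟨hinj, hsurj⟩
    have hT : ∀ i, ω.Commutes ((π i).comp e.symm.toLinearMap) := by
      intro i g hg v
      obtain ⟨y, rfl⟩ := e.surjective v
      have : g (e y) = e ⟨_, hact g hg y y.2⟩ := rfl
      rw [this]
      simp [π]
    choose c hc using fun i => h.exists_smul_of_commutes hr (hT i)
    have hsum : ∑ i, c i • ω.form i = 0 := by
      ext v z
      have h1 := LinearMap.congr_fun (e.symm v).2.2 z
      rw [LinearMap.zero_apply] at h1
      rw [LinearMap.zero_apply, LinearMap.zero_apply, ← h1]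
      simp only [LinearMap.sum_apply, LinearMap.smul_apply]
      refine Finset.sum_congr rfl fun i _ => ?_
      have h3 : (e.symm v).1 i = c i • v := hc i v
      rw [h3, map_smul, LinearMap.smul_apply]
    have hcj : c j = 0 := congrFun (hli c hsum) j
    have := h.1
    obtain ⟨v, hv⟩ := exists_ne (0 : V)
    have h1 : e (e.symm v) = c j • v := hc j v
    rw [LinearEquiv.apply_symm_apply, hcj, zero_smul] at h1
    exact hv h1

theorem Nondeg.eq_zero_of_sum_smul_eq_zero [Fintype ι] [Nontrivial V] {ω : MultiQuad ι k V}
    (h : ω.Nondeg) {c : ι → k} (hc : ∑ i, c i • ω.form i = 0) : c = 0 := by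
  obtain ⟨v, hv⟩ := exists_ne (0 : V)
  funext i
  have := congrFun (h (fun i => c i • v) (by
    have := LinearMap.congr_fun hc v
    simpa [LinearMap.sum_apply] using this)) i
  exact (smul_eq_zero.1 this).resolve_right hv

end Dixmier

end MultiQuad

/-- The natural numbers below `d`, as a standard type with `d` elements. -/
abbrev Idx (d : ℕ∞) : Type := {n : ℕ // (n : ℕ∞) < d}

namespace MultiQuad
open Submodule Module

/-! ### Orthonormal bases and reflections -/

section Basis

variable {k V : Type*} [Field k] [AddCommGroup V] [Module k V]

theorem nonempty_basis_nat (hr : Module.rank k V ≤ Cardinal.aleph0)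
    (hV : ¬ FiniteDimensional k V) : Nonempty (Basis ℕ k V) := by
  have h : Cardinal.aleph0 ≤ Module.rank k V := by
    rw [← not_lt, Module.rank_lt_aleph0_iff]
    exact hV
  let b := Basis.ofVectorSpace k V
  have h1 : Cardinal.mk (Basis.ofVectorSpaceIndex k V) = Cardinal.aleph0 := by
    rw [b.mk_eq_rank'']
    exact le_antisymm hr h
  obtain ⟨e⟩ := Cardinal.denumerable_iff.2 h1
  exact ⟨b.reindex (Denumerable.eqv _)⟩

theorem nonempty_basis_idx (hr : Module.rank k V ≤ Cardinal.aleph0) :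
    Nonempty (Basis (Idx (Cardinal.toENat (Module.rank k V))) k V) := by
  by_cases hV : FiniteDimensional k V
  · have h : Cardinal.toENat (Module.rank k V) = (finrank k V : ℕ) := by
      rw [← Module.finrank_eq_rank, Cardinal.toENat_nat]
    let e : Fin (finrank k V) ≃ Idx (Cardinal.toENat (Module.rank k V)) :=
      { toFun := fun i => ⟨i, by rw [h]; exact_mod_cast i.2⟩
        invFun := fun i => ⟨i, Nat.cast_lt.1 (i.2.trans_eq h)⟩
        left_inv := fun i => rfl
        right_inv := fun i => rfl }
    exact ⟨(finBasis k V).reindex e⟩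
  · obtain ⟨b⟩ := nonempty_basis_nat hr hV
    have h : Cardinal.toENat (Module.rank k V) = ⊤ := by
      rw [Cardinal.toENat_eq_top, ← not_lt, Module.rank_lt_aleph0_iff]
      exact hV
    let e : ℕ ≃ Idx (Cardinal.toENat (Module.rank k V)) :=
      { toFun := fun i => ⟨i, by rw [h]; exact ENat.natCast_lt_top i⟩
        invFun := fun i => i
        left_inv := fun i => rfl
        right_inv := fun i => rfl }
    exact ⟨b.reindex e⟩

/-- The bilinear form with a given Gram matrix in a basis. -/
def gramForm {κ : Type*} (b : Basis κ k V) (M : κ → κ → k) : LinearMap.BilinForm k V :=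
  b.constr k fun i => b.constr k (M i)

@[simp] theorem gramForm_basis {κ : Type*} (b : Basis κ k V) (M : κ → κ → k) (i j : κ) :
    gramForm b M (b i) (b j) = M i j := by
  simp [gramForm]

theorem isSymm_of_basis {κ : Type*} (b : Basis κ k V) {B : LinearMap.BilinForm k V}
    (h : ∀ i j, B (b i) (b j) = B (b j) (b i)) : B.IsSymm := by
  have : B = B.flip := LinearMap.BilinForm.ext_basis b fun i j => h i j
  exact ⟨fun x y => LinearMap.congr_fun (LinearMap.congr_fun this x) y⟩

theorem gramForm_symm {κ : Type*} (b : Basis κ k V) {M : κ → κ → k} (h : ∀ i j, M i j = M j i) :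
    (gramForm b M).IsSymm :=
  isSymm_of_basis b fun i j => by simp [h i j]

/-- A single symmetric form as a multi-quadratic space. -/
def single (B : LinearMap.BilinForm k V) (hB : B.IsSymm) : MultiQuad Unit k V :=
  ⟨fun _ => B, fun _ => hB⟩

theorem single_nondeg {B : LinearMap.BilinForm k V} {hB : B.IsSymm} (h : ∀ x, B x = 0 → x = 0) :
    (single B hB).Nondeg :=
  fun x hx => funext fun i => h (x i) (by simpa [single] using hx)

theorem apply_basis_of_orthonormal {κ : Type*} [DecidableEq κ] {b : Basis κ k V}
    {B : LinearMap.BilinForm k V} (h : ∀ i j, B (b i) (b j) = if i = j then 1 else 0)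
    (x : V) (j : κ) : B x (b j) = b.repr x j := by
  have : B.flip (b j) = b.coord j := b.ext fun i => by
    simp [h, Finsupp.single_apply]
  exact LinearMap.congr_fun this x

/-- In finite dimension an orthogonal basis is rescaled by square roots. In countably infinite
dimension, uniqueness of the nondegenerate space with one form carries over the basis of the
standard example. -/
theorem exists_orthonormal_basis [IsAlgClosed k] (h2 : (2 : k) ≠ 0)
    (hr : Module.rank k V ≤ Cardinal.aleph0) {B : LinearMap.BilinForm k V} (hB : B.IsSymm)
    (hnd : ∀ x, B x = 0 → x = 0) :
    ∃ b : Basis (Idx (Cardinal.toENat (Module.rank k V))) k V,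
      ∀ i j, B (b i) (b j) = if i = j then 1 else 0 := by
  suffices H : ∃ (κ : Type) (b : Basis κ k V) (_ : DecidableEq κ),
      ∀ i j, B (b i) (b j) = if i = j then 1 else 0 by
    obtain ⟨κ, b, _, h⟩ := H
    obtain ⟨b'⟩ := nonempty_basis_idx hr
    let e := b.indexEquiv b'
    exact ⟨b.reindex e, fun i j => by simp [h]⟩
  by_cases hV : FiniteDimensional k V
  · have : Invertible (2 : k) := invertibleOfNonzero h2
    obtain ⟨v, hv⟩ := LinearMap.BilinForm.exists_orthogonal_basis
      (LinearMap.BilinForm.isSymm_iff.1 hB)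
    rw [LinearMap.isOrthoᵢ_def] at hv
    have hne : ∀ i, B (v i) (v i) ≠ 0 := by
      intro i h0
      refine v.ne_zero i (hnd _ (v.ext fun j => ?_))
      rw [LinearMap.zero_apply]
      by_cases hij : i = j
      · rw [← hij, h0]
      · exact hv i j hij
    choose s hs using fun i => IsAlgClosed.exists_eq_mul_self (B (v i) (v i))
    have hs0 : ∀ i, s i ≠ 0 := fun i h0 => hne i (by rw [hs, h0, zero_mul])
    refine ⟨_, v.unitsSMul (fun i => (Units.mk0 (s i) (hs0 i))⁻¹), inferInstance, fun i j => ?_⟩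
    simp only [Basis.unitsSMul_apply, Units.smul_def, map_smul, LinearMap.smul_apply, smul_eq_mul,
      Units.val_inv_eq_inv_val, Units.val_mk0]
    split_ifs with hij
    · rw [← hij, hs]
      field_simp [hs0 i]
    · rw [hv i j hij]
      simp
  · obtain ⟨b⟩ := nonempty_basis_nat hr hV
    let D : LinearMap.BilinForm k V := gramForm b fun i j => if i = j then 1 else 0
    have hD : ∀ i j, D (b i) (b j) = if i = j then 1 else 0 := fun i j => gramForm_basis _ _ _ _
    have hDs : D.IsSymm := gramForm_symm b fun i j => by simp [eq_comm]
    have hDn : ∀ x, D x = 0 → x = 0 := fun x hx => b.ext_elem fun i => by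
      rw [← apply_basis_of_orthonormal hD, hx]
      simp
    obtain ⟨e, he⟩ := Nondeg.exists_equiv h2 (single_nondeg (hB := hDs) hDn)
      (single_nondeg (hB := hB) hnd) hV hV hr hr
    exact ⟨ℕ, b.map e, inferInstance, fun i j => (he () _ _).trans (hD i j)⟩

/-- The reflection in a vector `v` with `B v v ≠ 0`. -/
def reflection (B : LinearMap.BilinForm k V) (v : V) (hv : B v v ≠ 0) : V ≃ₗ[k] V :=
  LinearEquiv.ofInvolutive (LinearMap.id - (2 * (B v v)⁻¹) • (B.flip v).smulRight v) fun x => by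
    simp only [LinearMap.sub_apply, LinearMap.id_apply, LinearMap.smul_apply,
      LinearMap.smulRight_apply, map_sub, map_smul, smul_smul, smul_sub]
    rw [show B.flip v x = B x v from rfl, show B.flip v v = B v v from rfl]
    match_scalars <;> field_simp
    ring

theorem reflection_apply {B : LinearMap.BilinForm k V} {v : V} (hv : B v v ≠ 0) (x : V) :
    reflection B v hv x = x - (2 * (B v v)⁻¹ * B x v) • v := by
  simp [reflection, LinearEquiv.ofInvolutive, smul_smul]

theorem reflection_isometry {B : LinearMap.BilinForm k V} (hB : B.IsSymm) {v : V}
    (hv : B v v ≠ 0) (x y : V) : B (reflection B v hv x) (reflection B v hv y) = B x y := by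
  have : B v y = B y v := hB.eq v y
  simp only [reflection_apply, map_sub, map_smul, LinearMap.sub_apply, LinearMap.smul_apply,
    smul_eq_mul, this]
  field_simp
  ring

/-- Since `x` minus its reflection in `v` is a multiple of `v`, a stable subspace contains every
anisotropic `v` that is not orthogonal to it. -/
theorem eq_top_of_isometry_invariant {κ : Type*} [DecidableEq κ] (h2 : (2 : k) ≠ 0)
    {B : LinearMap.BilinForm k V} (hB : B.IsSymm) {b : Basis κ k V}
    (hb : ∀ i j, B (b i) (b j) = if i = j then 1 else 0) {N : Submodule k V} (hN : N ≠ ⊥)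
    (hinv : ∀ g : V ≃ₗ[k] V, (∀ x y, B (g x) (g y) = B x y) → ∀ x ∈ N, g x ∈ N) : N = ⊤ := by
  obtain ⟨x, hxN, hx⟩ := (Submodule.ne_bot_iff N).1 hN
  have key : ∀ x ∈ N, ∀ v, B v v ≠ 0 → B x v ≠ 0 → v ∈ N := by
    intro x hx v hv hxv
    have h1 := N.sub_mem hx (hinv _ (reflection_isometry hB hv) x hx)
    rw [reflection_apply, sub_sub_cancel] at h1
    exact (N.smul_mem_iff (mul_ne_zero (mul_ne_zero h2 (inv_ne_zero hv)) hxv)).1 h1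
  obtain ⟨i, hi⟩ : ∃ i, b.repr x i ≠ 0 := by
    by_contra! h
    exact hx (b.ext_elem fun i => by simp [h i])
  have hbi : b i ∈ N := key x hxN _ (by simp [hb]) (by rwa [apply_basis_of_orthonormal hb])
  rw [eq_top_iff, ← b.span_eq, span_le]
  rintro _ ⟨j, rfl⟩
  by_cases hij : i = j
  · rwa [← hij]
  -- The vector `b i + b j` has norm `2` and pairs to `1` with `b i`, so it is reached from `b i`
  -- even though `b j` is orthogonal to `b i`.
  · have h1 : b i + b j ∈ N := key _ hbi _ (by
      simp [hb, hij, Ne.symm hij, one_add_one_eq_two, h2]) (by simp [hb, hij])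
    exact (Submodule.add_mem_iff_right N hbi).1 h1

/-- A map commuting with the reflection in `v` preserves its `-1`-eigenline, so anisotropic vectors
are eigenvectors. The eigenvalues of `b i` and `b j` agree because `b i + b j` is anisotropic too.
-/
theorem exists_smul_of_commutes_isometry {κ : Type*} [DecidableEq κ] (h2 : (2 : k) ≠ 0)
    {B : LinearMap.BilinForm k V} (hB : B.IsSymm) {b : Basis κ k V}
    (hb : ∀ i j, B (b i) (b j) = if i = j then 1 else 0) {φ : V →ₗ[k] V}
    (hφ : ∀ g : V ≃ₗ[k] V, (∀ x y, B (g x) (g y) = B x y) → ∀ x, φ (g x) = g (φ x)) :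
    ∃ c : k, ∀ x, φ x = c • x := by
  have key : ∀ v, B v v ≠ 0 → ∃ c : k, φ v = c • v := by
    intro v hv
    have h1 := hφ _ (reflection_isometry hB hv) v
    rw [reflection_apply, reflection_apply, inv_mul_cancel_right₀ hv, map_sub, map_smul] at h1
    refine ⟨(B v v)⁻¹ * B (φ v) v, smul_right_injective V h2 ?_⟩
    dsimp only
    rw [smul_smul, ← mul_assoc]
    exact (sub_right_injective h1)
  choose c hc using fun i => key (b i) (by simp [hb])
  have heq : ∀ i j, c i = c j := by
    intro i j
    by_cases hij : i = j
    · rw [hij]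
    · obtain ⟨d, hd⟩ := key (b i + b j) (by
        simp [hb, hij, Ne.symm hij, one_add_one_eq_two, h2])
      rw [map_add, hc, hc] at hd
      have hi := congrArg (fun x => b.repr x i) hd
      have hj := congrArg (fun x => b.repr x j) hd
      simp [hij, Ne.symm hij] at hi hj
      rw [hi, hj]
  by_cases hκ : Nonempty κ
  · obtain ⟨i⟩ := hκ
    refine ⟨c i, fun x => ?_⟩
    have : φ = c i • LinearMap.id := b.ext fun j => by
      rw [hc, heq j i]
      rfl
    rw [this]
    rfl
  · have : φ = 0 := b.ext fun j => (hκ ⟨j⟩).elim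
    exact ⟨0, fun x => by simp [this]⟩

end Basis

/-! ### The pencil of forms -/

section Pencil

variable {k V V' : Type*} [Field k] [AddCommGroup V] [Module k V] [AddCommGroup V'] [Module k V']
  {ω : MultiQuad (Fin 2) k V} {ω' : MultiQuad (Fin 2) k V'}

@[simp] theorem pencil_coe (ω : MultiQuad (Fin 2) k V) (a : k) :
    ω.pencil (a : OnePoint k) = ω.form 0 + a • ω.form 1 := rfl

@[simp] theorem pencil_infty (ω : MultiQuad (Fin 2) k V) : ω.pencil ∞ = ω.form 1 := rfl

theorem pencil_isSymm (ω : MultiQuad (Fin 2) k V) (p : OnePoint k) : (ω.pencil p).IsSymm := by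
  induction p using OnePoint.rec with
  | infty => exact ω.symm 1
  | coe a => exact ⟨fun x y => by simp [form_comm ω _ x y]⟩

theorem pencil_comm (ω : MultiQuad (Fin 2) k V) (p : OnePoint k) (x y : V) :
    ω.pencil p x y = ω.pencil p y x := (ω.pencil_isSymm p).eq x y

theorem pencil_eq_of_form_eq {x y : V} {x' y' : V'}
    (h : ∀ i, ω.form i x y = ω'.form i x' y') (p : OnePoint k) :
    ω.pencil p x y = ω'.pencil p x' y' := by
  induction p using OnePoint.rec with
  | infty => exact h 1
  | coe a => simp [h]

/-- Any two distinct members of the pencil determine both forms. This is the change of coordinates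
that lets all later arguments work with `ω(p)` and `ω(q)` for a convenient pair of points. -/
theorem form_eq_of_pencil_eq {p q : OnePoint k} (hpq : p ≠ q) {x y : V} {x' y' : V'}
    (hp : ω.pencil p x y = ω'.pencil p x' y') (hq : ω.pencil q x y = ω'.pencil q x' y')
      (i : Fin 2) :
    ω.form i x y = ω'.form i x' y' := by
  induction p using OnePoint.rec with
  | infty =>
    induction q using OnePoint.rec with
    | infty => exact (hpq rfl).elim
    | coe b =>
      simp only [pencil_infty, pencil_coe, LinearMap.add_apply, LinearMap.smul_apply,
        smul_eq_mul] at hp hq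
      rw [hp, add_left_inj] at hq
      fin_cases i
      exacts [hq, hp]
  | coe a =>
    induction q using OnePoint.rec with
    | infty =>
      simp only [pencil_infty, pencil_coe, LinearMap.add_apply, LinearMap.smul_apply,
        smul_eq_mul] at hp hq
      rw [hq, add_left_inj] at hp
      fin_cases i
      exacts [hp, hq]
    | coe b =>
      have hab : a - b ≠ 0 := sub_ne_zero.2 fun h => hpq (by rw [h])
      simp only [pencil_coe, LinearMap.add_apply, LinearMap.smul_apply, smul_eq_mul] at hp hq
      have h1 : ω.form 1 x y = ω'.form 1 x' y' :=
        mul_left_cancel₀ hab (by linear_combination hp - hq)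
      rw [h1, add_left_inj] at hp
      fin_cases i
      exacts [hp, h1]

theorem exists_pencil_eq {p q : OnePoint k} (hpq : p ≠ q) {B B' : LinearMap.BilinForm k V}
    (hB : B.IsSymm) (hB' : B'.IsSymm) :
    ∃ ω : MultiQuad (Fin 2) k V, ω.pencil p = B ∧ ω.pencil q = B' := by
  have mk : ∀ a b c d : k, LinearMap.BilinForm.IsSymm (a • B + b • B') := fun a b c d =>
    ⟨fun x y => by
      have h1 : B x y = B y x := hB.eq x y
      have h2 : B' x y = B' y x := hB'.eq x y
      simp [h1, h2]⟩
  let Ω : k → k → k → k → MultiQuad (Fin 2) k V := fun a b c d =>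
    ⟨![a • B + b • B', c • B + d • B'], fun i => by
      fin_cases i
      exacts [mk a b 0 0, mk c d 0 0]⟩
  induction p using OnePoint.rec with
  | infty =>
    induction q using OnePoint.rec with
    | infty => exact (hpq rfl).elim
    | coe b => exact ⟨Ω (-b) 1 1 0, by simp [Ω], by simp [Ω]; module⟩
  | coe a =>
    induction q using OnePoint.rec with
    | infty => exact ⟨Ω 1 (-a) 0 1, by simp [Ω]; module, by simp [Ω]⟩
    | coe b =>
      have hab : a - b ≠ 0 := sub_ne_zero.2 fun h => hpq (by rw [h])
      -- The solution of `ω + a ω' = B`, `ω + b ω' = B'`: `ω' = (B - B') / (a - b)` and `ω = B - a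
      -- ω'`.
      refine ⟨Ω (1 - a * (a - b)⁻¹) (a * (a - b)⁻¹) (a - b)⁻¹ (-(a - b)⁻¹), ?_, ?_⟩
      · simp only [Ω, pencil_coe, Matrix.cons_val_zero, Matrix.cons_val_one]
        module
      · simp only [Ω, pencil_coe, Matrix.cons_val_zero, Matrix.cons_val_one]
        match_scalars
        · field_simp
          ring
        · field_simp
          ring

/-- A point of the projective line different from `p`. -/
def other (p : OnePoint k) : OnePoint k := p.elim ((0 : k) : OnePoint k) fun _ => ∞

theorem ne_other (p : OnePoint k) : p ≠ other p := by
  induction p using OnePoint.rec with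
  | infty => exact OnePoint.infty_ne_coe _
  | coe a => exact OnePoint.coe_ne_infty _

theorem exists_pencil_eq_smul_add {p q r : OnePoint k} (hpq : p ≠ q) (hpr : p ≠ r)
    (ω : MultiQuad (Fin 2) k V) :
    ∃ c c' : k, c ≠ 0 ∧ ω.pencil r = c • ω.pencil q + c' • ω.pencil p := by
  induction p using OnePoint.rec with
  | infty =>
    induction q using OnePoint.rec with
    | infty => exact (hpq rfl).elim
    | coe b =>
      induction r using OnePoint.rec with
      | infty => exact (hpr rfl).elim
      | coe d =>
        refine ⟨1, d - b, one_ne_zero, ?_⟩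
        simp only [pencil_coe, pencil_infty]
        module
  | coe a =>
    induction q using OnePoint.rec with
    | infty =>
      induction r using OnePoint.rec with
      | infty => exact ⟨1, 0, one_ne_zero, by simp⟩
      | coe d =>
        refine ⟨d - a, 1, sub_ne_zero.2 fun h => hpr (by rw [h]), ?_⟩
        simp only [pencil_coe, pencil_infty]
        module
    | coe b =>
      have hab : a - b ≠ 0 := sub_ne_zero.2 fun h => hpq (by rw [h])
      induction r using OnePoint.rec with
      | infty =>
        refine ⟨-(a - b)⁻¹, (a - b)⁻¹, by simpa using hab, ?_⟩
        simp only [pencil_coe, pencil_infty]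
        match_scalars <;> field_simp <;> ring
      | coe d =>
        have had : a - d ≠ 0 := sub_ne_zero.2 fun h => hpr (by rw [h])
        refine ⟨(a - d) * (a - b)⁻¹, 1 - (a - d) * (a - b)⁻¹,
          mul_ne_zero had (inv_ne_zero hab), ?_⟩
        simp only [pencil_coe]
        match_scalars <;> field_simp <;> ring

theorem exists_sum_smul_eq_pencil (ω : MultiQuad (Fin 2) k V) {c : Fin 2 → k} (hc : c ≠ 0) :
    ∃ (p : OnePoint k) (a : k), a ≠ 0 ∧ ∑ i, c i • ω.form i = a • ω.pencil p := by
  rw [Fin.sum_univ_two]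
  by_cases h0 : c 0 = 0
  · refine ⟨∞, c 1, fun h1 => hc (funext fun i => ?_), by simp [h0]⟩
    fin_cases i
    exacts [h0, h1]
  · exact ⟨((c 1 / c 0 : k) : OnePoint k), c 0, h0, by simp [smul_smul, mul_div_cancel₀ _ h0]⟩

theorem mem_nullspace {p : OnePoint k} {x : V} : x ∈ ω.nullspace p ↔ ω.pencil p x = 0 := Iff.rfl

theorem mem_perp_iff_pencil {p q : OnePoint k} (hpq : p ≠ q) {U : Submodule k V} {x : V} :
    x ∈ ω.perp U ↔ ∀ y ∈ U, ω.pencil p x y = 0 ∧ ω.pencil q x y = 0 := by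
  have h0 : ∀ r, ω.pencil r x 0 = 0 := by simp
  constructor
  · intro h y hy
    have h1 : ∀ i, ω.form i x y = ω.form i x 0 := fun i => by rw [h i y hy, map_zero]
    exact ⟨(pencil_eq_of_form_eq h1 p).trans (h0 p), (pencil_eq_of_form_eq h1 q).trans (h0 q)⟩
  · intro h i y hy
    rw [form_eq_of_pencil_eq (ω' := ω) hpq ((h y hy).1.trans (h0 p).symm)
      ((h y hy).2.trans (h0 q).symm) i, map_zero]

/-- Orthogonality to `N_p` under `ω(p)` is automatic, so one other member of the pencil decides. -/
theorem mem_perp_nullspace {p q : OnePoint k} (hpq : p ≠ q) {x : V} :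
    x ∈ ω.perp (ω.nullspace p) ↔ ∀ y ∈ ω.nullspace p, ω.pencil q x y = 0 := by
  rw [mem_perp_iff_pencil hpq]
  refine forall₂_congr fun y hy => and_iff_right ?_
  rw [pencil_comm, mem_nullspace.1 hy, LinearMap.zero_apply]

theorem mem_totalKer {ι : Type*} {ω : MultiQuad ι k V} {x : V} : x ∈ ω.totalKer ↔
    ∀ i, ω.form i x = 0 := by
  simp [totalKer, Submodule.mem_iInf]

theorem mem_totalKer_iff_pencil {p q : OnePoint k} (hpq : p ≠ q) {x : V} :
    x ∈ ω.totalKer ↔ ω.pencil p x = 0 ∧ ω.pencil q x = 0 := by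
  rw [mem_totalKer]
  constructor
  · intro h
    have h1 : ∀ y i, ω.form i x y = ω.form i 0 y := fun y i => by rw [h i]; simp
    exact ⟨LinearMap.ext fun y => (pencil_eq_of_form_eq (h1 y) p).trans (by simp),
      LinearMap.ext fun y => (pencil_eq_of_form_eq (h1 y) q).trans (by simp)⟩
  · intro h i
    ext y
    rw [form_eq_of_pencil_eq (ω' := ω) (x' := 0) (y' := y) hpq (by simp [h.1]) (by simp [h.2]) i]
    simp

theorem mem_Aut_iff_pencil {p q : OnePoint k} (hpq : p ≠ q) {g : V ≃ₗ[k] V} :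
    g ∈ ω.Aut ↔ ∀ x y, ω.pencil p (g x) (g y) = ω.pencil p x y ∧
      ω.pencil q (g x) (g y) = ω.pencil q x y :=
  ⟨fun h x y => ⟨pencil_eq_of_form_eq (fun i => h i x y) p,
    pencil_eq_of_form_eq (fun i => h i x y) q⟩,
    fun h i x y => form_eq_of_pencil_eq hpq (h x y).1 (h x y).2 i⟩

theorem inv_nullspace (ω : MultiQuad (Fin 2) k V) (p : OnePoint k) : ω.Inv (ω.nullspace p) := by
  intro g hg x hx
  rw [mem_nullspace] at hx ⊢
  ext y
  obtain ⟨y, rfl⟩ := g.surjective y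
  rw [pencil_eq_of_form_eq (ω' := ω) (x' := x) (y' := y) (fun i => hg i x y) p, hx]
  rfl

theorem Inv.perp {ι : Type*} {ω : MultiQuad ι k V} {U : Submodule k V} (hU : ω.Inv U) :
    ω.Inv (ω.perp U) := by
  intro g hg x hx i y hy
  have h1 : g.symm y ∈ U := hU g⁻¹ (inv_mem hg) y hy
  rw [← hx i _ h1, ← hg i x (g.symm y), LinearEquiv.apply_symm_apply]

theorem inv_totalKer {ι : Type*} (ω : MultiQuad ι k V) : ω.Inv ω.totalKer := by
  intro g hg x hx
  simp only [totalKer, Submodule.mem_iInf, LinearMap.mem_ker] at hx ⊢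
  intro i
  ext y
  obtain ⟨y, rfl⟩ := g.surjective y
  rw [hg i x y, hx i]
  rfl

theorem Universal.exists_pencil_embedding {W : Type*} [AddCommGroup W] [Module k W]
    [FiniteDimensional k W] (h : ω.Universal) {p q : OnePoint k} (hpq : p ≠ q)
    {B B' : LinearMap.BilinForm k W} (hB : B.IsSymm) (hB' : B'.IsSymm) :
    ∃ f : W →ₗ[k] V, Function.Injective f ∧ ∀ x y, ω.pencil p (f x) (f y) = B x y ∧
      ω.pencil q (f x) (f y) = B' x y := by
  obtain ⟨η, rfl, rfl⟩ := exists_pencil_eq hpq hB hB'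
  obtain ⟨f, hf, hf'⟩ := h.exists_embedding η
  exact ⟨f, hf, fun x y => ⟨pencil_eq_of_form_eq (fun i => hf' i x y) p,
    pencil_eq_of_form_eq (fun i => hf' i x y) q⟩⟩

theorem universal_of_exists_pencil_embedding {p q : OnePoint k} (hpq : p ≠ q)
    (h : ∀ (n : ℕ) (B B' : LinearMap.BilinForm k (Fin n → k)), B.IsSymm → B'.IsSymm →
      ∃ f : (Fin n → k) →ₗ[k] V, Function.Injective f ∧ ∀ x y, ω.pencil p (f x) (f y) = B x y ∧
      ω.pencil q (f x) (f y) = B' x y) : ω.Universal := by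
  intro n η
  obtain ⟨f, hf, hf'⟩ := h n _ _ (η.pencil_isSymm p) (η.pencil_isSymm q)
  exact ⟨f, hf, fun i x y => form_eq_of_pencil_eq hpq (hf' x y).1 (hf' x y).2 i⟩

/-- A universal space contains subspaces of every finite dimension on which `ω(p)` is nondegenerate,
and these inject into the quotient. -/
theorem Universal.not_finiteDimensional_quotient (h : ω.Universal) (p : OnePoint k) :
    ¬ FiniteDimensional k (V ⧸ ω.nullspace p) := by
  intro hfd
  let n := finrank k (V ⧸ ω.nullspace p) + 1
  let B : LinearMap.BilinForm k (Fin n → k) :=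
    gramForm (Pi.basisFun k (Fin n)) fun i j => if i = j then 1 else 0
  have hb : ∀ i j, B (Pi.basisFun k (Fin n) i) (Pi.basisFun k (Fin n) j) = if i = j then 1 else 0 :=
    fun i j => gramForm_basis _ _ _ _
  have hB : B.IsSymm := gramForm_symm _ fun i j => by simp [eq_comm]
  obtain ⟨f, hf, hf'⟩ := h.exists_pencil_embedding (ne_other p) hB (B' := 0) ⟨fun x y => by simp⟩
  have hinj : Function.Injective ((ω.nullspace p).mkQ.comp f) := by
    rw [← LinearMap.ker_eq_bot, LinearMap.ker_eq_bot']
    intro x hx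
    rw [LinearMap.comp_apply, mkQ_apply, Submodule.Quotient.mk_eq_zero, mem_nullspace] at hx
    refine (Pi.basisFun k (Fin n)).ext_elem fun i => ?_
    rw [← apply_basis_of_orthonormal hb, ← (hf' _ _).1, hx]
    simp
  have := LinearMap.finrank_le_finrank_of_injective hinj
  simp [n] at this

end Pencil

end MultiQuad

namespace MultiQuad
open Submodule Module

/-! ### Back-and-forth relative to a nullspace (Types IIb and IIc) -/

section TwoStep

variable {k V V' : Type*} [Field k] [AddCommGroup V] [Module k V] [AddCommGroup V'] [Module k V']

/-- Realization of prescribed values of the forms, by vectors in the nullspace of `ω(p)` and by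
vectors outside of it; `P` records whether `ω(q)` vanishes on the nullspace. -/
structure TwoStep (ω : MultiQuad (Fin 2) k V) (p q : OnePoint k) (P : Prop) : Prop where
  isotropic : P → ∀ x ∈ ω.nullspace p, ∀ y ∈ ω.nullspace p, ω.pencil q x y = 0
  realize_mem : ∀ A F : Submodule k V, FiniteDimensional k A → FiniteDimensional k F →
    ∀ (c : Dual k V) (d : k), (P → d = 0 ∧ ∀ a ∈ A, a ∈ ω.nullspace p → c a = 0) →
    ∃ v ∈ ω.nullspace p, v ∉ F ∧ (∀ a ∈ A, ω.pencil q v a = c a) ∧ ω.pencil q v v = d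
  realize_notMem : ∀ A F : Submodule k V, FiniteDimensional k A → FiniteDimensional k F →
    ∀ (c c' : Dual k V) (d d' : k), (∀ a ∈ A, a ∈ ω.nullspace p → c a = 0) →
    ∃ v ∉ F ⊔ ω.nullspace p, (∀ a ∈ A, ω.pencil p v a = c a ∧ ω.pencil q v a = c' a) ∧
      ω.pencil p v v = d ∧ ω.pencil q v v = d'

variable {ω : MultiQuad (Fin 2) k V} {ω' : MultiQuad (Fin 2) k V'} {p q : OnePoint k} {P : Prop}

theorem TwoStep.extProp (hpq : p ≠ q) (h : ω.TwoStep p q P) (h' : ω'.TwoStep p q P) :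
    ExtProp ω (ω.nullspace p) ω' (ω'.nullspace p) := by
  intro Γ hΓ hi v hv F hF
  set A' := Γ.map (LinearMap.snd k V V') with hA'
  have hmem : ∀ r ∈ Γ, r.2 ∈ A' := fun r hr => ⟨r, hr, rfl⟩
  -- If a translate of `v` by the domain lies in `N_p`, that translate is extended and the
  -- translation is undone afterwards. Otherwise the image must be sought outside `N_p` modulo the
  -- range.
  by_cases hvN : ∃ r ∈ Γ, v + r.1 ∈ ω.nullspace p
  · obtain ⟨r, hr, hn⟩ := hvN
    set n := v + r.1 with hn'
    have hnΓ : n ∉ Γ.map (LinearMap.fst k V V') := by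
      rintro ⟨s, hs, hs'⟩
      refine hv ⟨s - r, Γ.sub_mem hs hr, ?_⟩
      have : s.1 = v + r.1 := hs'
      simp [this]
    obtain ⟨c, hc⟩ := hi.exists_dual (ω.pencil q n)
    obtain ⟨n', hn'N, hn'F, h1, h3⟩ := h'.realize_mem A' (F ⊔ A') inferInstance inferInstance c
      (ω.pencil q n n) (by
        refine fun hP => ⟨h.isotropic hP _ hn _ hn, ?_⟩
        rintro _ ⟨s, hs, rfl⟩ hsN
        refine (hc s hs).trans ?_
        exact h.isotropic hP _ hn _ ((hi.mem_iff s hs).2 hsN))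
    rw [mem_nullspace] at hn hn'N
    have hext := hi.extend (v := n) (v' := n') hnΓ (fun h => hn'F (mem_sup_right h))
      (fun s hs => form_eq_of_pencil_eq hpq (by rw [hn, hn'N]; rfl)
        (by rw [h1 _ (hmem s hs), hc s hs]))
      (form_eq_of_pencil_eq hpq (by rw [hn, hn'N]; rfl) h3.symm)
      (fun s hs => by
        rw [Submodule.add_mem_iff_right _ hn, Submodule.add_mem_iff_right _ hn'N]
        exact hi.mem_iff s hs)
    refine ⟨n' - r.2, fun h0 => hn'F ?_, hext.mono ?_⟩
    · have := add_mem_sup h0 (hmem r hr)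
      rwa [sub_add_cancel] at this
    · refine sup_le le_sup_left ?_
      rw [span_singleton_le_iff_mem]
      have : (v, n' - r.2) = (n, n') - r := by ext <;> simp [hn']
      rw [this]
      exact Submodule.sub_mem _ (mem_sup_right (mem_span_singleton_self _)) (mem_sup_left hr)
  · push Not at hvN
    obtain ⟨c, hc⟩ := hi.exists_dual (ω.pencil p v)
    obtain ⟨c', hc'⟩ := hi.exists_dual (ω.pencil q v)
    obtain ⟨v', hv', h1, h3, h4⟩ := h'.realize_notMem A' (F ⊔ A') inferInstance inferInstance c c'
      (ω.pencil p v v) (ω.pencil q v v) (by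
        rintro _ ⟨s, hs, rfl⟩ hsN
        refine (hc s hs).trans ?_
        rw [pencil_comm, mem_nullspace.1 ((hi.mem_iff s hs).2 hsN)]
        rfl)
    refine ⟨v', fun h => hv' (mem_sup_left (mem_sup_left h)), hi.extend hv
      (fun h => hv' (mem_sup_left (mem_sup_right h)))
      (fun s hs => form_eq_of_pencil_eq hpq ?_ ?_)
      (form_eq_of_pencil_eq hpq h3.symm h4.symm) (fun s hs => ?_)⟩
    · rw [(h1 _ (hmem s hs)).1, hc s hs]
    · rw [(h1 _ (hmem s hs)).2, hc' s hs]
    · refine iff_of_false (hvN s hs) (fun h0 => hv' ?_)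
      have := add_mem_sup (mem_sup_right (S := F) (neg_mem (hmem s hs))) h0
      simpa using this

theorem TwoStep.isomorphic (hpq : p ≠ q) (h : ω.TwoStep p q P) (h' : ω'.TwoStep p q P)
    (hr : Module.rank k V ≤ Cardinal.aleph0) (hr' : Module.rank k V' ≤ Cardinal.aleph0) :
    ω.Isomorphic ω' := by
  obtain ⟨e, he, -⟩ := (h.extProp hpq h').exists_equiv (h'.extProp hpq h) (Γ := ⊥) inferInstance
    isPartialIso_bot hr hr'
  exact ⟨e, he⟩

theorem TwoStep.exists_smul_of_commutes (hpq : p ≠ q) (h : ω.TwoStep p q P)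
    (hr : Module.rank k V ≤ Cardinal.aleph0) {φ : V →ₗ[k] V} (hφ : ω.Commutes φ) :
    ∃ c : k, ∀ v, φ v = c • v :=
  (h.extProp hpq h).exists_smul_of_commutes hr hφ

/-- The difference-of-conjugates argument of `Nondeg.irred`, run once inside `N_p` for minimality
and once outside it for maximality. -/
theorem TwoStep.length_eq_two (h2 : (2 : k) ≠ 0) (hpq : p ≠ q) (h : ω.TwoStep p q P)
    (hr : Module.rank k V ≤ Cardinal.aleph0) : ω.length = 2 := by
  have half : ∀ {B : LinearMap.BilinForm k V}, B.IsSymm → ∀ {w u : V},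
      B w u = (2 : k)⁻¹ * B u u → B (w - u) (w - u) = B w w := by
    intro B hB w u h0
    have h1 : B u w = B w u := hB.eq u w
    simp only [map_sub, LinearMap.sub_apply, h1, h0]
    field_simp
    ring
  refine length_eq_two_of (inv_nullspace ω p) ?_ ?_ ?_ ?_
  · obtain ⟨v, hv, hv0, -⟩ := h.realize_mem ⊥ ⊥ inferInstance inferInstance 0 0 (by simp)
    exact fun h0 => hv0 (h0 ▸ hv)
  · obtain ⟨v, hv, -⟩ := h.realize_notMem ⊥ ⊥ inferInstance inferInstance 0 0 0 0 (by simp)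
    exact fun h0 => hv (mem_sup_right (h0 ▸ mem_top))
  · intro N hN hle hne
    obtain ⟨v, hvN, hv⟩ := (Submodule.ne_bot_iff N).1 hne
    refine le_antisymm hle fun u hu => ?_
    obtain ⟨w, hwN, hw, h1, h3⟩ := h.realize_mem (span k {u}) (span k {u}) inferInstance
      inferInstance ((2 : k)⁻¹ • ω.pencil q u) (ω.pencil q v v) (by
        refine fun hP => ⟨h.isotropic hP _ (hle hvN) _ (hle hvN), fun a _ ha => ?_⟩
        rw [LinearMap.smul_apply, h.isotropic hP _ hu _ ha, smul_zero])
    have hw0 : w ≠ 0 := fun h0 => hw (h0 ▸ Submodule.zero_mem _)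
    have hwu : w - u ≠ 0 := fun h0 => hw (sub_eq_zero.1 h0 ▸ mem_span_singleton_self _)
    have hwuN := Submodule.sub_mem _ hwN hu
    have hz : ∀ {x y : V}, x ∈ ω.nullspace p → ω.pencil p x y = 0 := fun hx => by
      rw [mem_nullspace.1 hx]; rfl
    obtain ⟨g, hg, hgw⟩ := (h.extProp hpq h).exists_aut hr hv hw0
      (form_eq_of_pencil_eq hpq (by rw [hz hwN, hz (hle hvN)]) h3.symm)
      (iff_of_true (hle hvN) hwN)
    obtain ⟨g', hg', hgu⟩ := (h.extProp hpq h).exists_aut hr hv hwu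
      (form_eq_of_pencil_eq hpq (by rw [hz hwuN, hz (hle hvN)]) (by
        rw [half (ω.pencil_isSymm q) (h1 u (mem_span_singleton_self _)), h3]))
      (iff_of_true (hle hvN) hwuN)
    have : u = g v - g' v := by rw [hgu, hgw]; abel
    rw [this]
    exact N.sub_mem (hN g hg v hvN) (hN g' hg' v hvN)
  · intro N hN hle hne
    obtain ⟨v, hvN, hv⟩ := SetLike.exists_of_lt (lt_of_le_of_ne hle (Ne.symm hne))
    rw [eq_top_iff]
    rintro u -
    by_cases hu : u ∈ ω.nullspace p
    · exact hle hu
    obtain ⟨w, hw, h1, h3, h4⟩ := h.realize_notMem (span k {u}) (span k {u}) inferInstance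
      inferInstance ((2 : k)⁻¹ • ω.pencil p u) ((2 : k)⁻¹ • ω.pencil q u) (ω.pencil p v v)
      (ω.pencil q v v) (by
        intro a ha haN
        obtain ⟨t, rfl⟩ := mem_span_singleton.1 ha
        rcases eq_or_ne t 0 with rfl | ht
        · simp
        · exact (hu ((Submodule.smul_mem_iff _ ht).1 haN)).elim)
    have h1' := h1 u (mem_span_singleton_self _)
    have hwN : w ∉ ω.nullspace p := fun h => hw (mem_sup_right h)
    have hwuN : w - u ∉ ω.nullspace p := fun h => hw (by
      have := add_mem_sup (mem_span_singleton_self u) h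
      simpa using this)
    have ne0 : ∀ {x}, x ∉ ω.nullspace p → x ≠ 0 := fun hx h0 => hx (h0 ▸ Submodule.zero_mem _)
    obtain ⟨g, hg, hgw⟩ := (h.extProp hpq h).exists_aut hr (ne0 hv) (ne0 hwN)
      (form_eq_of_pencil_eq hpq h3.symm h4.symm) (iff_of_false hv hwN)
    obtain ⟨g', hg', hgu⟩ := (h.extProp hpq h).exists_aut hr (ne0 hv) (ne0 hwuN)
      (form_eq_of_pencil_eq hpq (by rw [half (ω.pencil_isSymm p) h1'.1, h3])
        (by rw [half (ω.pencil_isSymm q) h1'.2, h4]))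
      (iff_of_false hv hwuN)
    have : u = g v - g' v := by rw [hgu, hgw]; abel
    rw [this]
    exact N.sub_mem (hN g hg v hvN) (hN g' hg' v hvN)

theorem finiteDimensional_comap_subtype (N F : Submodule k V) [FiniteDimensional k F] :
    FiniteDimensional k (F.comap N.subtype) :=
  FiniteDimensional.of_injective
    ((N.subtype ∘ₗ (F.comap N.subtype).subtype).codRestrict F fun x => x.2)
    fun _ _ h => Subtype.ext (Subtype.ext (congrArg (fun y : F => (y : V)) h))

theorem exists_dual_eq_on {A : Submodule k V} {v : V} (hv : v ∉ A) (f : Dual k V) (t : k) :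
    ∃ c : Dual k V, (∀ a ∈ A, c a = f a) ∧ c v = t := by
  obtain ⟨h, hhv, hhA⟩ := Submodule.exists_le_ker_of_notMem hv
  refine ⟨f + ((t - f v) * (h v)⁻¹) • h, fun a ha => ?_, ?_⟩
  · simp [LinearMap.mem_ker.1 (hhA ha)]
  · simp [hhv]

theorem strong_single_pencil (hq : ¬ FiniteDimensional k (V ⧸ ω.nullspace p)) :
    (single (ω.pencil p) (ω.pencil_isSymm p)).Strong := by
  refine ⟨fun h => hq inferInstance, fun c hc hker => hq ?_⟩
  have hc' : c () ≠ 0 := fun h => hc (funext fun _ => h)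
  have : LinearMap.ker (∑ i, c i • (single (ω.pencil p) (ω.pencil_isSymm p)).form i) =
      ω.nullspace p := by
    ext x
    simp [single, mem_nullspace, hc']
  rwa [this] at hker

/-- The hypothesis `h` makes the linear conditions consistent. The `ω(p)`-diagonal is then adjusted
using the infinite rank of `ω(p)`. The `ω(q)`-diagonal is left open, to be corrected later by
vectors of `N_p`, which are invisible to `ω(p)`. -/
theorem exists_pencil_realize [IsAlgClosed k] (h2 : (2 : k) ≠ 0)
    (hq : ¬ FiniteDimensional k (V ⧸ ω.nullspace p)) (A B F : Submodule k V)
    [FiniteDimensional k A] [FiniteDimensional k B] [FiniteDimensional k F] (c c' : Dual k V)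
      (d : k)
    (h : ∀ a ∈ A, ∀ b ∈ B, ω.pencil p a + ω.pencil q b = 0 → c a + c' b = 0) :
    ∃ v ∉ F ⊔ ω.nullspace p, (∀ a ∈ A, ω.pencil p v a = c a) ∧ (∀ b ∈ B, ω.pencil q v b = c' b) ∧
      ω.pencil p v v = d := by
  let f : (A × B) →ₗ[k] Dual k V :=
    (ω.pencil p ∘ₗ A.subtype).coprod (ω.pencil q ∘ₗ B.subtype)
  let g : Dual k (A × B) := (c ∘ₗ A.subtype).coprod (c' ∘ₗ B.subtype)
  obtain ⟨v₀, hv₀⟩ := exists_eval_eq f g (by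
    rintro ⟨⟨a, ha⟩, ⟨b, hb⟩⟩ h0
    exact h a ha b hb h0)
  obtain ⟨C, hC, hCA⟩ := cofg_perp (ω.pencil p) A
  obtain ⟨C', hC', hCB⟩ := cofg_perp (ω.pencil q) B
  obtain ⟨x, ⟨hx, hx'⟩, hxF, hxd⟩ := (strong_single_pencil hq).exists_add_apply_self_eq h2
    (hC.inf hC') v₀ (fun _ => d) (F := F ⊔ ω.nullspace p) (not_cofg_sup hq)
  refine ⟨v₀ + x, hxF, fun a ha => ?_, fun b hb => ?_, hxd ()⟩
  · have := hv₀ (⟨a, ha⟩, 0)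
    simp only [f, g, LinearMap.coprod_apply, map_zero, add_zero] at this
    rw [pencil_comm, map_add, hCA x hx a ha, add_zero]
    exact this
  · have := hv₀ (0, ⟨b, hb⟩)
    simp only [f, g, LinearMap.coprod_apply, map_zero, zero_add] at this
    rw [pencil_comm, map_add, hCB x hx' b hb, add_zero]
    exact this

theorem exists_mem_pencil_eq (A : Submodule k V) [FiniteDimensional k A] (N : Submodule k V)
    (q : OnePoint k) (c : Dual k V)
    (h : ∀ a ∈ A, (∀ y ∈ N, ω.pencil q a y = 0) → c a = 0) :
    ∃ v ∈ N, ∀ a ∈ A, ω.pencil q v a = c a := by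
  obtain ⟨v, hv⟩ := exists_eval_eq (L := N)
    (((ω.pencil q).domRestrict₁₂ A N)) (c ∘ₗ A.subtype) (by
      rintro ⟨a, ha⟩ h0
      refine h a ha fun y hy => ?_
      exact LinearMap.congr_fun h0 ⟨y, hy⟩)
  exact ⟨v, v.2, fun a ha => (pencil_comm ω q _ _).trans (hv ⟨a, ha⟩)⟩

/-- Since `N_p^⊥ = 0`, the form `ω(q)` is nondegenerate on `N_p` and vectors of `N_p` take arbitrary
`ω(q)`-values on finite-dimensional subspaces. `N_p` is infinite-dimensional because `V` embeds in
its dual. -/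
theorem twoStep_of_perp_eq_bot [IsAlgClosed k] (h2 : (2 : k) ≠ 0) (hpq : p ≠ q)
    (hq : ¬ FiniteDimensional k (V ⧸ ω.nullspace p)) (hN : ω.perp (ω.nullspace p) = ⊥) :
    ω.TwoStep p q False := by
  have hperp : ∀ x, (∀ y ∈ ω.nullspace p, ω.pencil q x y = 0) → x = 0 := fun x hx => by
    have := (mem_perp_nullspace hpq).2 hx
    rwa [hN, mem_bot] at this
  have hNinf : ¬ FiniteDimensional k (ω.nullspace p) := by
    intro hfd
    let f : V →ₗ[k] Dual k (ω.nullspace p) :=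
      ((ω.pencil q).domRestrict (ω.nullspace p)).flip
    have hf : Function.Injective f := by
      rw [← LinearMap.ker_eq_bot, LinearMap.ker_eq_bot']
      intro x hx
      refine hperp x fun y hy => ?_
      rw [pencil_comm]
      exact LinearMap.congr_fun hx ⟨y, hy⟩
    have := FiniteDimensional.of_injective f hf
    exact hq inferInstance
  have hmem : ∀ A F : Submodule k V, FiniteDimensional k A → FiniteDimensional k F →
      ∀ (c : Dual k V) (d : k), ∃ v ∈ ω.nullspace p, v ∉ F ∧
        (∀ a ∈ A, ω.pencil q v a = c a) ∧ ω.pencil q v v = d := by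
    intro A F hA hF c d
    obtain ⟨v₀, hv₀, h1⟩ := exists_mem_pencil_eq A (ω.nullspace p) q c
      (fun a _ ha' => by rw [hperp a ha', map_zero])
    let B : LinearMap.BilinForm k (ω.nullspace p) :=
      (ω.pencil q).comp (ω.nullspace p).subtype (ω.nullspace p).subtype
    have hB : B.IsSymm := ⟨fun x y => pencil_comm ω q x y⟩
    have hnd : (single B hB).Nondeg := single_nondeg fun x hx => Subtype.ext <|
      hperp x fun y hy => LinearMap.congr_fun hx ⟨y, hy⟩
    let G : ω.nullspace p →ₗ[k] Dual k A := ((ω.pencil q).domRestrict₁₂ A (ω.nullspace p)).flip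
    have := finiteDimensional_comap_subtype (ω.nullspace p) F
    obtain ⟨x, hx, hxF, hxd⟩ := (hnd.strong hNinf).exists_add_apply_self_eq h2
      (Submodule.CoFG.ker G) ⟨v₀, hv₀⟩ (fun _ => d) (F := F.comap (ω.nullspace p).subtype)
      (not_cofg_of_finiteDimensional hNinf _)
    refine ⟨v₀ + x, Submodule.add_mem _ hv₀ x.2, hxF, fun a ha => ?_, hxd ()⟩
    have h0 : ω.pencil q a x = 0 := LinearMap.congr_fun hx ⟨a, ha⟩
    rw [map_add, LinearMap.add_apply, h1 a ha, pencil_comm ω q x, h0, add_zero]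
  refine ⟨fun h => h.elim, fun A F hA hF c d _ => hmem A F hA hF c d,
    fun A F hA hF c c' d d' hc => ?_⟩
  obtain ⟨v, hvF, h1, -, h3⟩ := exists_pencil_realize (q := q) h2 hq A ⊥ (F ⊔ A) c 0 d
    (fun a ha b hb h0 => by
      rw [(mem_bot k).1 hb, map_zero, add_zero] at h0 ⊢
      exact hc a ha h0)
  have hvA : v ∉ A := fun h => hvF (mem_sup_left (mem_sup_right h))
  -- The value `0` at `v` makes the correction `n` orthogonal to `v`, so the diagonal of `v + n` is
  -- fixed by the norm of `n` alone.
  obtain ⟨f, hf, hfv⟩ := exists_dual_eq_on hvA (c' - ω.pencil q v) 0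
  obtain ⟨n, hn, -, hnA, hnn⟩ := hmem (A ⊔ span k {v}) ⊥ inferInstance inferInstance f
    (d' - ω.pencil q v v)
  have hnv : ω.pencil q n v = 0 := (hnA v (mem_sup_right (mem_span_singleton_self v))).trans hfv
  have hvn : ω.pencil q v n = 0 := by rw [pencil_comm, hnv]
  have hn0 : ω.pencil p n = 0 := hn
  have hvn0 : ω.pencil p v n = 0 := by rw [pencil_comm, hn0]; rfl
  refine ⟨v + n, fun h => hvF ?_, fun a ha => ⟨?_, ?_⟩, ?_, ?_⟩
  · have := Submodule.sub_mem _ h (mem_sup_right (S := F) hn)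
    rw [add_sub_cancel_right] at this
    exact (sup_le_sup_right le_sup_left _ : F ⊔ ω.nullspace p ≤ F ⊔ A ⊔ ω.nullspace p) this
  · rw [map_add, LinearMap.add_apply, hn0, h1 a ha]
    simp
  · rw [map_add, LinearMap.add_apply, hnA a (mem_sup_left ha), hf a ha]
    simp
  · simp [hn0, hvn0, h3]
  · simp [hnv, hvn, hnn]

/-- Here `N_p` is totally isotropic, so corrections from `N_p` change neither `ω(q)`-values on `N_p`
nor `ω(p)`. The `ω(q)`-values on `A ∩ N_p` must therefore be imposed together with the
`ω(p)`-values, and `hdisj` is what makes the two sets of conditions compatible. -/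
theorem twoStep_of_perp_eq_self [IsAlgClosed k] (h2 : (2 : k) ≠ 0) (hpq : p ≠ q)
    (hq : ¬ FiniteDimensional k (V ⧸ ω.nullspace p))
    (hN : ω.perp (ω.nullspace p) = ω.nullspace p)
    (hdisj : ∀ n ∈ ω.nullspace p, ∀ m, ω.pencil p m + ω.pencil q n = 0 → n = 0) :
    ω.TwoStep p q True := by
  have hperp : ∀ x, (∀ y ∈ ω.nullspace p, ω.pencil q x y = 0) ↔ x ∈ ω.nullspace p := fun x => by
    rw [← mem_perp_nullspace hpq, hN]
  have hNinf : ¬ FiniteDimensional k (ω.nullspace p) := by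
    intro hfd
    let f : V →ₗ[k] Dual k (ω.nullspace p) :=
      ((ω.pencil q).domRestrict (ω.nullspace p)).flip
    have hf : LinearMap.ker f ≤ ω.nullspace p := by
      intro x hx
      refine (hperp x).1 fun y hy => ?_
      rw [pencil_comm]
      exact LinearMap.congr_fun hx ⟨y, hy⟩
    exact hq ((Submodule.CoFG.ker f).of_le hf)
  have hmem : ∀ A F : Submodule k V, FiniteDimensional k A → FiniteDimensional k F →
      ∀ c : Dual k V, (∀ a ∈ A, a ∈ ω.nullspace p → c a = 0) → ∃ v ∈ ω.nullspace p, v ∉ F ∧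
        ∀ a ∈ A, ω.pencil q v a = c a := by
    intro A F hA hF c hc
    obtain ⟨v₀, hv₀, h1⟩ := exists_mem_pencil_eq A (ω.nullspace p) q c
      (fun a ha ha' => hc a ha ((hperp a).1 ha'))
    by_cases hvF : v₀ ∈ F
    · let G : ω.nullspace p →ₗ[k] Dual k A := ((ω.pencil q).domRestrict₁₂ A (ω.nullspace p)).flip
      have := finiteDimensional_comap_subtype (ω.nullspace p) F
      obtain ⟨x, hx, hxF⟩ := CoFG.exists_notMem (Submodule.CoFG.ker G)
        (F := F.comap (ω.nullspace p).subtype) (not_cofg_of_finiteDimensional hNinf _)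
      refine ⟨v₀ + x, Submodule.add_mem _ hv₀ x.2,
        fun h => hxF ((Submodule.add_mem_iff_right F hvF).1 h), fun a ha => ?_⟩
      have h0 : ω.pencil q a x = 0 := LinearMap.congr_fun hx ⟨a, ha⟩
      rw [map_add, LinearMap.add_apply, h1 a ha, pencil_comm ω q x, h0, add_zero]
    · exact ⟨v₀, hv₀, hvF, h1⟩
  have hiso : ∀ x ∈ ω.nullspace p, ∀ y ∈ ω.nullspace p, ω.pencil q x y = 0 := fun x hx =>
    (hperp x).2 hx
  refine ⟨fun _ => hiso, fun A F hA hF c d h => ?_, fun A F hA hF c c' d d' hc => ?_⟩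
  · obtain ⟨rfl, hc⟩ := h trivial
    obtain ⟨v, hv, hvF, h1⟩ := hmem A F hA hF c hc
    exact ⟨v, hv, hvF, h1, hiso v hv v hv⟩
  have : FiniteDimensional k (A ⊓ ω.nullspace p : Submodule k V) :=
    Submodule.finiteDimensional_inf_left _ _
  obtain ⟨v, hvF, h1, h4, h3⟩ := exists_pencil_realize (q := q) h2 hq A (A ⊓ ω.nullspace p)
    (F ⊔ A) c c' d (fun a ha b hb h0 => by
      have hb0 := hdisj b hb.2 a h0
      rw [hb0, map_zero, add_zero] at h0 ⊢
      exact hc a ha h0)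
  have hvA : v ∉ A := fun h => hvF (mem_sup_left (mem_sup_right h))
  -- As `n` is isotropic, the `ω(q)`-diagonal of `v + n` changes by twice the pairing of `n` with
  -- `v`; hence the factor one half.
  obtain ⟨f, hf, hfv⟩ := exists_dual_eq_on hvA (c' - ω.pencil q v)
    ((2 : k)⁻¹ * (d' - ω.pencil q v v))
  obtain ⟨n, hn, -, hnA⟩ := hmem (A ⊔ span k {v}) ⊥ inferInstance inferInstance f (by
    intro x hx hxN
    obtain ⟨a, ha, b, hb, rfl⟩ := mem_sup.1 hx
    obtain ⟨t, rfl⟩ := mem_span_singleton.1 hb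
    rcases eq_or_ne t 0 with rfl | ht
    · rw [zero_smul, add_zero] at hxN ⊢
      rw [hf a ha, LinearMap.sub_apply, h4 a ⟨ha, hxN⟩, sub_self]
    · refine (hvF ?_).elim
      have h5 : t • v ∈ (F ⊔ A) ⊔ ω.nullspace p := by
        have := Submodule.sub_mem _ (mem_sup_right (S := F ⊔ A) hxN)
          (mem_sup_left (T := ω.nullspace p) (mem_sup_right (S := F) ha))
        rwa [add_sub_cancel_left] at this
      exact (Submodule.smul_mem_iff _ ht).1 h5)
  have hnv := (hnA v (mem_sup_right (mem_span_singleton_self v))).trans hfv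
  have hvn := (pencil_comm ω q v n).trans hnv
  have hn0 : ω.pencil p n = 0 := hn
  have hvn0 : ω.pencil p v n = 0 := by rw [pencil_comm, hn0]; rfl
  refine ⟨v + n, fun h => hvF ?_, fun a ha => ⟨?_, ?_⟩, ?_, ?_⟩
  · have := Submodule.sub_mem _ h (mem_sup_right (S := F) hn)
    rw [add_sub_cancel_right] at this
    exact (sup_le_sup_right le_sup_left _ : F ⊔ ω.nullspace p ≤ F ⊔ A ⊔ ω.nullspace p) this
  · rw [map_add, LinearMap.add_apply, hn0, h1 a ha]
    simp
  · rw [map_add, LinearMap.add_apply, hnA a (mem_sup_left ha), hf a ha]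
    simp
  · simp [hn0, hvn0, h3]
  · simp only [map_add, LinearMap.add_apply, hnv, hvn, hiso n hn n hn]
    field_simp
    ring

end TwoStep

end MultiQuad

namespace MultiQuad
open Submodule Module

/-! ### Recognizing the commutant algebras -/

section AlgEquiv

variable {k R : Type*} [Field k] [Semiring R] [Algebra k R]

theorem nonempty_algEquiv_of_scalar [Nontrivial R] (h : ∀ r : R, ∃ c : k, r = c • 1) :
    Nonempty (R ≃ₐ[k] k) := by
  refine ⟨(AlgEquiv.ofBijective (Algebra.ofId k R) ⟨(algebraMap k R).injective, fun r => ?_⟩).symm⟩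
  obtain ⟨c, rfl⟩ := h r
  exact ⟨c, Algebra.algebraMap_eq_smul_one c⟩

theorem nonempty_algEquiv_dualNumber {e : R} (he : e * e = 0)
    (hinj : ∀ a c : k, a • (1 : R) + c • e = 0 → a = 0 ∧ c = 0)
    (hsurj : ∀ r : R, ∃ a c : k, r = a • 1 + c • e) :
    Nonempty (R ≃ₐ[k] (Polynomial k ⧸ Ideal.span {(Polynomial.X ^ 2 : Polynomial k)})) := by
  let f : (Polynomial k ⧸ Ideal.span {(Polynomial.X ^ 2 : Polynomial k)}) →ₐ[k] R :=
    Ideal.Quotient.liftₐ _ (Polynomial.aeval e) fun p hp => by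
      obtain ⟨q, rfl⟩ := Ideal.mem_span_singleton.1 hp
      simp [pow_two, he]
  refine ⟨(AlgEquiv.ofBijective f ⟨?_, fun r => ?_⟩).symm⟩
  · rw [injective_iff_map_eq_zero]
    intro x hx
    obtain ⟨p, rfl⟩ := Ideal.Quotient.mk_surjective x
    have hp : Polynomial.aeval e p = 0 := hx
    -- Division by `X ^ 2`: only the linear remainder is seen by `e`, since `e * e = 0`.
    have hdecomp : p = Polynomial.X ^ 2 * p.divX.divX +
        (Polynomial.C (p.coeff 0) + Polynomial.C (p.coeff 1) * Polynomial.X) := by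
      conv_lhs => rw [← Polynomial.divX_mul_X_add p, ← Polynomial.divX_mul_X_add p.divX]
      rw [Polynomial.coeff_divX]
      ring
    rw [hdecomp] at hp
    simp only [map_add, map_mul, Polynomial.aeval_X, Polynomial.aeval_C, pow_two, he,
      zero_mul, zero_add, Algebra.algebraMap_eq_smul_one, smul_mul_assoc, one_mul] at hp
    obtain ⟨h0, h1⟩ := hinj _ _ hp
    rw [h0, h1] at hdecomp
    rw [Ideal.Quotient.eq_zero_iff_mem, Ideal.mem_span_singleton, hdecomp]
    simp
  · obtain ⟨a, c, rfl⟩ := hsurj r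
    refine ⟨Ideal.Quotient.mk _ (Polynomial.C a + Polynomial.C c * Polynomial.X), ?_⟩
    change Polynomial.aeval e _ = _
    simp [Algebra.algebraMap_eq_smul_one]

theorem nonempty_algEquiv_prod {e f : R} (he : e * e = e) (hf : f * f = f) (hef : e * f = 0)
    (hfe : f * e = 0) (h1 : e + f = 1) (he0 : e ≠ 0) (hf0 : f ≠ 0)
    (hsurj : ∀ r : R, ∃ a b : k, r = a • e + b • f) : Nonempty (R ≃ₐ[k] k × k) := by
  let g : k × k →ₐ[k] R := AlgHom.ofLinearMap
    ((LinearMap.toSpanSingleton k R e).coprod (LinearMap.toSpanSingleton k R f))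
    (by simp [h1]) (fun x y => by
      simp [mul_add, add_mul, he, hf, hef, hfe, smul_smul, mul_comm])
  refine ⟨(AlgEquiv.ofBijective g ⟨?_, fun r => ?_⟩).symm⟩
  · rw [injective_iff_map_eq_zero]
    rintro ⟨a, b⟩ hx
    have hx' : a • e + b • f = 0 := hx
    have ha := congrArg (· * e) hx'
    have hb := congrArg (· * f) hx'
    simp only [add_mul, smul_mul_assoc, he, hf, hef, hfe, smul_zero, add_zero, zero_add,
      zero_mul] at ha hb
    have hz : ∀ {c : k} {x : R}, c • x = 0 → x ≠ 0 → c = 0 := fun {c x} hcx hx => by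
      by_contra hc
      exact hx (by rw [← inv_smul_smul₀ hc x, hcx, smul_zero])
    rw [hz ha he0, hz hb hf0]
    rfl
  · obtain ⟨a, b, rfl⟩ := hsurj r
    exact ⟨(a, b), rfl⟩

end AlgEquiv

section Commutant

variable {ι k V : Type*} [Field k] [AddCommGroup V] [Module k V] {ω : MultiQuad ι k V}

theorem commutant_ext {φ ψ : ω.Commutant} (h : ∀ x, φ.toLinearMap x = ψ.toLinearMap x) : φ = ψ :=
  Representation.IntertwiningMap.ext (LinearMap.ext h)

theorem commutant_scalar [Nontrivial V]
    (h : ∀ φ : V →ₗ[k] V, ω.Commutes φ → ∃ c : k, ∀ x, φ x = c • x) :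
    Nonempty (ω.Commutant ≃ₐ[k] k) := by
  have : Nontrivial ω.Commutant := by
    obtain ⟨x, hx⟩ := exists_ne (0 : V)
    exact ⟨1, 0, fun h => hx (congrArg (fun φ : ω.Commutant => φ.toLinearMap x) h)⟩
  refine nonempty_algEquiv_of_scalar fun φ => ?_
  obtain ⟨c, hc⟩ := h _ (commutes_toLinearMap φ)
  exact ⟨c, commutant_ext hc⟩

end Commutant

/-! ### Types IIb and IIc, and the vanishing of the other nullspaces -/

section TypeII

variable {k V V' : Type*} [Field k] [AddCommGroup V] [Module k V] [AddCommGroup V'] [Module k V']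
  {ω : MultiQuad (Fin 2) k V} {ω' : MultiQuad (Fin 2) k V'} {p q : OnePoint k}

/-- Two distinct nullspaces are orthogonal under the whole pencil, so `N_q ≤ N_p^⊥ ≤ N_p`, and `N_p
∩ N_q` is the total kernel. -/
theorem nullspace_eq_bot (hpq : p ≠ q) (h : ω.perp (ω.nullspace p) ≤ ω.nullspace p)
    (h' : ω.totalKer = ⊥) : ω.nullspace q = ⊥ := by
  rw [Submodule.eq_bot_iff]
  intro x hx
  rw [mem_nullspace] at hx
  have hxp := h ((mem_perp_nullspace hpq).2 fun y _ => by rw [hx]; rfl)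
  have : x ∈ ω.totalKer := (mem_totalKer_iff_pencil hpq).2 ⟨hxp, hx⟩
  rwa [h', mem_bot] at this

theorem TypeIIb.twoStep [IsAlgClosed k] (h2 : (2 : k) ≠ 0) (h : ω.TypeIIb p) :
    ω.TwoStep p (other p) False :=
  twoStep_of_perp_eq_bot h2 (ne_other p) (h.1.not_finiteDimensional_quotient p) h.2.2

theorem TypeIIb.nullspace_eq_bot (h : ω.TypeIIb p) (hpq : p ≠ q) : ω.nullspace q = ⊥ := by
  refine MultiQuad.nullspace_eq_bot hpq (h.2.2 ▸ bot_le) ?_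
  rw [Submodule.eq_bot_iff]
  intro x hx
  have : x ∈ ω.perp (ω.nullspace p) := fun i y _ => by
    rw [mem_totalKer.1 hx i]; rfl
  rwa [h.2.2, mem_bot] at this

theorem TypeIIc.twoStep [IsAlgClosed k] (h2 : (2 : k) ≠ 0) (h : ω.TypeIIc p) :
    ω.TwoStep p (other p) True := by
  obtain ⟨hu, -, hperp, hdep, hker⟩ := h
  refine twoStep_of_perp_eq_self h2 (ne_other p) (hu.not_finiteDimensional_quotient p) hperp ?_
  intro n hn m hmn
  by_contra hn0
  have hli : ¬ LinearIndependent k ![n, m] := by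
    intro hli
    induction p using OnePoint.rec with
    | infty =>
      refine hdep n m ?_ hli
      rw [← hmn]
      simp [other, add_comm]
    | coe a =>
      -- For `p = a` the other point is `∞`, and `ω(a)_m + ω'_n` regroups as `ω_m + ω'_(a m + n)`.
      refine hdep m (a • m + n) ?_ ?_
      · rw [← hmn]
        simp only [other, pencil_coe, OnePoint.elim_some, pencil_infty, LinearMap.add_apply,
          LinearMap.smul_apply, map_add, map_smul]
        abel
      · rw [LinearIndependent.pair_iff] at hli ⊢
        intro s t hst
        obtain ⟨h1, h3⟩ := hli t (s + t * a) (by rw [← hst]; module)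
        rw [h1, zero_mul, add_zero] at h3
        exact ⟨h3, h1⟩
  -- If `m` is a multiple of `n`, it lies in `N_p`, so the relation reduces to `ω(q)_n = 0` and `n`
  -- lies in the total kernel.
  rw [LinearIndependent.pair_iff' hn0] at hli
  push Not at hli
  obtain ⟨c, rfl⟩ := hli
  rw [map_smul, mem_nullspace.1 hn, smul_zero, zero_add] at hmn
  have : n ∈ ω.totalKer := (mem_totalKer_iff_pencil (ne_other p)).2 ⟨hn, hmn⟩
  rw [hker, mem_bot] at this
  exact hn0 this

theorem TypeIIc.nullspace_eq_bot (h : ω.TypeIIc p) (hpq : p ≠ q) : ω.nullspace q = ⊥ :=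
  MultiQuad.nullspace_eq_bot hpq h.2.2.1.le h.2.2.2.2

theorem TypeIIa.totalKer_eq_bot (h : ω.TypeIIa p) : ω.totalKer = ⊥ := by
  rw [Submodule.eq_bot_iff]
  intro x hx
  obtain ⟨hxp, hxq⟩ := (mem_totalKer_iff_pencil (ne_other p)).1 hx
  obtain ⟨T, hT⟩ := h.2.2.2 _ (ne_other p).symm
  obtain ⟨y, hy⟩ := T.surjective ⟨x, hxp⟩
  obtain ⟨y, rfl⟩ := Submodule.Quotient.mk_surjective _ y
  have h1 := hT y
  rw [hy, hxq] at h1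
  have h3 : Submodule.Quotient.mk (p := ω.nullspace p) y = 0 :=
    (Submodule.Quotient.mk_eq_zero _).2 h1.symm
  rw [h3, map_zero] at hy
  exact (congrArg Subtype.val hy).symm

theorem TypeIIa.nullspace_eq_bot (h : ω.TypeIIa p) (hpq : p ≠ q) : ω.nullspace q = ⊥ :=
  MultiQuad.nullspace_eq_bot hpq h.2.2.1.le h.totalKer_eq_bot

end TypeII

/-! ### Type IIa: normal form and commutant -/

section TypeIIa

variable {k V V' : Type*} [Field k] [AddCommGroup V] [Module k V] [AddCommGroup V'] [Module k V']
  {ω : MultiQuad (Fin 2) k V} {ω' : MultiQuad (Fin 2) k V'} {p q : OnePoint k}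

/-- The standard form on `k^(ℕ)`. -/
def dotForm (k : Type*) [Field k] : LinearMap.BilinForm k (ℕ →₀ k) :=
  gramForm Finsupp.basisSingleOne fun i j => if i = j then 1 else 0

theorem dotForm_basis (i j : ℕ) : dotForm k (Finsupp.basisSingleOne i) (Finsupp.basisSingleOne j) =
    if i = j then 1 else 0 := gramForm_basis _ _ _ _

theorem dotForm_isSymm : (dotForm k).IsSymm := gramForm_symm _ fun i j => by simp [eq_comm]

theorem dotForm_comm (x y : ℕ →₀ k) : dotForm k x y = dotForm k y x := dotForm_isSymm.eq x y

theorem dotForm_nondeg (x : ℕ →₀ k) (hx : dotForm k x = 0) : x = 0 :=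
  Finsupp.basisSingleOne.ext_elem fun i => by
    rw [← apply_basis_of_orthonormal dotForm_basis, hx]
    simp

theorem exists_orthonormal_basis_nat [IsAlgClosed k] (h2 : (2 : k) ≠ 0)
    (hr : Module.rank k V ≤ Cardinal.aleph0) (hV : ¬ FiniteDimensional k V)
    {B : LinearMap.BilinForm k V} (hB : B.IsSymm)
    (hnd : ∀ x, B x = 0 → x = 0) :
    ∃ b : Basis ℕ k V, ∀ i j, B (b i) (b j) = if i = j then 1 else 0 := by
  obtain ⟨b, hb⟩ := exists_orthonormal_basis h2 hr hB hnd
  obtain ⟨b'⟩ := nonempty_basis_nat hr hV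
  exact ⟨b.reindex (b.indexEquiv b'), fun i j => by simp [hb]⟩

/-- A complement `C` of `N_p` carries an orthonormal basis for `ω(p)`, and `T` turns it into a dual
basis of `N_p` for `ω(q)`. It remains to tilt `C` by a map `s : C → N_p` so that `ω(q)` vanishes on
it, using that `N_p` is isotropic. -/
theorem TypeIIa.exists_coordinates [IsAlgClosed k] (h2 : (2 : k) ≠ 0)
    (hr : Module.rank k V ≤ Cardinal.aleph0) (h : ω.TypeIIa p) :
    ∃ e : ((ℕ →₀ k) × (ℕ →₀ k)) ≃ₗ[k] V, ∀ x y, ω.pencil p (e x) (e y) = dotForm k x.1 y.1 ∧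
      ω.pencil (other p) (e x) (e y) = dotForm k x.1 y.2 + dotForm k x.2 y.1 := by
  obtain ⟨T, hT⟩ := h.2.2.2 _ (ne_other p).symm
  let N := ω.nullspace p
  have hN : N = ω.nullspace p := rfl
  set α := ω.pencil p with hα
  set β := ω.pencil (other p) with hβ
  have hαN : ∀ n ∈ N, α n = 0 := fun n hn => hn
  have hαN' : ∀ n ∈ N, ∀ x, α x n = 0 := fun n hn x => by
    rw [hα, pencil_comm, ← hα, hαN n hn]; rfl
  obtain ⟨C, hC⟩ := N.exists_isCompl
  let E : (V ⧸ N) ≃ₗ[k] C := Submodule.quotientEquivOfIsCompl N C hC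
  have hE : ∀ c : C, E.symm c = Submodule.Quotient.mk (c : V) := fun c => rfl
  let αC : LinearMap.BilinForm k C := α.comp C.subtype C.subtype
  have hαC : αC.IsSymm := ⟨fun x y => pencil_comm ω p x y⟩
  have hαCn : ∀ x, αC x = 0 → x = 0 := by
    intro x hx
    have hxN : (x : V) ∈ N := by
      rw [hN, mem_nullspace]
      ext y
      have hy : y ∈ N ⊔ C := by rw [hC.sup_eq_top]; trivial
      obtain ⟨n, hn, c, hc, rfl⟩ := mem_sup.1 hy
      rw [map_add, ← hα, hαN' n hn, zero_add]
      exact LinearMap.congr_fun hx ⟨c, hc⟩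
    exact Subtype.ext (Submodule.disjoint_def.1 hC.disjoint x hxN x.2)
  have hCinf : ¬ FiniteDimensional k C := fun hfd =>
    h.1.not_finiteDimensional_quotient p E.symm.finiteDimensional
  obtain ⟨b, hb⟩ := exists_orthonormal_basis_nat h2 ((Submodule.rank_le C).trans hr) hCinf hαC hαCn
  let Φ : (ℕ →₀ k) ≃ₗ[k] C := b.repr.symm
  let T' : C ≃ₗ[k] N := E.symm.trans T
  have hT' : ∀ c : C, ∀ y, β (T' c) y = α c y := fun c y => by
    have := LinearMap.congr_fun (hT (c : V)) y
    rwa [← hE c] at this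
  have hβN : ∀ n ∈ N, ∀ n' ∈ N, β n n' = 0 := by
    intro n hn n' hn'
    obtain ⟨c, hc⟩ := T'.surjective ⟨n, hn⟩
    have := hT' c n'
    rw [hc] at this
    rw [this, hαN' n' hn']
  have hβs : ∀ x y, β x y = β y x := pencil_comm ω _
  -- Only the symmetrization of `β(b_i, s b_j)` matters. The obvious choice `-β(b_i, b_j) / 2` may
  -- be nonzero for infinitely many `i`, so the strictly upper triangular part is used, with half of
  -- the diagonal; each column is then a finite sum.
  let s : C →ₗ[k] N := b.constr k fun j => T' (∑ i ∈ Finset.range j, (-β (b i) (b j)) • b i +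
    (-(2 : k)⁻¹ * β (b j) (b j)) • b j)
  have hs : ∀ i j, β (b i) (s (b j)) = if i < j then -β (b i) (b j) else
      if i = j then -(2 : k)⁻¹ * β (b j) (b j) else 0 := by
    intro i j
    rw [Basis.constr_basis, hβs, hT']
    have hαCi : ∀ c : C, α c (b i) = b.repr c i := (apply_basis_of_orthonormal hb · i)
    rw [hαCi]
    simp only [map_add, map_sum, map_smul, Basis.repr_self, Finsupp.add_apply,
      Finsupp.finsetSum_apply,
      Finsupp.smul_apply, Finsupp.single_apply, smul_eq_mul, mul_ite, mul_one, mul_zero]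
    rw [Finset.sum_ite_eq']
    rcases lt_trichotomy i j with hij | hij | hij
    · simp [hij, hij.ne']
    · simp [hij]
    · simp [hij.not_gt, hij.ne, hij.ne']
  let e := (LinearEquiv.skewProd Φ (Φ.trans T') (s ∘ₗ Φ.toLinearMap)).trans
    (Submodule.prodEquivOfIsCompl C N hC.symm)
  have he : ∀ x, e x = (Φ x.1 : V) + ((T' (Φ x.2) : V) + (s (Φ x.1) : V)) := fun x => rfl
  have key1 : ∀ x y, α (Φ x : V) (Φ y : V) = dotForm k x y := by
    have : αC.comp Φ.toLinearMap Φ.toLinearMap = dotForm k := by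
      refine LinearMap.BilinForm.ext_basis Finsupp.basisSingleOne fun i j => ?_
      rw [dotForm_basis, ← hb]
      simp [Φ]
    exact fun x y => LinearMap.congr_fun (LinearMap.congr_fun this x) y
  have key2 : ∀ x y, β (Φ x : V) (Φ y : V) + β (Φ x : V) (s (Φ y) : V) +
      β (s (Φ x) : V) (Φ y : V) = 0 := by
    have : (β.comp (C.subtype ∘ₗ Φ.toLinearMap) (C.subtype ∘ₗ Φ.toLinearMap)) +
        β.comp (C.subtype ∘ₗ Φ.toLinearMap) (N.subtype ∘ₗ s ∘ₗ Φ.toLinearMap) +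
        β.comp (N.subtype ∘ₗ s ∘ₗ Φ.toLinearMap) (C.subtype ∘ₗ Φ.toLinearMap) = 0 := by
      refine LinearMap.BilinForm.ext_basis Finsupp.basisSingleOne fun i j => ?_
      have hΦ : ∀ i, Φ (Finsupp.basisSingleOne i) = b i := fun i => by simp [Φ]
      simp only [LinearMap.add_apply, LinearMap.BilinForm.comp_apply, LinearMap.comp_apply,
        LinearEquiv.coe_coe, hΦ, Submodule.subtype_apply, LinearMap.zero_apply]
      rw [hs i j, hβs (s (b i)) (b j), hs j i]
      rcases lt_trichotomy i j with hij | hij | hij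
      · simp [hij, hij.not_gt, hij.ne']
      · simp only [hij, lt_irrefl, if_false, if_true]
        field_simp
        ring
      · simp [hij, hij.not_gt, hij.ne', hβs (b i) (b j)]
    exact fun x y => LinearMap.congr_fun (LinearMap.congr_fun this x) y
  refine ⟨e, fun x y => ⟨?_, ?_⟩⟩
  · simp only [he, map_add, hαN _ (Subtype.prop _), hαN' _ (Subtype.prop _), add_zero, key1]
  · have h1 : β (Φ x.1 : V) (T' (Φ y.2) : V) = dotForm k x.1 y.2 := by
      rw [hβs, hT', key1, dotForm_comm]
    have h3 : β (T' (Φ x.2) : V) (Φ y.1 : V) = dotForm k x.2 y.1 := by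
      rw [hT', key1]
    simp only [he, map_add, LinearMap.add_apply, h1, h3,
      hβN _ (Subtype.prop _) _ (Subtype.prop _)]
    linear_combination key2 x.1 y.1

theorem TypeIIa.isomorphic [IsAlgClosed k] (h2 : (2 : k) ≠ 0)
    (hr : Module.rank k V ≤ Cardinal.aleph0) (hr' : Module.rank k V' ≤ Cardinal.aleph0)
    (h : ω.TypeIIa p) (h' : ω'.TypeIIa p) : ω.Isomorphic ω' := by
  obtain ⟨e, he⟩ := h.exists_coordinates h2 hr
  obtain ⟨e', he'⟩ := h'.exists_coordinates h2 hr'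
  refine ⟨e.symm.trans e', fun i x y => form_eq_of_pencil_eq (ne_other p) ?_ ?_ i⟩
  · obtain ⟨x, rfl⟩ := e.surjective x
    obtain ⟨y, rfl⟩ := e.surjective y
    simp [he, he']
  · obtain ⟨x, rfl⟩ := e.surjective x
    obtain ⟨y, rfl⟩ := e.surjective y
    simp [he, he']

section Coordinates

variable {e : ((ℕ →₀ k) × (ℕ →₀ k)) ≃ₗ[k] V}

theorem prodMap_mem_Aut (he : ∀ x y, ω.pencil p (e x) (e y) = dotForm k x.1 y.1 ∧
      ω.pencil (other p) (e x) (e y) = dotForm k x.1 y.2 + dotForm k x.2 y.1)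
    {g : (ℕ →₀ k) ≃ₗ[k] (ℕ →₀ k)} (hg : ∀ x y, dotForm k (g x) (g y) = dotForm k x y) :
    e.symm.trans ((g.prodCongr g).trans e) ∈ ω.Aut := by
  rw [mem_Aut_iff_pencil (ne_other p)]
  intro x y
  obtain ⟨x, rfl⟩ := e.surjective x
  obtain ⟨y, rfl⟩ := e.surjective y
  simp [he, hg]

theorem mem_nullspace_coordinates (he : ∀ x y, ω.pencil p (e x) (e y) = dotForm k x.1 y.1 ∧
      ω.pencil (other p) (e x) (e y) = dotForm k x.1 y.2 + dotForm k x.2 y.1)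
    (x : (ℕ →₀ k) × (ℕ →₀ k)) : e x ∈ ω.nullspace p ↔ x.1 = 0 := by
  rw [mem_nullspace]
  constructor
  · intro h
    refine dotForm_nondeg _ (LinearMap.ext fun y => ?_)
    rw [← (he x (y, 0)).1, h]
    rfl
  · intro h
    ext y
    obtain ⟨y, rfl⟩ := e.surjective y
    rw [(he x y).1, h]
    simp

end Coordinates

/-- Isometries of the dot product act diagonally on both copies, so `N_p` and `V / N_p` are
irreducible by the reflection argument. -/
theorem TypeIIa.length_eq_two [IsAlgClosed k] (h2 : (2 : k) ≠ 0)
    (hr : Module.rank k V ≤ Cardinal.aleph0) (h : ω.TypeIIa p) : ω.length = 2 := by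
  obtain ⟨e, he⟩ := h.exists_coordinates h2 hr
  have hmem := mem_nullspace_coordinates he
  refine length_eq_two_of (inv_nullspace ω p) h.2.1 ?_ ?_ ?_
  · intro htop
    have := (hmem (Finsupp.single 0 1, 0)).1 (htop ▸ mem_top)
    simp at this
  · intro N hN hle hne
    have htop := eq_top_of_isometry_invariant h2 dotForm_isSymm dotForm_basis
      (N := N.comap (e.toLinearMap ∘ₗ LinearMap.inr k _ _)) (by
        obtain ⟨v, hvN, hv⟩ := (Submodule.ne_bot_iff N).1 hne
        obtain ⟨x, rfl⟩ := e.surjective v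
        have hx := (hmem x).1 (hle hvN)
        refine (Submodule.ne_bot_iff _).2 ⟨x.2, ?_, fun h0 => hv ?_⟩
        · have : x = (0, x.2) := Prod.ext hx rfl
          rw [this] at hvN
          exact hvN
        · rw [show x = 0 from Prod.ext hx h0, map_zero])
      (fun g hg x hx => by
        have := hN _ (prodMap_mem_Aut he hg) _ hx
        simpa using this)
    refine le_antisymm hle fun v hv => ?_
    obtain ⟨x, rfl⟩ := e.surjective v
    have hx := (hmem x).1 hv
    have h1 : x.2 ∈ N.comap (e.toLinearMap ∘ₗ LinearMap.inr k _ _) := htop ▸ mem_top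
    have : x = (0, x.2) := Prod.ext hx rfl
    rw [this]
    exact h1
  · intro N hN hle hne
    have h0 : ∀ x : (ℕ →₀ k) × (ℕ →₀ k), e x ∈ N ↔ e (x.1, 0) ∈ N := by
      intro x
      have h1 : e (0, x.2) ∈ N := hle ((hmem _).2 rfl)
      have : e x = e (x.1, 0) + e (0, x.2) := by rw [← map_add]; simp
      rw [this, Submodule.add_mem_iff_left N h1]
    have htop := eq_top_of_isometry_invariant h2 dotForm_isSymm dotForm_basis
      (N := N.comap (e.toLinearMap ∘ₗ LinearMap.inl k _ _)) (by
        obtain ⟨v, hvN, hv⟩ := SetLike.exists_of_lt (lt_of_le_of_ne hle (Ne.symm hne))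
        obtain ⟨x, rfl⟩ := e.surjective v
        exact (Submodule.ne_bot_iff _).2 ⟨x.1, (h0 x).1 hvN, fun h0 => hv ((hmem x).2 h0)⟩)
      (fun g hg x hx => by
        have := hN _ (prodMap_mem_Aut he hg) _ hx
        simpa using this)
    rw [eq_top_iff]
    rintro v -
    obtain ⟨x, rfl⟩ := e.surjective v
    have h1 : x.1 ∈ N.comap (e.toLinearMap ∘ₗ LinearMap.inl k _ _) := htop ▸ mem_top
    exact (h0 x).2 h1

/-- Diagonal isometries force an equivariant map to be a 2 by 2 matrix of scalars; one unipotent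
automorphism makes it triangular with equal diagonal entries. The remaining nilpotent map is
equivariant because it is determined by the forms. -/
theorem TypeIIa.commutant [IsAlgClosed k] (h2 : (2 : k) ≠ 0)
    (hr : Module.rank k V ≤ Cardinal.aleph0) (h : ω.TypeIIa p) :
    Nonempty (ω.Commutant ≃ₐ[k]
      (Polynomial k ⧸ Ideal.span {(Polynomial.X ^ 2 : Polynomial k)})) := by
  obtain ⟨e, he⟩ := h.exists_coordinates h2 hr
  have hcomp : ∀ φ : V →ₗ[k] V, ω.Commutes φ → ∃ a b c d : k, ∀ x, φ (e x) =
      e (a • x.1 + b • x.2, c • x.1 + d • x.2) := by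
    intro φ hφ
    have hg : ∀ g : (ℕ →₀ k) ≃ₗ[k] (ℕ →₀ k), (∀ x y, dotForm k (g x) (g y) = dotForm k x y) →
        ∀ x, e.symm (φ (e (g x.1, g x.2))) = (g (e.symm (φ (e x))).1, g (e.symm (φ (e x))).2) := by
      intro g hg x
      have := hφ _ (prodMap_mem_Aut he hg) (e x)
      simpa [LinearEquiv.eq_symm_apply, LinearEquiv.symm_apply_eq] using this
    have hsc : ∀ (i : (ℕ →₀ k) →ₗ[k] ((ℕ →₀ k) × (ℕ →₀ k)))
        (π : ((ℕ →₀ k) × (ℕ →₀ k)) →ₗ[k] (ℕ →₀ k)),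
        (∀ g : (ℕ →₀ k) ≃ₗ[k] (ℕ →₀ k), ∀ x, i (g x) = (g (i x).1, g (i x).2)) →
        (∀ g : (ℕ →₀ k) ≃ₗ[k] (ℕ →₀ k), ∀ x, π (g x.1, g x.2) = g (π x)) →
        ∃ c : k, ∀ x, π (e.symm (φ (e (i x)))) = c • x := by
      intro i π hi hπ
      refine exists_smul_of_commutes_isometry h2 dotForm_isSymm dotForm_basis
        (φ := π ∘ₗ e.symm.toLinearMap ∘ₗ φ ∘ₗ e.toLinearMap ∘ₗ i) ?_
      intro g hg' x
      simp only [LinearMap.comp_apply, LinearEquiv.coe_coe]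
      rw [hi, hg g hg', hπ]
    obtain ⟨a, ha⟩ := hsc (LinearMap.inl k (ℕ →₀ k) (ℕ →₀ k)) (LinearMap.fst k (ℕ →₀ k) (ℕ →₀ k))
      (by simp) (by simp)
    obtain ⟨b, hb⟩ := hsc (LinearMap.inr k (ℕ →₀ k) (ℕ →₀ k)) (LinearMap.fst k (ℕ →₀ k) (ℕ →₀ k))
      (by simp) (by simp)
    obtain ⟨c, hc⟩ := hsc (LinearMap.inl k (ℕ →₀ k) (ℕ →₀ k)) (LinearMap.snd k (ℕ →₀ k) (ℕ →₀ k))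
      (by simp) (by simp)
    obtain ⟨d, hd⟩ := hsc (LinearMap.inr k (ℕ →₀ k) (ℕ →₀ k)) (LinearMap.snd k (ℕ →₀ k) (ℕ →₀ k))
      (by simp) (by simp)
    refine ⟨a, b, c, d, fun x => ?_⟩
    have hx : e x = e (LinearMap.inl k _ _ x.1) + e (LinearMap.inr k _ _ x.2) := by
      rw [← map_add]; simp
    rw [← LinearEquiv.symm_apply_eq, hx, map_add, map_add]
    ext1
    · rw [Prod.fst_add]
      exact congrArg₂ (· + ·) (ha x.1) (hb x.2)
    · rw [Prod.snd_add]
      exact congrArg₂ (· + ·) (hc x.1) (hd x.2)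
  let b₀ : ℕ →₀ k := Finsupp.basisSingleOne 0
  let b₁ : ℕ →₀ k := Finsupp.basisSingleOne 1
  -- `S` is skew for the dot product, which is exactly what makes `(x, y) ↦ (x, y + S x)` an
  -- automorphism.
  let S : (ℕ →₀ k) →ₗ[k] (ℕ →₀ k) :=
    ((dotForm k).flip b₀).smulRight b₁ - ((dotForm k).flip b₁).smulRight b₀
  have hS : ∀ x, S x = dotForm k x b₀ • b₁ - dotForm k x b₁ • b₀ := fun x => rfl
  let u : V ≃ₗ[k] V := e.symm.trans
    ((LinearEquiv.skewProd (.refl k _) (.refl k _) S).trans e)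
  have hue : ∀ x, u (e x) = e (x.1, x.2 + S x.1) := fun x => by simp [u]
  have hu : u ∈ ω.Aut := by
    rw [mem_Aut_iff_pencil (ne_other p)]
    intro x y
    obtain ⟨x, rfl⟩ := e.surjective x
    obtain ⟨y, rfl⟩ := e.surjective y
    simp only [hue, he, true_and, map_add, LinearMap.add_apply, hS, map_sub, map_smul,
      LinearMap.sub_apply, LinearMap.smul_apply, smul_eq_mul, dotForm_comm b₁, dotForm_comm b₀]
    ring
  have hcomp' : ∀ φ : V →ₗ[k] V, ω.Commutes φ → ∃ a c : k, ∀ x, φ (e x) =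
      e (a • x.1, c • x.1 + a • x.2) := by
    intro φ hφ
    obtain ⟨a, b, c, d, hx⟩ := hcomp φ hφ
    have h1 := hφ u hu (e (b₀, 0))
    have h3 := hφ u hu (e (0, b₀))
    have hS0 : S b₀ = b₁ := by
      rw [hS, dotForm_basis, dotForm_basis]
      simp
    rw [hx, hue, hue, hx] at h1 h3
    replace h1 := e.injective h1
    replace h3 := e.injective h3
    have h1' := congrArg (fun y => y.2 1) h1
    have h3' := congrArg (fun y => y.2 1) h3
    simp only [hS0, map_zero, map_smul, smul_zero, add_zero, zero_add] at h1' h3'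
    simp [b₀, b₁] at h1' h3'
    refine ⟨a, c, fun x => ?_⟩
    rw [hx, ← h3', h1']
    simp
  let E : V →ₗ[k] V := e.toLinearMap ∘ₗ LinearMap.inr k _ _ ∘ₗ LinearMap.fst k _ _ ∘ₗ
    e.symm.toLinearMap
  have hE : ∀ x, E (e x) = e (0, x.1) := fun x => by simp [E]
  have hEc : ω.Commutes E := by
    intro g hg x
    obtain ⟨T, hT⟩ := h.2.2.2 _ (ne_other p).symm
    have hxE : ∀ x, ω.pencil (other p) (E x) = ω.pencil p x ∧ E x ∈ ω.nullspace p := by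
      intro x
      obtain ⟨x, rfl⟩ := e.surjective x
      rw [hE]
      refine ⟨LinearMap.ext fun y => ?_, (mem_nullspace_coordinates he _).2 rfl⟩
      obtain ⟨y, rfl⟩ := e.surjective y
      simp [he]
    -- `E x` is characterized as the vector of `N_p` with `ω(q)_(E x) = ω(p)_x`, and automorphisms
    -- preserve this description.
    have hker : E (g x) - g (E x) ∈ ω.totalKer := by
      rw [mem_totalKer_iff_pencil (ne_other p)]
      refine ⟨Submodule.sub_mem _ (hxE _).2 (inv_nullspace ω p g hg _ (hxE x).2), ?_⟩
      ext y
      obtain ⟨y, rfl⟩ := g.surjective y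
      have h1 := (mem_Aut_iff_pencil (ne_other p)).1 hg
      rw [map_sub, LinearMap.sub_apply, (hxE _).1, (h1 _ _).1, (h1 _ _).2, (hxE x).1]
      simp
    rw [h.totalKer_eq_bot, mem_bot] at hker
    exact sub_eq_zero.1 hker
  refine nonempty_algEquiv_dualNumber (e := hEc.toCommutant) ?_ ?_ ?_
  · refine commutant_ext fun x => ?_
    obtain ⟨x, rfl⟩ := e.surjective x
    change E (E (e x)) = 0
    rw [hE, hE]
    simp
  · intro a c hac
    have h1 : a • e (b₀, 0) + c • E (e (b₀, 0)) = 0 :=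
      congrArg (fun φ : ω.Commutant => φ.toLinearMap (e (b₀, 0))) hac
    rw [hE, ← map_smul, ← map_smul, ← map_add, map_eq_zero_iff e e.injective] at h1
    have h3 := congrArg (fun y => y.1 0) h1
    have h4 := congrArg (fun y => y.2 0) h1
    simp [b₀] at h3 h4
    exact ⟨h3, h4⟩
  · intro φ
    obtain ⟨a, c, hac⟩ := hcomp' _ (commutes_toLinearMap φ)
    refine ⟨a, c, commutant_ext fun x => ?_⟩
    obtain ⟨x, rfl⟩ := e.surjective x
    rw [hac]
    change _ = a • e x + c • E (e x)
    rw [hE, ← map_smul, ← map_smul, ← map_add]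
    congr 1
    ext1
    · simp
    · simp [add_comm]

end TypeIIa

end MultiQuad

namespace MultiQuad
open Submodule Module

/-! ### Spaces whose automorphisms include all isometries of one form -/

section Isometry

variable {ι k V V' : Type*} [Field k] [AddCommGroup V] [Module k V] [AddCommGroup V'] [Module k V']

theorem exists_isometry [IsAlgClosed k] (h2 : (2 : k) ≠ 0)
    (hr : Module.rank k V ≤ Cardinal.aleph0) (hr' : Module.rank k V' ≤ Cardinal.aleph0)
    (hd : Cardinal.toENat (Module.rank k V) = Cardinal.toENat (Module.rank k V'))
    {B : LinearMap.BilinForm k V} {B' : LinearMap.BilinForm k V'} (hB : B.IsSymm) (hB' : B'.IsSymm)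
    (hnd : ∀ x, B x = 0 → x = 0) (hnd' : ∀ x, B' x = 0 → x = 0) :
    ∃ e : V ≃ₗ[k] V', ∀ x y, B' (e x) (e y) = B x y := by
  obtain ⟨b, hb⟩ := exists_orthonormal_basis h2 hr hB hnd
  obtain ⟨b', hb'⟩ := exists_orthonormal_basis h2 hr' hB' hnd'
  let σ := Equiv.cast (congrArg Idx hd)
  let e := b.equiv b' σ
  have h : B'.comp e.toLinearMap e.toLinearMap = B := LinearMap.BilinForm.ext_basis b fun i j => by
    simp [e, hb, hb']
  exact ⟨e, fun x y => LinearMap.congr_fun (LinearMap.congr_fun h x) y⟩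

theorem irred_of_isometry_mem_Aut [IsAlgClosed k] [Nontrivial V] (h2 : (2 : k) ≠ 0)
    (hr : Module.rank k V ≤ Cardinal.aleph0) {ω : MultiQuad ι k V} {B : LinearMap.BilinForm k V}
    (hB : B.IsSymm) (hnd : ∀ x, B x = 0 → x = 0)
    (hAut : ∀ g : V ≃ₗ[k] V, (∀ x y, B (g x) (g y) = B x y) → g ∈ ω.Aut) :
    ω.Irred ∧ ∀ φ, ω.Commutes φ → ∃ c : k, ∀ x, φ x = c • x := by
  obtain ⟨b, hb⟩ := exists_orthonormal_basis h2 hr hB hnd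
  refine ⟨⟨inferInstance, fun N hN => or_iff_not_imp_left.2 fun hne => ?_⟩, fun φ hφ => ?_⟩
  · exact eq_top_of_isometry_invariant h2 hB hb hne fun g hg => hN g (hAut g hg)
  · exact exists_smul_of_commutes_isometry h2 hB hb fun g hg => hφ g (hAut g hg)

/-- All linear automorphisms are allowed, in particular the isometries of an auxiliary form with an
orthonormal basis. -/
theorem irred_of_form_eq_zero [IsAlgClosed k] [Nontrivial V] (h2 : (2 : k) ≠ 0)
    (hr : Module.rank k V ≤ Cardinal.aleph0) {ω : MultiQuad ι k V} (hω : ∀ i, ω.form i = 0) :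
    ω.Irred ∧ ∀ φ, ω.Commutes φ → ∃ c : k, ∀ x, φ x = c • x := by
  classical
  obtain ⟨b⟩ := nonempty_basis_idx hr
  have hb : ∀ i j, gramForm b (fun i j => if i = j then (1 : k) else 0) (b i) (b j) =
    if i = j then 1 else 0 := gramForm_basis _ _
  refine irred_of_isometry_mem_Aut h2 hr
    (gramForm_symm b (M := fun i j => if i = j then 1 else 0) fun i j => by simp [eq_comm])
    (fun x hx => b.ext_elem fun i => ?_) fun g _ i x y => by simp [hω]
  rw [← apply_basis_of_orthonormal hb, hx]
  simp

theorem irred_of_pencil_eq_zero [IsAlgClosed k] [Nontrivial V] (h2 : (2 : k) ≠ 0)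
    (hr : Module.rank k V ≤ Cardinal.aleph0) {ω : MultiQuad (Fin 2) k V} {p q : OnePoint k}
    (hpq : p ≠ q) (hp : ω.pencil p = 0) (hq : ∀ x, ω.pencil q x = 0 → x = 0) :
    ω.Irred ∧ ∀ φ, ω.Commutes φ → ∃ c : k, ∀ x, φ x = c • x :=
  irred_of_isometry_mem_Aut h2 hr (ω.pencil_isSymm q) hq fun g hg =>
    (mem_Aut_iff_pencil hpq).2 fun x y => ⟨by simp [hp], hg x y⟩

theorem isomorphic_of_pencil_eq_zero [IsAlgClosed k] (h2 : (2 : k) ≠ 0)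
    (hr : Module.rank k V ≤ Cardinal.aleph0) (hr' : Module.rank k V' ≤ Cardinal.aleph0)
    (hd : Cardinal.toENat (Module.rank k V) = Cardinal.toENat (Module.rank k V'))
    {ω : MultiQuad (Fin 2) k V} {ω' : MultiQuad (Fin 2) k V'} {p q : OnePoint k} (hpq : p ≠ q)
    (hp : ω.pencil p = 0) (hp' : ω'.pencil p = 0) (hq : ∀ x, ω.pencil q x = 0 → x = 0)
    (hq' : ∀ x, ω'.pencil q x = 0 → x = 0) : ω.Isomorphic ω' := by
  obtain ⟨e, he⟩ := exists_isometry h2 hr hr' hd (ω.pencil_isSymm q) (ω'.pencil_isSymm q) hq hq'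
  exact ⟨e, fun i x y => form_eq_of_pencil_eq hpq (by simp [hp, hp']) (he x y) i⟩

end Isometry

/-! ### Orthogonal direct sums -/

section IsSum

variable {ι k V V' A B A' B' : Type*} [Field k] [AddCommGroup V] [Module k V] [AddCommGroup V']
  [Module k V'] [AddCommGroup A] [Module k A] [AddCommGroup B] [Module k B] [AddCommGroup A']
  [Module k A'] [AddCommGroup B'] [Module k B']

/-- The linear isomorphism exhibits a space as an orthogonal direct sum. -/
def IsSum (ω : MultiQuad ι k V) (η : MultiQuad ι k A) (η' : MultiQuad ι k B)
    (e : (A × B) ≃ₗ[k] V) : Prop :=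
  ∀ i x y, ω.form i (e x) (e y) = η.form i x.1 y.1 + η'.form i x.2 y.2

variable {ω : MultiQuad ι k V} {ω' : MultiQuad ι k V'} {η : MultiQuad ι k A} {η' : MultiQuad ι k B}
  {η₁ : MultiQuad ι k A'} {η₁' : MultiQuad ι k B'} {e : (A × B) ≃ₗ[k] V} {e' : (A' × B') ≃ₗ[k] V'}

theorem isSum_of_isCompl {M N : Submodule k V} (h : IsCompl M N)
    (horth : ∀ i, ∀ x ∈ M, ∀ y ∈ N, ω.form i x y = 0) :
    IsSum ω (ω.restrict M) (ω.restrict N) (Submodule.prodEquivOfIsCompl M N h) := by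
  intro i x y
  change ω.form i ((x.1 : V) + x.2) (y.1 + y.2) = ω.form i x.1 y.1 + ω.form i x.2 y.2
  have h1 := horth i x.1 x.1.2 y.2 y.2.2
  have h3 := horth i y.1 y.1.2 x.2 x.2.2
  rw [form_comm] at h3
  simp [h1, h3]

theorem isSum_quotTotalKer (ω : MultiQuad ι k V) : ∃ e : ((V ⧸ ω.totalKer) × ω.totalKer) ≃ₗ[k] V,
    IsSum ω ω.quotTotalKer (ω.restrict ω.totalKer) e ∧ ∀ n : ω.totalKer, e (0, n) = n := by
  obtain ⟨C, hC⟩ := ω.totalKer.exists_isCompl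
  let E : (V ⧸ ω.totalKer) ≃ₗ[k] C := Submodule.quotientEquivOfIsCompl _ C hC
  refine ⟨(E.prodCongr (.refl k ω.totalKer)).trans (Submodule.prodEquivOfIsCompl C _ hC.symm), ?_,
    fun n => ?_⟩
  · rintro i ⟨x, n⟩ ⟨y, m⟩
    obtain ⟨x, rfl⟩ := E.symm.surjective x
    obtain ⟨y, rfl⟩ := E.symm.surjective y
    have h1 : ω.form i n = 0 := mem_totalKer.1 n.2 i
    have h3 : ∀ x, ω.form i x m = 0 := fun x => by rw [form_comm, mem_totalKer.1 m.2 i]; rfl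
    have h4 : ω.form i x y = ω.quotTotalKer.form i (E.symm x) (E.symm y) := by
      rw [form_comm]
      rfl
    change ω.form i ((E (E.symm x) : V) + n) ((E (E.symm y) : V) + m) =
      ω.quotTotalKer.form i (E.symm x) (E.symm y) + ω.form i n m
    rw [← h4, E.apply_symm_apply, E.apply_symm_apply]
    simp [h1, h3]
  · simp

theorem IsSum.prodCongr_mem_Aut (h : IsSum ω η η' e) {g : A ≃ₗ[k] A} {g' : B ≃ₗ[k] B}
    (hg : g ∈ η.Aut) (hg' : g' ∈ η'.Aut) : e.symm.trans ((g.prodCongr g').trans e) ∈ ω.Aut := by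
  intro i x y
  obtain ⟨x, rfl⟩ := e.surjective x
  obtain ⟨y, rfl⟩ := e.surjective y
  simp [h i, hg i, hg' i]

theorem IsSum.isomorphic (h : IsSum ω η η' e) (h' : IsSum ω' η₁ η₁' e') (h1 : η.Isomorphic η₁)
    (h1' : η'.Isomorphic η₁') : ω.Isomorphic ω' := by
  obtain ⟨f, hf⟩ := h1
  obtain ⟨f', hf'⟩ := h1'
  refine ⟨e.symm.trans ((f.prodCongr f').trans e'), fun i x y => ?_⟩
  obtain ⟨x, rfl⟩ := e.surjective x
  obtain ⟨y, rfl⟩ := e.surjective y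
  simp [h i, h' i, hf i, hf' i]

theorem IsSum.universal (h : IsSum ω η η' e) (hu : η.Universal) : ω.Universal := by
  intro n ξ
  obtain ⟨f, hf, hf'⟩ := hu n ξ
  refine ⟨e.toLinearMap ∘ₗ LinearMap.inl k A B ∘ₗ f,
    e.injective.comp (LinearMap.inl_injective.comp hf), fun i x y => ?_⟩
  refine (h i (f x, 0) (f y, 0)).trans ?_
  simp [hf']

/-- The hypotheses on traces of stable subspaces, rather than on automorphisms of the factors, let
this serve both orthogonal sums and the doubles of Type III, where the two copies are moved
simultaneously. -/
theorem length_eq_two_of_prod {N : Submodule k V} (hN : ω.Inv N) (hmem : ∀ x, e x ∈ N ↔ x.1 = 0)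
    [Nontrivial A] [Nontrivial B]
    (hA : ∀ N', ω.Inv N' → N'.comap (e.toLinearMap ∘ₗ LinearMap.inl k A B) ≠ ⊥ →
      N'.comap (e.toLinearMap ∘ₗ LinearMap.inl k A B) = ⊤)
    (hB : ∀ N', ω.Inv N' → N'.comap (e.toLinearMap ∘ₗ LinearMap.inr k A B) ≠ ⊥ →
      N'.comap (e.toLinearMap ∘ₗ LinearMap.inr k A B) = ⊤) : ω.length = 2 := by
  obtain ⟨a, ha⟩ := exists_ne (0 : A)
  obtain ⟨b, hb⟩ := exists_ne (0 : B)
  refine length_eq_two_of hN ?_ ?_ ?_ ?_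
  · exact (Submodule.ne_bot_iff _).2 ⟨e (0, b), (hmem _).2 rfl, by simpa using hb⟩
  · intro htop
    exact ha ((hmem (a, b)).1 (htop ▸ mem_top))
  · intro N' hN' hle hne
    obtain ⟨v, hvN, hv⟩ := (Submodule.ne_bot_iff N').1 hne
    obtain ⟨⟨x, y⟩, rfl⟩ := e.surjective v
    obtain rfl : x = 0 := (hmem _).1 (hle hvN)
    have key := hB N' hN' ((Submodule.ne_bot_iff _).2
      ⟨y, hvN, fun h0 => hv (by rw [h0]; exact map_zero e)⟩)
    refine le_antisymm hle fun v hv => ?_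
    obtain ⟨⟨x, y⟩, rfl⟩ := e.surjective v
    obtain rfl : x = 0 := (hmem _).1 hv
    exact key.ge (mem_top (x := y))
  · intro N' hN' hle hne
    obtain ⟨v, hvN, hv⟩ := SetLike.exists_of_lt (lt_of_le_of_ne hle (Ne.symm hne))
    obtain ⟨⟨x, y⟩, rfl⟩ := e.surjective v
    have hsum : ∀ x y, e (x, y) = e (x, 0) + e (0, y) := fun x y => by rw [← map_add]; simp
    have hN0 : ∀ y, e (0, y) ∈ N' := fun y => hle ((hmem _).2 rfl)
    rw [hsum, Submodule.add_mem_iff_left N' (hN0 y)] at hvN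
    have key := hA N' hN' ((Submodule.ne_bot_iff _).2 ⟨x, hvN, fun h0 => hv ((hmem _).2 h0)⟩)
    rw [eq_top_iff]
    rintro v -
    obtain ⟨⟨x, y⟩, rfl⟩ := e.surjective v
    rw [hsum]
    exact add_mem (key.ge (mem_top (x := x))) (hN0 y)

theorem IsSum.length_eq_two (h : IsSum ω η η' e) (hη : η.Irred) (hη' : η'.Irred)
    {N : Submodule k V} (hN : ω.Inv N) (hmem : ∀ x, e x ∈ N ↔ x.1 = 0) : ω.length = 2 :=
  have := hη.1
  have := hη'.1
  length_eq_two_of_prod hN hmem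
    (fun N' hN' hne => (hη.2 _ fun g hg x hx => by
      simpa using hN' _ (h.prodCongr_mem_Aut hg (one_mem η'.Aut)) _ hx).resolve_left hne)
    (fun N' hN' hne => (hη'.2 _ fun g hg x hx => by
      simpa using hN' _ (h.prodCongr_mem_Aut (one_mem η.Aut) hg) _ hx).resolve_left hne)

theorem IsSum.exists_smul_of_commutes (h : IsSum ω η η' e) (h2 : (2 : k) ≠ 0)
    (hη : ∀ φ, η.Commutes φ → ∃ c : k, ∀ x, φ x = c • x)
    (hη' : ∀ φ, η'.Commutes φ → ∃ c : k, ∀ x, φ x = c • x) {φ : V →ₗ[k] V} (hφ : ω.Commutes φ) :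
    ∃ a b : k, ∀ x, φ (e x) = e (a • x.1, b • x.2) := by
  have hg : ∀ g ∈ η.Aut, ∀ g' ∈ η'.Aut, ∀ x, e.symm (φ (e (g x.1, g' x.2))) =
      (g (e.symm (φ (e x))).1, g' (e.symm (φ (e x))).2) := by
    intro g hg g' hg' x
    have := hφ _ (h.prodCongr_mem_Aut hg hg') (e x)
    simpa [LinearEquiv.eq_symm_apply, LinearEquiv.symm_apply_eq] using this
  obtain ⟨a, ha⟩ := hη (LinearMap.fst k A B ∘ₗ e.symm.toLinearMap ∘ₗ φ ∘ₗ e.toLinearMap ∘ₗ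
    LinearMap.inl k A B) fun g hgA x => by
      simpa using congrArg Prod.fst (hg g hgA 1 (one_mem _) (x, 0))
  obtain ⟨b, hb⟩ := hη' (LinearMap.snd k A B ∘ₗ e.symm.toLinearMap ∘ₗ φ ∘ₗ e.toLinearMap ∘ₗ
    LinearMap.inr k A B) fun g hgB x => by
      simpa using congrArg Prod.snd (hg 1 (one_mem _) g hgB (0, x))
  -- Negation on the first factor alone is an automorphism; commuting with it kills both
  -- off-diagonal blocks, as `2 ≠ 0`.
  have hneg : LinearEquiv.neg k ∈ η.Aut := fun i x y => by simp
  have h3 : ∀ x, (e.symm (φ (e (x, 0)))).2 = 0 := by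
    intro x
    have := congrArg Prod.snd (hg _ hneg 1 (one_mem _) (x, 0))
    have h4 : (LinearEquiv.neg k x, (1 : B ≃ₗ[k] B) 0) = -((x, 0) : A × B) := by simp
    dsimp only at this
    rw [h4, map_neg, map_neg, map_neg] at this
    have h5 : (2 : k) • (e.symm (φ (e (x, 0)))).2 = 0 := by
      rw [two_smul]
      nth_rewrite 1 [show (e.symm (φ (e (x, 0)))).2 = -(e.symm (φ (e (x, 0)))).2 from this.symm]
      exact neg_add_cancel _
    exact (smul_eq_zero.1 h5).resolve_left h2
  have h4 : ∀ y, (e.symm (φ (e (0, y)))).1 = 0 := by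
    intro y
    have := congrArg Prod.fst (hg _ hneg 1 (one_mem _) (0, y))
    have h4 : (LinearEquiv.neg k (0 : A), (1 : B ≃ₗ[k] B) y) = (0, y) := by simp
    dsimp only at this
    rw [h4] at this
    have h5 : (2 : k) • (e.symm (φ (e (0, y)))).1 = 0 := by
      rw [two_smul]
      nth_rewrite 1 [this]
      exact neg_add_cancel _
    exact (smul_eq_zero.1 h5).resolve_left h2
  refine ⟨a, b, fun ⟨x, y⟩ => ?_⟩
  have hx : e (x, y) = e (x, 0) + e (0, y) := by rw [← map_add]; simp
  rw [← LinearEquiv.symm_apply_eq, hx, map_add, map_add]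
  ext1
  · rw [Prod.fst_add, h4, add_zero]
    exact ha x
  · rw [Prod.snd_add, h3, zero_add]
    exact hb y

/-- When both summands are stable, the two projections commute with all automorphisms and are the
idempotents of `k × k`. -/
theorem IsSum.commutant (h : IsSum ω η η' e) (h2 : (2 : k) ≠ 0)
    (hη : ∀ φ, η.Commutes φ → ∃ c : k, ∀ x, φ x = c • x)
    (hη' : ∀ φ, η'.Commutes φ → ∃ c : k, ∀ x, φ x = c • x) [Nontrivial A] [Nontrivial B]
    {M N : Submodule k V} (hM : ω.Inv M) (hN : ω.Inv N) (hMmem : ∀ x, e x ∈ M ↔ x.2 = 0)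
    (hNmem : ∀ x, e x ∈ N ↔ x.1 = 0) : Nonempty (ω.Commutant ≃ₐ[k] k × k) := by
  let P : V →ₗ[k] V := e.toLinearMap ∘ₗ LinearMap.inl k A B ∘ₗ LinearMap.fst k A B ∘ₗ
    e.symm.toLinearMap
  let Q : V →ₗ[k] V := e.toLinearMap ∘ₗ LinearMap.inr k A B ∘ₗ LinearMap.snd k A B ∘ₗ
    e.symm.toLinearMap
  have hP : ∀ x, P (e x) = e (x.1, 0) := fun x => by simp [P]
  have hQ : ∀ x, Q (e x) = e (0, x.2) := fun x => by simp [Q]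
  have hsum : ∀ x : A × B, e x = e (x.1, 0) + e (0, x.2) := fun x => by rw [← map_add]; simp
  have hact : ∀ g ∈ ω.Aut, ∀ x, P (g (e x)) = g (e (x.1, 0)) ∧ Q (g (e x)) = g (e (0, x.2)) := by
    intro g hg x
    obtain ⟨y, hy⟩ := e.surjective (g (e (x.1, 0)))
    obtain ⟨z, hz⟩ := e.surjective (g (e (0, x.2)))
    have hy2 := (hMmem y).1 (hy ▸ hM g hg _ ((hMmem _).2 rfl))
    have hz1 := (hNmem z).1 (hz ▸ hN g hg _ ((hNmem _).2 rfl))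
    rw [hsum x, map_add, ← hy, ← hz, ← map_add, hP, hQ]
    obtain ⟨y, y'⟩ := y
    obtain ⟨z, z'⟩ := z
    obtain rfl : y' = 0 := hy2
    obtain rfl : z = 0 := hz1
    simp
  have hPc : ω.Commutes P := fun g hg x => by
    obtain ⟨x, rfl⟩ := e.surjective x
    rw [(hact g hg x).1, hP]
  have hQc : ω.Commutes Q := fun g hg x => by
    obtain ⟨x, rfl⟩ := e.surjective x
    rw [(hact g hg x).2, hQ]
  obtain ⟨a₀, ha₀⟩ := exists_ne (0 : A)
  obtain ⟨b₀, hb₀⟩ := exists_ne (0 : B)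
  refine nonempty_algEquiv_prod (e := hPc.toCommutant) (f := hQc.toCommutant)
    (commutant_ext fun x => ?_) (commutant_ext fun x => ?_) (commutant_ext fun x => ?_)
    (commutant_ext fun x => ?_) (commutant_ext fun x => ?_) (fun h0 => ?_) (fun h0 => ?_)
    fun φ => ?_
  · obtain ⟨x, rfl⟩ := e.surjective x
    change P (P (e x)) = P (e x)
    rw [hP, hP]
  · obtain ⟨x, rfl⟩ := e.surjective x
    change Q (Q (e x)) = Q (e x)
    rw [hQ, hQ]
  · obtain ⟨x, rfl⟩ := e.surjective x
    change P (Q (e x)) = 0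
    rw [hQ, hP]
    exact map_zero e
  · obtain ⟨x, rfl⟩ := e.surjective x
    change Q (P (e x)) = 0
    rw [hP, hQ]
    exact map_zero e
  · obtain ⟨x, rfl⟩ := e.surjective x
    change P (e x) + Q (e x) = e x
    rw [hP, hQ, ← hsum]
  · have h1 : P (e (a₀, 0)) = 0 := congrArg (fun φ : ω.Commutant => φ.toLinearMap (e (a₀, 0))) h0
    rw [hP, map_eq_zero_iff e e.injective] at h1
    exact ha₀ (congrArg Prod.fst h1)
  · have h1 : Q (e (0, b₀)) = 0 := congrArg (fun φ : ω.Commutant => φ.toLinearMap (e (0, b₀))) h0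
    rw [hQ, map_eq_zero_iff e e.injective] at h1
    exact hb₀ (congrArg Prod.snd h1)
  · obtain ⟨a, b, hab⟩ := h.exists_smul_of_commutes h2 hη hη' (commutes_toLinearMap φ)
    refine ⟨a, b, commutant_ext fun x => ?_⟩
    obtain ⟨x, rfl⟩ := e.surjective x
    rw [hab]
    change _ = a • P (e x) + b • Q (e x)
    rw [hP, hQ, ← map_smul, ← map_smul, ← map_add]
    simp

end IsSum

/-! ### Types Ia, Ib and Ic -/

section TypeI

variable {k V V' : Type*} [Field k] [AddCommGroup V] [Module k V] [AddCommGroup V'] [Module k V']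
  {ω : MultiQuad (Fin 2) k V} {ω' : MultiQuad (Fin 2) k V'} {p q : OnePoint k}

theorem pencil_restrict (ω : MultiQuad (Fin 2) k V) (U : Submodule k V) (p : OnePoint k) (x y : U) :
    (ω.restrict U).pencil p x y = ω.pencil p x y :=
  pencil_eq_of_form_eq (ω := ω.restrict U) (ω' := ω) (fun _ => rfl) p

theorem pencil_restrict_nullspace (ω : MultiQuad (Fin 2) k V) (p : OnePoint k) :
    (ω.restrict (ω.nullspace p)).pencil p = 0 := by
  ext x y
  rw [pencil_restrict, mem_nullspace.1 x.2]
  rfl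

theorem orth_nullspace (hpq : p ≠ q) (i : Fin 2) (x : V) (hx : x ∈ ω.nullspace p) (y : V)
    (hy : y ∈ ω.nullspace q) : ω.form i x y = 0 := by
  have h1 : ω.pencil p x y = ω.pencil p 0 0 := by rw [mem_nullspace.1 hx]; simp
  have h3 : ω.pencil q x y = ω.pencil q 0 0 := by rw [pencil_comm, mem_nullspace.1 hy]; simp
  rw [form_eq_of_pencil_eq hpq h1 h3 i]
  simp

theorem pencil_restrict_nondeg (h : IsCompl (ω.nullspace p) (ω.nullspace q))
    (x : ω.nullspace p) (hx : (ω.restrict (ω.nullspace p)).pencil q x = 0) : x = 0 := by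
  have hxq : (x : V) ∈ ω.nullspace q := by
    rw [mem_nullspace]
    ext y
    have hy : y ∈ ω.nullspace p ⊔ ω.nullspace q := by rw [h.sup_eq_top]; trivial
    obtain ⟨a, ha, b, hb, rfl⟩ := mem_sup.1 hy
    have h1 : ω.pencil q x a = 0 := by
      rw [← pencil_restrict ω (ω.nullspace p) q x ⟨a, ha⟩, hx]
      rfl
    have h3 : ω.pencil q x b = 0 := by
      rw [pencil_comm, mem_nullspace.1 hb]
      rfl
    rw [map_add, h1, h3, add_zero]
    rfl
  exact Subtype.ext (Submodule.disjoint_def.1 h.disjoint x x.2 hxq)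

theorem nontrivial_of_not_finiteDimensional {U : Submodule k V} (h : ¬ FiniteDimensional k U) :
    Nontrivial U :=
  not_subsingleton_iff_nontrivial.1 fun _ => h inferInstance

theorem mem_right_prodEquivOfIsCompl {M N : Submodule k V} (h : IsCompl M N) (x : M × N) :
    Submodule.prodEquivOfIsCompl M N h x ∈ N ↔ x.1 = 0 := by
  rw [← Submodule.prodEquivOfIsCompl_symm_apply_fst_eq_zero _ _ h, LinearEquiv.symm_apply_apply]

theorem mem_left_prodEquivOfIsCompl {M N : Submodule k V} (h : IsCompl M N) (x : M × N) :
    Submodule.prodEquivOfIsCompl M N h x ∈ M ↔ x.2 = 0 := by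
  rw [← Submodule.prodEquivOfIsCompl_symm_apply_snd_eq_zero _ _ h, LinearEquiv.symm_apply_apply]

theorem TypeIa.length_eq_two [IsAlgClosed k] (h2 : (2 : k) ≠ 0)
    (hr : Module.rank k V ≤ Cardinal.aleph0) {S : Set (OnePoint k)} (h : ω.TypeIa S) :
    ω.length = 2 := by
  obtain ⟨p, q, hpq, -, hp, hq, hc⟩ := h
  have := nontrivial_of_not_finiteDimensional hp
  have := nontrivial_of_not_finiteDimensional hq
  exact (isSum_of_isCompl hc (orth_nullspace hpq)).length_eq_two
    (irred_of_pencil_eq_zero h2 ((Submodule.rank_le _).trans hr) hpq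
      (pencil_restrict_nullspace ω p) (pencil_restrict_nondeg hc)).1
    (irred_of_pencil_eq_zero h2 ((Submodule.rank_le _).trans hr) hpq.symm
      (pencil_restrict_nullspace ω q) (pencil_restrict_nondeg hc.symm)).1
    (inv_nullspace ω q) (mem_right_prodEquivOfIsCompl hc)

theorem TypeIa.commutant [IsAlgClosed k] (h2 : (2 : k) ≠ 0)
    (hr : Module.rank k V ≤ Cardinal.aleph0) {S : Set (OnePoint k)} (h : ω.TypeIa S) :
    Nonempty (ω.Commutant ≃ₐ[k] k × k) := by
  obtain ⟨p, q, hpq, -, hp, hq, hc⟩ := h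
  have := nontrivial_of_not_finiteDimensional hp
  have := nontrivial_of_not_finiteDimensional hq
  exact (isSum_of_isCompl hc (orth_nullspace hpq)).commutant h2
    (irred_of_pencil_eq_zero h2 ((Submodule.rank_le _).trans hr) hpq
      (pencil_restrict_nullspace ω p) (pencil_restrict_nondeg hc)).2
    (irred_of_pencil_eq_zero h2 ((Submodule.rank_le _).trans hr) hpq.symm
      (pencil_restrict_nullspace ω q) (pencil_restrict_nondeg hc.symm)).2
    (inv_nullspace ω p) (inv_nullspace ω q) (mem_left_prodEquivOfIsCompl hc)
    (mem_right_prodEquivOfIsCompl hc)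

theorem exists_pencil_embedding_nullspace [IsAlgClosed k] (h2 : (2 : k) ≠ 0)
    (hp : ¬ FiniteDimensional k (ω.nullspace p)) (hc : IsCompl (ω.nullspace p) (ω.nullspace q))
    {W : Type*} [AddCommGroup W] [Module k W] [FiniteDimensional k W] {B : LinearMap.BilinForm k W}
    (hB : B.IsSymm) : ∃ f : W →ₗ[k] ω.nullspace p, Function.Injective f ∧
      ∀ x y, ω.pencil q (f x) (f y) = B x y := by
  obtain ⟨f, hf, hf'⟩ := ((single_nondeg (hB := pencil_isSymm _ _)
    (pencil_restrict_nondeg hc)).universal h2 hp).exists_embedding (single B hB)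
  refine ⟨f, hf, fun x y => ?_⟩
  rw [← pencil_restrict]
  exact hf' () x y

/-- On `N_p` only `ω(q)` is visible and on `N_q` only `ω(p)`. Hence the sum of an embedding into
`N_p` for the second form and one into `N_q` for the first realizes both at once. -/
theorem TypeIa.universal [IsAlgClosed k] (h2 : (2 : k) ≠ 0) {S : Set (OnePoint k)}
    (h : ω.TypeIa S) : ω.Universal := by
  obtain ⟨p, q, hpq, -, hp, hq, hc⟩ := h
  refine universal_of_exists_pencil_embedding hpq fun n B B' hB hB' => ?_
  obtain ⟨f, hf, hf'⟩ := exists_pencil_embedding_nullspace h2 hp hc hB'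
  obtain ⟨g, hg, hg'⟩ := exists_pencil_embedding_nullspace h2 hq hc.symm hB
  have h0 : ∀ x y, ω.pencil p (f x : V) y = 0 := fun x y => by rw [mem_nullspace.1 (f x).2]; rfl
  have h1 : ∀ x y, ω.pencil q (g x : V) y = 0 := fun x y => by rw [mem_nullspace.1 (g x).2]; rfl
  have h0' : ∀ x y, ω.pencil p y (f x : V) = 0 := fun x y => by rw [pencil_comm, h0]
  have h1' : ∀ x y, ω.pencil q y (g x : V) = 0 := fun x y => by rw [pencil_comm, h1]
  refine ⟨(ω.nullspace p).subtype ∘ₗ f + (ω.nullspace q).subtype ∘ₗ g, ?_, fun x y => ?_⟩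
  · rw [injective_iff_map_eq_zero]
    intro x hx
    have hx' : (f x : V) + g x = 0 := hx
    have h3 : (f x : V) ∈ ω.nullspace q := by
      rw [eq_neg_of_add_eq_zero_left hx']
      exact neg_mem (g x).2
    have h4 := Submodule.disjoint_def.1 hc.disjoint _ (f x).2 h3
    exact (map_eq_zero_iff f hf).1 (Subtype.ext h4)
  · simp [h0, h1, h0', h1', hf', hg']

theorem TypeIa.isomorphic [IsAlgClosed k] (h2 : (2 : k) ≠ 0)
    (hr : Module.rank k V ≤ Cardinal.aleph0) (hr' : Module.rank k V' ≤ Cardinal.aleph0)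
    {S : Set (OnePoint k)} (h : ω.TypeIa S) (h' : ω'.TypeIa S) : ω.Isomorphic ω' := by
  obtain ⟨p, q, hpq, hS, hp, hq, hc⟩ := h
  obtain ⟨hp', hq', hc'⟩ : ¬ FiniteDimensional k (ω'.nullspace p) ∧
      ¬ FiniteDimensional k (ω'.nullspace q) ∧ IsCompl (ω'.nullspace p) (ω'.nullspace q) := by
    obtain ⟨p', q', -, hS', hp', hq', hc'⟩ := h'
    rcases Set.pair_eq_pair_iff.1 (hS.symm.trans hS') with ⟨rfl, rfl⟩ | ⟨rfl, rfl⟩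
    · exact ⟨hp', hq', hc'⟩
    · exact ⟨hq', hp', hc'.symm⟩
  have hrank : ∀ {X : Type _} [AddCommGroup X] [Module k X], ¬ FiniteDimensional k X →
      Cardinal.toENat (Module.rank k X) = ⊤ := fun hX => by
    rw [Cardinal.toENat_eq_top, ← not_lt, Module.rank_lt_aleph0_iff]
    exact hX
  have hrank' : ∀ {X : Type _} [AddCommGroup X] [Module k X], ¬ FiniteDimensional k X →
      Cardinal.toENat (Module.rank k X) = ⊤ := fun hX => by
    rw [Cardinal.toENat_eq_top, ← not_lt, Module.rank_lt_aleph0_iff]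
    exact hX
  exact (isSum_of_isCompl hc (orth_nullspace hpq)).isomorphic
    (isSum_of_isCompl hc' (orth_nullspace hpq))
    (isomorphic_of_pencil_eq_zero h2 ((Submodule.rank_le _).trans hr)
      ((Submodule.rank_le _).trans hr') ((hrank hp).trans (hrank' hp').symm) hpq
      (pencil_restrict_nullspace ω p) (pencil_restrict_nullspace ω' p)
      (pencil_restrict_nondeg hc) (pencil_restrict_nondeg hc'))
    (isomorphic_of_pencil_eq_zero h2 ((Submodule.rank_le _).trans hr)
      ((Submodule.rank_le _).trans hr') ((hrank hq).trans (hrank' hq').symm) hpq.symm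
      (pencil_restrict_nullspace ω q) (pencil_restrict_nullspace ω' q)
      (pencil_restrict_nondeg hc.symm) (pencil_restrict_nondeg hc'.symm))

variable {d : ℕ∞}

theorem TypeIb.isSum (h : ω.TypeIb d p) : IsSum ω (ω.restrict (ω.perp (ω.nullspace p)))
    (ω.restrict (ω.nullspace p)) (Submodule.prodEquivOfIsCompl _ _ h.2.2.2.1) :=
  isSum_of_isCompl _ fun i _ hx y hy => hx i y hy

theorem TypeIb.nondeg (h : ω.TypeIb d p) : (ω.restrict (ω.perp (ω.nullspace p))).Nondeg :=
  h.2.1.nondeg h.2.2.1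

theorem TypeIb.universal (h : ω.TypeIb d p) : ω.Universal := h.isSum.universal h.2.1

theorem TypeIb.pencil_nondeg (h : ω.TypeIb d p) (hpq : p ≠ q) (x : ω.nullspace p)
    (hx : (ω.restrict (ω.nullspace p)).pencil q x = 0) : x = 0 := by
  have h1 : (x : V) ∈ ω.perp (ω.nullspace p) := (mem_perp_nullspace hpq).2 fun y hy => by
    rw [← pencil_restrict ω (ω.nullspace p) q x ⟨y, hy⟩, hx]
    rfl
  exact Subtype.ext (Submodule.disjoint_def.1 h.2.2.2.1.disjoint x h1 x.2)

theorem TypeIb.irred_nullspace [IsAlgClosed k] (h2 : (2 : k) ≠ 0)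
    (hr : Module.rank k V ≤ Cardinal.aleph0) (h : ω.TypeIb d p) :
    (ω.restrict (ω.nullspace p)).Irred ∧ ∀ φ, (ω.restrict (ω.nullspace p)).Commutes φ →
      ∃ c : k, ∀ x, φ x = c • x :=
  have := Submodule.nontrivial_iff_ne_bot.2 h.1
  irred_of_pencil_eq_zero h2 ((Submodule.rank_le _).trans hr) (ne_other p)
    (pencil_restrict_nullspace ω p) (h.pencil_nondeg (ne_other p))

theorem TypeIb.length_eq_two [IsAlgClosed k] (h2 : (2 : k) ≠ 0)
    (hr : Module.rank k V ≤ Cardinal.aleph0) (h : ω.TypeIb d p) : ω.length = 2 :=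
  h.isSum.length_eq_two
    (h.nondeg.irred h2 h.2.1.not_finiteDimensional ((Submodule.rank_le _).trans hr))
    (h.irred_nullspace h2 hr).1 (inv_nullspace ω p) (mem_right_prodEquivOfIsCompl _)

theorem TypeIb.commutant [IsAlgClosed k] (h2 : (2 : k) ≠ 0)
    (hr : Module.rank k V ≤ Cardinal.aleph0) (h : ω.TypeIb d p) :
    Nonempty (ω.Commutant ≃ₐ[k] k × k) :=
  have := Submodule.nontrivial_iff_ne_bot.2 h.1
  have := nontrivial_of_not_finiteDimensional h.2.1.not_finiteDimensional
  h.isSum.commutant h2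
    (fun _ => h.nondeg.exists_smul_of_commutes h2 h.2.1.not_finiteDimensional
      ((Submodule.rank_le _).trans hr))
    (h.irred_nullspace h2 hr).2 (inv_nullspace ω p).perp (inv_nullspace ω p)
    (mem_left_prodEquivOfIsCompl _) (mem_right_prodEquivOfIsCompl _)

theorem TypeIb.isomorphic [IsAlgClosed k] (h2 : (2 : k) ≠ 0)
    (hr : Module.rank k V ≤ Cardinal.aleph0) (hr' : Module.rank k V' ≤ Cardinal.aleph0)
    (h : ω.TypeIb d p) (h' : ω'.TypeIb d p) : ω.Isomorphic ω' :=
  h.isSum.isomorphic h'.isSum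
    (h.nondeg.exists_equiv h2 h'.nondeg h.2.1.not_finiteDimensional h'.2.1.not_finiteDimensional
      ((Submodule.rank_le _).trans hr) ((Submodule.rank_le _).trans hr'))
    (isomorphic_of_pencil_eq_zero h2 ((Submodule.rank_le _).trans hr)
      ((Submodule.rank_le _).trans hr') (h.2.2.2.2.symm.trans h'.2.2.2.2) (ne_other p)
      (pencil_restrict_nullspace ω p) (pencil_restrict_nullspace ω' p)
      (h.pencil_nondeg (ne_other p)) (h'.pencil_nondeg (ne_other p)))

theorem form_restrict_totalKer {ι : Type*} (ω : MultiQuad ι k V) (i : ι) :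
    (ω.restrict ω.totalKer).form i = 0 := by
  ext x y
  have := LinearMap.congr_fun (mem_totalKer.1 x.2 i) y
  exact this

theorem TypeIc.nondeg (h : ω.TypeIc d) : ω.quotTotalKer.Nondeg := h.2.1.nondeg h.2.2.1

theorem TypeIc.universal (h : ω.TypeIc d) : ω.Universal := by
  obtain ⟨e, he, -⟩ := isSum_quotTotalKer ω
  exact he.universal h.2.1

theorem TypeIc.length_eq_two [IsAlgClosed k] (h2 : (2 : k) ≠ 0)
    (hr : Module.rank k V ≤ Cardinal.aleph0) (h : ω.TypeIc d) : ω.length = 2 := by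
  obtain ⟨e, he, hen⟩ := isSum_quotTotalKer ω
  have := Submodule.nontrivial_iff_ne_bot.2 h.1
  refine he.length_eq_two
    (h.nondeg.irred h2 h.2.1.not_finiteDimensional ((rank_quotient_le _).trans hr))
    (irred_of_form_eq_zero h2 ((Submodule.rank_le _).trans hr) (form_restrict_totalKer ω)).1
    (inv_totalKer ω) fun x => ⟨fun hx => ?_, fun hx => ?_⟩
  · have h1 := hen ⟨e x, hx⟩
    rw [← e.injective h1]
  · have := hen x.2
    rw [show x = (0, x.2) from Prod.ext hx rfl, this]
    exact x.2.2

theorem TypeIc.commutant [IsAlgClosed k] (h2 : (2 : k) ≠ 0)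
    (hr : Module.rank k V ≤ Cardinal.aleph0) (h : ω.TypeIc d) :
    Nonempty (ω.Commutant ≃ₐ[k] k) := by
  obtain ⟨e, he, -⟩ := isSum_quotTotalKer ω
  have := Submodule.nontrivial_iff_ne_bot.2 h.1
  have : Nontrivial V := (e.injective.comp (LinearMap.inr_injective (R := k))).nontrivial
  refine commutant_scalar fun φ hφ => ?_
  obtain ⟨a, b, hab⟩ := he.exists_smul_of_commutes h2
    (fun _ => h.nondeg.exists_smul_of_commutes h2 h.2.1.not_finiteDimensional
      ((rank_quotient_le _).trans hr))
    (irred_of_form_eq_zero h2 ((Submodule.rank_le _).trans hr) (form_restrict_totalKer ω)).2 hφ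
  have hQ : Nontrivial (V ⧸ ω.totalKer) :=
    not_subsingleton_iff_nontrivial.1 fun _ => h.2.1.not_finiteDimensional inferInstance
  obtain ⟨x, hx⟩ := exists_ne (0 : V ⧸ ω.totalKer)
  obtain ⟨n, hn⟩ := exists_ne (0 : ω.totalKer)
  obtain ⟨f, hf⟩ := Module.Projective.exists_dual_ne_zero k hx
  -- Adding vectors of the total kernel is an automorphism. It mixes the two summands and so forces
  -- the two scalars to agree, in contrast with Type Ib.
  let u : V ≃ₗ[k] V := e.symm.trans
    ((LinearEquiv.skewProd (.refl k _) (.refl k _) (f.smulRight n)).trans e)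
  have hue : ∀ x, u (e x) = e (x.1, x.2 + f x.1 • n) := fun x => by simp [u]
  have hu : u ∈ ω.Aut := by
    intro i x y
    obtain ⟨x, rfl⟩ := e.surjective x
    obtain ⟨y, rfl⟩ := e.surjective y
    rw [hue, hue, he i, he i, form_restrict_totalKer]
    rfl
  have h1 := hφ u hu (e (x, 0))
  rw [hue, hab, hab, hue] at h1
  have h3 := congrArg Prod.snd (e.injective h1)
  simp only [zero_add, smul_zero, map_smul, smul_eq_mul, smul_smul] at h3
  have h4 := smul_left_injective k hn h3
  have hba : b = a := mul_right_cancel₀ hf h4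
  refine ⟨a, fun y => ?_⟩
  obtain ⟨y, rfl⟩ := e.surjective y
  rw [hab, hba, ← map_smul]
  rfl

theorem TypeIc.isomorphic [IsAlgClosed k] (h2 : (2 : k) ≠ 0)
    (hr : Module.rank k V ≤ Cardinal.aleph0) (hr' : Module.rank k V' ≤ Cardinal.aleph0)
    (h : ω.TypeIc d) (h' : ω'.TypeIc d) : ω.Isomorphic ω' := by
  obtain ⟨e, he, -⟩ := isSum_quotTotalKer ω
  obtain ⟨e', he', -⟩ := isSum_quotTotalKer ω'
  refine he.isomorphic he'
    (h.nondeg.exists_equiv h2 h'.nondeg h.2.1.not_finiteDimensional h'.2.1.not_finiteDimensional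
      ((rank_quotient_le _).trans hr) ((rank_quotient_le _).trans hr')) ?_
  obtain ⟨b⟩ := nonempty_basis_idx ((Submodule.rank_le ω.totalKer).trans hr)
  obtain ⟨b'⟩ := nonempty_basis_idx ((Submodule.rank_le ω'.totalKer).trans hr')
  have hd : Idx (Cardinal.toENat (Module.rank k ω.totalKer)) =
      Idx (Cardinal.toENat (Module.rank k ω'.totalKer)) := by
    rw [← h.2.2.2, ← h'.2.2.2]
  exact ⟨b.equiv b' (Equiv.cast hd), fun i x y => by simp [form_restrict_totalKer]⟩

end TypeI

end MultiQuad

namespace MultiQuad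
open Submodule Module

/-! ### Dividing out the linear relations between forms -/

section Recombine

variable {ι κ k V V' : Type*} [Field k] [AddCommGroup V] [Module k V] [AddCommGroup V']
  [Module k V'] [Fintype κ]

/-- The linear combinations of the forms with the coefficients given by a linear map. -/
def recombine [DecidableEq ι] (θ : MultiQuad κ k V) (R : (ι → k) →ₗ[k] (κ → k)) :
    MultiQuad ι k V where
  form i := ∑ j, R (Pi.single i 1) j • θ.form j
  symm _ := θ.isSymm_sum _

theorem recombine_form [DecidableEq ι] (θ : MultiQuad κ k V) (R : (ι → k) →ₗ[k] (κ → k)) (i : ι) :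
    (θ.recombine R).form i = ∑ j, R (Pi.single i 1) j • θ.form j := rfl

theorem sum_smul_recombine [Fintype ι] [DecidableEq ι] (θ : MultiQuad κ k V)
    (R : (ι → k) →ₗ[k] (κ → k)) (c : ι → k) :
    ∑ i, c i • (θ.recombine R).form i = ∑ j, R c j • θ.form j := by
  have hc : R c = ∑ i, c i • R (Pi.single i 1) := by
    conv_lhs => rw [← Finset.univ_sum_single c]
    rw [map_sum]
    refine Finset.sum_congr rfl fun i _ => ?_
    rw [← map_smul, ← Pi.single_smul, smul_eq_mul, mul_one]
  simp only [recombine_form, Finset.smul_sum, hc, Finset.sum_apply, Finset.sum_smul]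
  rw [Finset.sum_comm]
  simp [smul_smul]

theorem mem_relations [Fintype ι] {ω : MultiQuad ι k V} {c : ι → k} :
    c ∈ ω.relations ↔ ∑ i, c i • ω.form i = 0 := Iff.rfl

/-- `R` presents the quotient of `k^ι` by the relations and `S` is a section, so `η.recombine S` is
a system of independent forms with the same span. Nothing is lost, since `S ∘ R` differs from the
identity by relations. -/
theorem recombine_recombine [Fintype ι] [DecidableEq ι] [DecidableEq κ] (η : MultiQuad ι k V)
    {R : (ι → k) →ₗ[k] (κ → k)}
    {S : (κ → k) →ₗ[k] (ι → k)} (hRS : ∀ x, R (S x) = x) (hR : LinearMap.ker R = η.relations) :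
    (η.recombine S).recombine R = η := by
  have : ((η.recombine S).recombine R).form = η.form := by
    funext i
    rw [recombine_form, sum_smul_recombine]
    have h : S (R (Pi.single i 1)) - Pi.single i 1 ∈ η.relations := by
      rw [← hR, LinearMap.mem_ker, map_sub, hRS, sub_self]
    rw [mem_relations] at h
    have h1 : ∑ j, S (R (Pi.single i 1)) j • η.form j =
        ∑ j, (Pi.single i 1 : ι → k) j • η.form j := by
      ext x y
      have h3 := LinearMap.congr_fun (LinearMap.congr_fun h x) y
      simp only [LinearMap.sum_apply, LinearMap.smul_apply, Pi.sub_apply, smul_eq_mul, sub_mul,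
        Finset.sum_sub_distrib, LinearMap.zero_apply] at h3 ⊢
      exact sub_eq_zero.1 h3
    rw [h1]
    simp [Pi.single_apply]
  cases η
  simp only [recombine, MultiQuad.mk.injEq] at this ⊢
  exact this

theorem aut_le_aut_recombine [DecidableEq ι] (θ : MultiQuad κ k V) (R : (ι → k) →ₗ[k] (κ → k)) :
    θ.Aut ≤ (θ.recombine R).Aut := by
  intro g hg i x y
  simp only [recombine_form, LinearMap.sum_apply, LinearMap.smul_apply]
  exact Finset.sum_congr rfl fun j _ => by rw [hg j x y]

theorem Isomorphic.recombine [DecidableEq ι] {θ : MultiQuad κ k V} {θ' : MultiQuad κ k V'}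
    (h : θ.Isomorphic θ')
    (R : (ι → k) →ₗ[k] (κ → k)) : (θ.recombine R).Isomorphic (θ'.recombine R) := by
  obtain ⟨e, he⟩ := h
  refine ⟨e, fun i x y => ?_⟩
  simp only [recombine_form, LinearMap.sum_apply, LinearMap.smul_apply]
  exact Finset.sum_congr rfl fun j _ => by rw [he j x y]

theorem exists_section [Finite ι] (E : Submodule k (ι → k)) :
    ∃ (m : ℕ) (R : (ι → k) →ₗ[k] (Fin m → k)) (S : (Fin m → k) →ₗ[k] (ι → k)),
      (∀ x, R (S x) = x) ∧ LinearMap.ker R = E := by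
  let b := Module.finBasis k ((ι → k) ⧸ E)
  let R : (ι → k) →ₗ[k] _ := b.equivFun.toLinearMap ∘ₗ E.mkQ
  obtain ⟨S, hS⟩ := R.exists_rightInverse_of_surjective
    (LinearMap.range_eq_top.2 (b.equivFun.surjective.comp E.mkQ_surjective))
  exact ⟨_, R, S, fun x => LinearMap.congr_fun hS x, by simp [R]⟩

theorem relations_recombine [Fintype ι] [DecidableEq ι] [Nontrivial V] {θ : MultiQuad κ k V}
    (h : θ.Nondeg)
    (R : (ι → k) →ₗ[k] (κ → k)) : (θ.recombine R).relations = LinearMap.ker R := by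
  ext c
  rw [mem_relations, sum_smul_recombine, LinearMap.mem_ker]
  exact ⟨h.eq_zero_of_sum_smul_eq_zero, fun hc => by simp [hc]⟩

/-- The recombined system keeps all automorphisms of `η`, hence irreducibility, and its forms are
independent, so `Irred.nondeg` applies. -/
theorem Irred.nondeg_recombine [Fintype ι] [DecidableEq ι] [IsAlgClosed k] [Uncountable k]
    [DecidableEq κ]
    {η : MultiQuad ι k V} (h : η.Irred) (hr : Module.rank k V ≤ Cardinal.aleph0)
    {R : (ι → k) →ₗ[k] (κ → k)} {S : (κ → k) →ₗ[k] (ι → k)}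
    (hRS : ∀ x, R (S x) = x) (hR : LinearMap.ker R = η.relations) : (η.recombine S).Nondeg := by
  refine Irred.nondeg ⟨h.1, fun N hN => h.2 N fun g hg => hN g (aut_le_aut_recombine _ _ hg)⟩ hr
    fun c hc => ?_
  rw [sum_smul_recombine, ← mem_relations, ← hR, LinearMap.mem_ker, hRS] at hc
  exact hc

end Recombine

/-! ### Biquadratic spaces built from four forms -/

section Double

variable {k V V' A A' : Type*} [Field k] [AddCommGroup V] [Module k V] [AddCommGroup V']
  [Module k V'] [AddCommGroup A] [Module k A] [AddCommGroup A'] [Module k A']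

/-- The biquadratic space is obtained from two copies of a space with four forms. -/
structure IsDouble (ω : MultiQuad (Fin 2) k V) (η : MultiQuad (Fin 4) k A)
    (e : (A × A) ≃ₗ[k] V) : Prop where
  form_zero : ∀ x y, ω.form 0 (e x) (e y) =
    η.form 0 x.1 y.1 + η.form 2 x.2 y.2 + η.form 3 x.1 y.2 + η.form 3 x.2 y.1
  form_one : ∀ x y, ω.form 1 (e x) (e y) =
    η.form 1 x.1 y.1 + η.form 3 x.2 y.2 + η.form 0 x.1 y.2 + η.form 0 x.2 y.1

/-- The condition on four forms under which the two copies are determined by the double. -/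
def Separated (η : MultiQuad (Fin 4) k A) : Prop :=
  ∀ x y z : A, η.form 0 x + η.form 1 z + η.form 3 y = 0 →
    η.form 0 z + η.form 2 y + η.form 3 x = 0 → x = 0 ∧ y = 0 ∧ z = 0

variable {ω : MultiQuad (Fin 2) k V} {ω' : MultiQuad (Fin 2) k V'} {η : MultiQuad (Fin 4) k A}
  {η' : MultiQuad (Fin 4) k A'} {e : (A × A) ≃ₗ[k] V} {e' : (A' × A') ≃ₗ[k] V'}

/-- Testing against each copy of `A` turns `ω_x = ω'_y` into two equations in `(x.1 - y.2, x.2,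
-y.1)`, which are those of `Separated`. -/
theorem IsDouble.form_eq_iff (h : IsDouble ω η e) (x y : A × A) :
    ω.form 0 (e x) = ω.form 1 (e y) ↔
      η.form 0 (x.1 - y.2) + η.form 1 (-y.1) + η.form 3 x.2 = 0 ∧
      η.form 0 (-y.1) + η.form 2 x.2 + η.form 3 (x.1 - y.2) = 0 := by
  constructor
  · intro hxy
    constructor <;> ext z
    · have := LinearMap.congr_fun hxy (e (z, 0))
      rw [h.form_zero, h.form_one] at this
      simp only [map_zero, add_zero] at this
      simp only [LinearMap.add_apply, map_sub, map_neg, LinearMap.sub_apply, LinearMap.neg_apply,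
        LinearMap.zero_apply]
      linear_combination this
    · have := LinearMap.congr_fun hxy (e (0, z))
      rw [h.form_zero, h.form_one] at this
      simp only [map_zero, add_zero, zero_add] at this
      simp only [LinearMap.add_apply, map_sub, map_neg, LinearMap.sub_apply, LinearMap.neg_apply,
        LinearMap.zero_apply]
      linear_combination this
  · rintro ⟨h1, h3⟩
    ext v
    obtain ⟨z, rfl⟩ := e.surjective v
    rw [h.form_zero, h.form_one]
    have h1' := LinearMap.congr_fun h1 z.1
    have h3' := LinearMap.congr_fun h3 z.2
    simp only [LinearMap.add_apply, map_sub, map_neg, LinearMap.sub_apply, LinearMap.neg_apply,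
      LinearMap.zero_apply] at h1' h3'
    linear_combination h1' + h3'

theorem IsDouble.form_eq_iff_of_separated (h : IsDouble ω η e) (hs : η.Separated) (x y : A × A) :
    ω.form 0 (e x) = ω.form 1 (e y) ↔ x.2 = 0 ∧ y = (0, x.1) := by
  rw [h.form_eq_iff]
  constructor
  · rintro ⟨h1, h3⟩
    obtain ⟨hx, hy, hz⟩ := hs _ _ _ h1 h3
    exact ⟨hy, Prod.ext (neg_eq_zero.1 hz) (sub_eq_zero.1 hx).symm⟩
  · rintro ⟨hx, rfl⟩
    simp [hx]

theorem IsDouble.separated (h : IsDouble ω η e)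
    (hK : ∀ x y, ω.form 0 (e x) = ω.form 1 (e y) → x.2 = 0 ∧ y = (0, x.1)) : η.Separated := by
  intro x y z h1 h3
  obtain ⟨hy, hx⟩ := hK (x, y) (-z, 0) ((h.form_eq_iff _ _).2 (by simpa using ⟨h1, h3⟩))
  rw [Prod.mk.injEq] at hx
  exact ⟨hx.2.symm, hy, neg_eq_zero.1 hx.1⟩

theorem Separated.goodSubspace [Nontrivial A] (hs : η.Separated) : GoodSubspace η.relations := by
  intro a b c h1 h3
  obtain ⟨s, hs0⟩ := exists_ne (0 : A)
  rw [mem_relations, Fin.sum_univ_four] at h1 h3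
  have h1' := LinearMap.congr_fun h1 s
  have h3' := LinearMap.congr_fun h3 s
  obtain ⟨ha, hb, hc⟩ := hs (a • s) (b • s) (c • s) (by simpa using h1')
    (by simpa using h3')
  exact ⟨(smul_eq_zero.1 ha).resolve_right hs0, (smul_eq_zero.1 hb).resolve_right hs0,
    (smul_eq_zero.1 hc).resolve_right hs0⟩

theorem apply_fin_four {κ : Type*} (R : (Fin 4 → k) →ₗ[k] (κ → k)) (c : Fin 4 → k) :
    R c = fun j => c 0 * R (Pi.single 0 1) j + c 1 * R (Pi.single 1 1) j +
      c 2 * R (Pi.single 2 1) j + c 3 * R (Pi.single 3 1) j := by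
  have hc : c = c 0 • Pi.single 0 1 + c 1 • Pi.single 1 1 + c 2 • Pi.single 2 1 +
      c 3 • Pi.single 3 1 := by
    funext i
    fin_cases i <;> simp
  funext j
  conv_lhs => rw [hc]
  simp

/-- Joint nondegeneracy splits the two equations of `Separated` into equations between vectors, one
for each form. Applying any linear functional to them yields scalars `a, b, c` as in `GoodSubspace`.
-/
theorem separated_recombine {κ : Type*} [Fintype κ] {θ : MultiQuad κ k A} (h : θ.Nondeg)
    {R : (Fin 4 → k) →ₗ[k] (κ → k)} (hR : GoodSubspace (LinearMap.ker R)) :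
    (θ.recombine R).Separated := by
  intro x y z h1 h3
  have key : ∀ (r0 r1 r2 : κ → k) (x y z : A), (∑ j, r0 j • θ.form j) x + (∑ j, r1 j • θ.form j) y +
      (∑ j, r2 j • θ.form j) z = 0 → ∀ j, r0 j • x + r1 j • y + r2 j • z = 0 := by
    intro r0 r1 r2 x y z hxyz
    refine congrFun (h (fun j => r0 j • x + r1 j • y + r2 j • z) ?_)
    rw [← hxyz]
    simp [LinearMap.sum_apply, Finset.sum_add_distrib]
  have h1' := key _ _ _ _ _ _ h1
  have h3' := key _ _ _ _ _ _ h3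
  have hf : ∀ f : Module.Dual k A, f x = 0 ∧ f y = 0 ∧ f z = 0 := by
    intro f
    refine hR (f x) (f y) (f z) ?_ ?_
    · rw [LinearMap.mem_ker]
      funext j
      rw [apply_fin_four]
      have := congrArg f (h1' j)
      simp only [map_add, map_smul, smul_eq_mul, map_zero] at this
      simp
      linear_combination this
    · rw [LinearMap.mem_ker]
      funext j
      rw [apply_fin_four]
      have := congrArg f (h3' j)
      simp only [map_add, map_smul, smul_eq_mul, map_zero] at this
      simp
      linear_combination this
  refine ⟨?_, ?_, ?_⟩
  · exact (Module.forall_dual_apply_eq_zero_iff k x).1 fun f => (hf f).1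
  · exact (Module.forall_dual_apply_eq_zero_iff k y).1 fun f => (hf f).2.1
  · exact (Module.forall_dual_apply_eq_zero_iff k z).1 fun f => (hf f).2.2

/-- `Separated` asserts the injectivity of a linear map from three copies of `A` to two copies of
its dual. -/
theorem Separated.not_finiteDimensional [Nontrivial A] (hs : η.Separated) :
    ¬ FiniteDimensional k A := by
  intro hA
  let L : (A × A × A) →ₗ[k] (Module.Dual k A × Module.Dual k A) :=
    ((η.form 0).coprod ((η.form 3).coprod (η.form 1))).prod
      ((η.form 3).coprod ((η.form 2).coprod (η.form 0)))
  have hL : Function.Injective L := by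
    rw [injective_iff_map_eq_zero]
    rintro ⟨x, y, z⟩ hxyz
    have h1 : η.form 0 x + (η.form 3 y + η.form 1 z) = 0 := congrArg Prod.fst hxyz
    have h3 : η.form 3 x + (η.form 2 y + η.form 0 z) = 0 := congrArg Prod.snd hxyz
    obtain ⟨rfl, rfl, rfl⟩ := hs x y z (by rw [← h1]; abel) (by rw [← h3]; abel)
    rfl
  have h1 := LinearMap.finrank_le_finrank_of_injective hL
  simp only [Module.finrank_prod, Subspace.dual_finrank_eq] at h1
  have := Module.finrank_pos (R := k) (M := A)
  omega

theorem IsDouble.isomorphic (h : IsDouble ω η e) (h' : IsDouble ω' η' e') (hη : η.Isomorphic η') :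
    ω.Isomorphic ω' := by
  obtain ⟨f, hf⟩ := hη
  refine ⟨e.symm.trans ((f.prodCongr f).trans e'), fun i x y => ?_⟩
  obtain ⟨x, rfl⟩ := e.surjective x
  obtain ⟨y, rfl⟩ := e.surjective y
  fin_cases i
  · simp [h.form_zero, h'.form_zero, hf]
  · simp [h.form_one, h'.form_one, hf]

theorem IsDouble.prodCongr_mem_Aut (h : IsDouble ω η e) {g : A ≃ₗ[k] A} (hg : g ∈ η.Aut) :
    e.symm.trans ((g.prodCongr g).trans e) ∈ ω.Aut := by
  intro i x y
  obtain ⟨x, rfl⟩ := e.surjective x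
  obtain ⟨y, rfl⟩ := e.surjective y
  have hg' := mem_Aut.1 hg
  fin_cases i
  · simp [h.form_zero, hg']
  · simp [h.form_one, hg']

/-- The solutions of `ω_x = ω'_y` are exactly the pairs `(a, 0), (0, a)`. Automorphisms permute
solutions, so they act on both copies by the same map. -/
theorem IsDouble.exists_of_mem_Aut (h : IsDouble ω η e) (hs : η.Separated) {g : V ≃ₗ[k] V}
    (hg : g ∈ ω.Aut) : ∃ f : A →ₗ[k] A, ∀ x, g (e x) = e (f x.1, f x.2) := by
  have hK := h.form_eq_iff_of_separated hs
  have h1 : ∀ a, (e.symm (g (e (a, 0)))).2 = 0 ∧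
      e.symm (g (e (0, a))) = (0, (e.symm (g (e (a, 0)))).1) := by
    intro a
    rw [← hK, LinearEquiv.apply_symm_apply, LinearEquiv.apply_symm_apply]
    ext v
    obtain ⟨v, rfl⟩ := g.surjective v
    rw [hg, hg, (hK (a, 0) (0, a)).2 ⟨rfl, rfl⟩]
  refine ⟨LinearMap.fst k A A ∘ₗ e.symm.toLinearMap ∘ₗ g.toLinearMap ∘ₗ e.toLinearMap ∘ₗ
    LinearMap.inl k A A, fun ⟨x, y⟩ => ?_⟩
  have hxy : e (x, y) = e (x, 0) + e (0, y) := by rw [← map_add]; simp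
  rw [← LinearEquiv.symm_apply_eq, hxy, map_add, map_add, (h1 y).2]
  ext1
  · simp
  · simpa using (h1 x).1

/-- The embedding is sought as `x ↦ (F(x, 0), F(0, x))` with `F : W × W → A`, the pulled-back forms
on `W × W` being free to choose by universality of `θ`. -/
theorem IsDouble.universal [IsAlgClosed k] {κ : Type*} [Fintype κ] (h2 : (2 : k) ≠ 0)
    {θ : MultiQuad κ k A} (hθ : θ.Nondeg) (hA : ¬ FiniteDimensional k A)
    {R : (Fin 4 → k) →ₗ[k] (κ → k)} (hR : GoodSubspace (LinearMap.ker R))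
    (h : IsDouble ω (θ.recombine R) e) : ω.Universal := by
  classical
  intro n ξ
  let r : Fin 4 → κ → k := fun i => R (Pi.single i 1)
  -- `L` computes the coefficients of `ω` and `ω'` on the image when `θ_j` has coefficient `s.1 j`
  -- on the first copy of `W` and `s.2 j` across the copies; cross terms occur twice. Its
  -- surjectivity is the case `b = 0` of `GoodSubspace`.
  let L : (κ → k) × (κ → k) →ₗ[k] (Fin 2 → k) := LinearMap.pi
    ![∑ j, ((r 0 j • LinearMap.proj j ∘ₗ LinearMap.fst k _ _) +
        (2 * r 3 j) • LinearMap.proj j ∘ₗ LinearMap.snd k _ _),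
      ∑ j, ((r 1 j • LinearMap.proj j ∘ₗ LinearMap.fst k _ _) +
        (2 * r 0 j) • LinearMap.proj j ∘ₗ LinearMap.snd k _ _)]
  have hL0 : ∀ s, L s 0 = ∑ j, (r 0 j * s.1 j + 2 * r 3 j * s.2 j) := fun s => by
    simp [L, LinearMap.sum_apply]
  have hL1 : ∀ s, L s 1 = ∑ j, (r 1 j * s.1 j + 2 * r 0 j * s.2 j) := fun s => by
    simp [L, LinearMap.sum_apply]
  have hLsurj : Function.Surjective L := by
    rw [← LinearMap.range_eq_top]
    by_contra hne
    obtain ⟨f, hf0, hf⟩ := Submodule.exists_le_ker_of_lt_top _ (lt_top_iff_ne_top.2 hne)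
    have hfv : ∀ v, f v = v 0 * f (Pi.single 0 1) + v 1 * f (Pi.single 1 1) := by
      intro v
      have hv : v = v 0 • Pi.single 0 1 + v 1 • Pi.single 1 1 := by
        funext i
        fin_cases i <;> simp
      conv_lhs => rw [hv]
      simp
    have hfL : ∀ s, f (L s) = 0 := fun s => hf ⟨s, rfl⟩
    have h1 : ∀ j, r 0 j * f (Pi.single 0 1) + r 1 j * f (Pi.single 1 1) = 0 := by
      intro j
      have := hfL (Pi.single j 1, 0)
      rw [hfv, hL0, hL1] at this
      simpa [Pi.single_apply] using this
    have h3 : ∀ j, r 3 j * f (Pi.single 0 1) + r 0 j * f (Pi.single 1 1) = 0 := by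
      intro j
      have := hfL (0, Pi.single j 1)
      rw [hfv, hL0, hL1] at this
      simp [Pi.single_apply] at this
      refine (mul_eq_zero.1 ?_).resolve_left h2
      linear_combination this
    obtain ⟨h5, -, h6⟩ := hR (f (Pi.single 0 1)) 0 (f (Pi.single 1 1)) (by
        rw [LinearMap.mem_ker, apply_fin_four]
        funext j
        simp
        linear_combination h1 j) (by
        rw [LinearMap.mem_ker, apply_fin_four]
        funext j
        simp
        linear_combination h3 j)
    exact hf0 (LinearMap.ext fun v => by rw [hfv, h5, h6]; simp)
  obtain ⟨s, hs⟩ := hLsurj ![1, 0]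
  obtain ⟨t, ht⟩ := hLsurj ![0, 1]
  have hs0 := (hL0 s).symm.trans (congrFun hs 0)
  have hs1 := (hL1 s).symm.trans (congrFun hs 1)
  have ht0 := (hL0 t).symm.trans (congrFun ht 0)
  have ht1 := (hL1 t).symm.trans (congrFun ht 1)
  let W := Fin n → k
  let σ : κ → LinearMap.BilinForm k W := fun j => s.1 j • ξ.form 0 + t.1 j • ξ.form 1
  let τ : κ → LinearMap.BilinForm k W := fun j => s.2 j • ξ.form 0 + t.2 j • ξ.form 1
  have hσ : ∀ j x y, σ j x y = s.1 j * ξ.form 0 x y + t.1 j * ξ.form 1 x y := fun j x y => by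
    simp [σ]
  have hτ : ∀ j x y, τ j x y = s.2 j * ξ.form 0 x y + t.2 j * ξ.form 1 x y := fun j x y => by
    simp [τ]
  let ζ : MultiQuad κ k (W × W) :=
    { form := fun j => (σ j).comp (.fst k W W) (.fst k W W) +
        ((τ j).comp (.fst k W W) (.snd k W W) + (τ j).comp (.snd k W W) (.fst k W W))
      symm := fun j => ⟨fun x y => by
        simp only [LinearMap.add_apply, LinearMap.BilinForm.comp_apply, hσ, hτ,
          LinearMap.fst_apply, LinearMap.snd_apply, form_comm ξ _ x.1, form_comm ξ _ x.2]
        ring⟩ }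
  have hζ : ∀ j x y, ζ.form j x y = σ j x.1 y.1 + (τ j x.1 y.2 + τ j x.2 y.1) := fun _ _ _ => rfl
  obtain ⟨F, hF, hF'⟩ := (hθ.universal h2 hA).exists_embedding ζ
  refine ⟨e.toLinearMap ∘ₗ (F ∘ₗ LinearMap.inl k W W).prod (F ∘ₗ LinearMap.inr k W W), ?_, ?_⟩
  · intro x y hxy
    have := congrArg Prod.fst (e.injective hxy)
    exact LinearMap.inl_injective (hF this)
  · intro i x y
    have hsum : ∀ (c c' : κ → k) (a b : k), ∑ j, (c j * s.1 j + 2 * c' j * s.2 j) = a →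
        ∑ j, (c j * t.1 j + 2 * c' j * t.2 j) = b →
        ∑ j, (c j * σ j x y + 2 * (c' j * τ j x y)) = a * ξ.form 0 x y + b * ξ.form 1 x y := by
      rintro c c' a b rfl rfl
      rw [Finset.sum_mul, Finset.sum_mul, ← Finset.sum_add_distrib]
      refine Finset.sum_congr rfl fun j _ => ?_
      rw [hσ, hτ]
      ring
    fin_cases i
    · change _ = ξ.form 0 x y
      refine (h.form_zero (F (x, 0), F (0, x)) (F (y, 0), F (0, y))).trans ?_
      simp only [recombine_form, LinearMap.sum_apply, LinearMap.smul_apply, hF', hζ,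
        LinearMap.zero_apply, map_zero, add_zero, zero_add, smul_zero, Finset.sum_const_zero]
      have := hsum _ _ _ _ hs0 ht0
      simp only [Finset.sum_add_distrib, ← Finset.mul_sum] at this
      simp only [smul_eq_mul]
      simp at this
      linear_combination this
    · change _ = ξ.form 1 x y
      refine (h.form_one (F (x, 0), F (0, x)) (F (y, 0), F (0, y))).trans ?_
      simp only [recombine_form, LinearMap.sum_apply, LinearMap.smul_apply, hF', hζ,
        LinearMap.zero_apply, map_zero, add_zero, zero_add, smul_zero, Finset.sum_const_zero]
      have := hsum _ _ _ _ hs1 ht1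
      simp only [Finset.sum_add_distrib, ← Finset.mul_sum] at this
      simp only [smul_eq_mul]
      simp at this
      linear_combination this

theorem IsDouble.inv_of_mem_iff (h : IsDouble ω η e) (hs : η.Separated) {N : Submodule k V}
    (hmem : ∀ x, e x ∈ N ↔ x.1 = 0) : ω.Inv N := by
  intro g hg v hv
  obtain ⟨x, rfl⟩ := e.surjective v
  obtain ⟨f, hf⟩ := h.exists_of_mem_Aut hs hg
  rw [hf, hmem, (hmem x).1 hv, map_zero]

theorem IsDouble.length_eq_two (h : IsDouble ω η e) (hs : η.Separated) (hη : η.Irred) :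
    ω.length = 2 := by
  have := hη.1
  have hmem : ∀ x, e x ∈ LinearMap.range (e.toLinearMap ∘ₗ LinearMap.inr k A A) ↔ x.1 = 0 := by
    intro x
    constructor
    · rintro ⟨y, hy⟩
      rw [← e.injective hy]
      rfl
    · intro hx
      exact ⟨x.2, congrArg e (Prod.ext hx.symm rfl)⟩
  refine length_eq_two_of_prod (h.inv_of_mem_iff hs hmem) hmem
    (fun N' hN' hne => (hη.2 _ fun g hg x hx => ?_).resolve_left hne)
    (fun N' hN' hne => (hη.2 _ fun g hg x hx => ?_).resolve_left hne)
  · simpa using hN' _ (h.prodCongr_mem_Aut hg) _ hx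
  · simpa using hN' _ (h.prodCongr_mem_Aut hg) _ hx

/-- As a representation, `V` is two copies of `A`, so scalar matrices of size two commute with the
action. Conversely, each block of an equivariant map is a scalar by Schur's lemma for `A`. -/
theorem IsDouble.commutant [IsAlgClosed k] [Uncountable k] (h : IsDouble ω η e) (hs : η.Separated)
    (hη : η.Irred) (hr : Module.rank k A ≤ Cardinal.aleph0) :
    Nonempty (ω.Commutant ≃ₐ[k] Matrix (Fin 2) (Fin 2) k) := by
  have := hη.1
  let φ : Matrix (Fin 2) (Fin 2) k → (V →ₗ[k] V) := fun M => e.toLinearMap ∘ₗ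
    ((M 0 0 • LinearMap.fst k A A + M 0 1 • LinearMap.snd k A A).prod
      (M 1 0 • LinearMap.fst k A A + M 1 1 • LinearMap.snd k A A)) ∘ₗ e.symm.toLinearMap
  have hφ : ∀ M x, φ M (e x) = e (M 0 0 • x.1 + M 0 1 • x.2, M 1 0 • x.1 + M 1 1 • x.2) :=
    fun M x => by simp [φ]
  have hφc : ∀ M, ω.Commutes (φ M) := by
    intro M g hg v
    obtain ⟨x, rfl⟩ := e.surjective v
    obtain ⟨f, hf⟩ := h.exists_of_mem_Aut hs hg
    rw [hf, hφ, hφ, hf]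
    simp
  let Φ : Matrix (Fin 2) (Fin 2) k →ₗ[k] ω.Commutant :=
    { toFun := fun M => (hφc M).toCommutant
      map_add' := fun M N => commutant_ext fun v => by
        obtain ⟨x, rfl⟩ := e.surjective v
        change φ (M + N) (e x) = φ M (e x) + φ N (e x)
        rw [hφ, hφ, hφ, ← map_add]
        simp only [Matrix.add_apply, Prod.mk_add_mk, add_smul]
        congr 2 <;> abel
      map_smul' := fun c M => commutant_ext fun v => by
        obtain ⟨x, rfl⟩ := e.surjective v
        change φ (c • M) (e x) = c • φ M (e x)
        rw [hφ, hφ, ← map_smul]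
        simp [smul_smul] }
  have hΦ : ∀ M x, (Φ M).toLinearMap (e x) =
    e (M 0 0 • x.1 + M 0 1 • x.2, M 1 0 • x.1 + M 1 1 • x.2) := hφ
  let Ψ : Matrix (Fin 2) (Fin 2) k →ₐ[k] ω.Commutant := AlgHom.ofLinearMap Φ
    (commutant_ext fun v => by
      obtain ⟨x, rfl⟩ := e.surjective v
      rw [hΦ]
      change _ = e x
      simp)
    (fun M N => commutant_ext fun v => by
      obtain ⟨x, rfl⟩ := e.surjective v
      rw [hΦ]
      change _ = (Φ M).toLinearMap ((Φ N).toLinearMap (e x))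
      rw [hΦ, hΦ]
      simp only [Matrix.mul_apply, Fin.sum_univ_two]
      congr 2 <;> module)
  have hΨ : ∀ M x, (Ψ M).toLinearMap (e x) =
    e (M 0 0 • x.1 + M 0 1 • x.2, M 1 0 • x.1 + M 1 1 • x.2) := hφ
  refine ⟨(AlgEquiv.ofBijective Ψ ⟨?_, fun ψ => ?_⟩).symm⟩
  · rw [injective_iff_map_eq_zero]
    intro M hM
    obtain ⟨a, ha⟩ := exists_ne (0 : A)
    have h1 := hΨ M (a, 0)
    have h3 := hΨ M (0, a)
    rw [hM] at h1 h3
    have h1' : (0 : A × A) = _ := e.injective ((map_zero e).trans h1)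
    have h3' : (0 : A × A) = _ := e.injective ((map_zero e).trans h3)
    have e00 : M 0 0 = 0 := by simpa [ha] using (congrArg Prod.fst h1').symm
    have e01 : M 0 1 = 0 := by simpa [ha] using (congrArg Prod.fst h3').symm
    have e10 : M 1 0 = 0 := by simpa [ha] using (congrArg Prod.snd h1').symm
    have e11 : M 1 1 = 0 := by simpa [ha] using (congrArg Prod.snd h3').symm
    ext i j
    fin_cases i <;> fin_cases j
    exacts [e00, e01, e10, e11]
  · have hψ := commutes_toLinearMap ψ
    have hg : ∀ g ∈ η.Aut, ∀ x, e.symm (ψ.toLinearMap (e (g x.1, g x.2))) =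
        (g (e.symm (ψ.toLinearMap (e x))).1, g (e.symm (ψ.toLinearMap (e x))).2) := by
      intro g hg x
      have := hψ _ (h.prodCongr_mem_Aut hg) (e x)
      simpa [LinearEquiv.eq_symm_apply, LinearEquiv.symm_apply_eq] using this
    have hsc : ∀ (i : A →ₗ[k] (A × A)) (π : (A × A) →ₗ[k] A),
        (∀ g : A ≃ₗ[k] A, ∀ x, i (g x) = (g (i x).1, g (i x).2)) →
        (∀ g : A ≃ₗ[k] A, ∀ x, π (g x.1, g x.2) = g (π x)) →
        ∃ c : k, ∀ x, π (e.symm (ψ.toLinearMap (e (i x)))) = c • x := by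
      intro i π hi hπ
      refine hη.exists_smul_of_commutes hr
        (φ := π ∘ₗ e.symm.toLinearMap ∘ₗ ψ.toLinearMap ∘ₗ e.toLinearMap ∘ₗ i) ?_
      intro g hg' x
      simp only [LinearMap.comp_apply, LinearEquiv.coe_coe]
      rw [hi, hg g hg', hπ]
    obtain ⟨a, ha⟩ := hsc (LinearMap.inl k A A) (LinearMap.fst k A A) (by simp) (by simp)
    obtain ⟨b, hb⟩ := hsc (LinearMap.inr k A A) (LinearMap.fst k A A) (by simp) (by simp)
    obtain ⟨c, hc⟩ := hsc (LinearMap.inl k A A) (LinearMap.snd k A A) (by simp) (by simp)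
    obtain ⟨d, hd⟩ := hsc (LinearMap.inr k A A) (LinearMap.snd k A A) (by simp) (by simp)
    refine ⟨!![a, b; c, d], commutant_ext fun v => ?_⟩
    obtain ⟨x, rfl⟩ := e.surjective v
    have hx : e x = e (LinearMap.inl k A A x.1) + e (LinearMap.inr k A A x.2) := by
      rw [← map_add]; simp
    rw [hΨ, eq_comm, ← LinearEquiv.symm_apply_eq, hx, map_add, map_add]
    ext1
    · rw [Prod.fst_add]
      exact congrArg₂ (· + ·) (ha x.1) (hb x.2)
    · rw [Prod.snd_add]
      exact congrArg₂ (· + ·) (hc x.1) (hd x.2)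

end Double

/-! ### Type III spaces as doubles -/

section TypeIII

variable {k V V' : Type*} [Field k] [AddCommGroup V] [Module k V] [AddCommGroup V'] [Module k V']
  {ω : MultiQuad (Fin 2) k V} {ω' : MultiQuad (Fin 2) k V'} {E : Submodule k (Fin 4 → k)}

/-- The identity `ω_x = ω'_(T x)` expresses the pairings between `U` and `U'` through the forms on
`U` and `U'`: `ω(x, T y) = ω'(T x, T y)` and `ω'(x, T y) = ω(x, y)`. -/
theorem TypeIII.exists_isDouble (h : ω.TypeIII E) :
    ∃ (A : Submodule k V) (η : MultiQuad (Fin 4) k A) (e : (A × A) ≃ₗ[k] V),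
      IsDouble ω η e ∧ η.Separated ∧ η.Irred ∧ E = η.relations := by
  obtain ⟨U, U', T, hc, hK, hirr, hE⟩ := h
  let e : (U × U) ≃ₗ[k] V := ((LinearEquiv.refl k U).prodCongr T).trans
    (Submodule.prodEquivOfIsCompl U U' hc)
  have he : ∀ x, e x = (x.1 : V) + T x.2 := fun x => rfl
  have hT : ∀ x : U, ω.form 0 (x : V) = ω.form 1 (T x : V) := fun x => (hK _ _).2 ⟨x.2, rfl⟩
  have hd : IsDouble ω (ω.fourForms T) e := by
    constructor
    · intro x y
      have h0 : (ω.fourForms T).form 0 x.1 y.1 = ω.form 0 x.1 y.1 := rfl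
      have h1 : (ω.fourForms T).form 2 x.2 y.2 = ω.form 0 (T x.2) (T y.2) := rfl
      have h3 : (ω.fourForms T).form 3 x.1 y.2 = ω.form 1 (T x.1) (T y.2) := rfl
      have h4 : (ω.fourForms T).form 3 x.2 y.1 = ω.form 1 (T x.2) (T y.1) := rfl
      rw [h0, h1, h3, h4, he, he, ← hT, form_comm ω 1, ← hT]
      simp only [map_add, LinearMap.add_apply, form_comm ω 0 (T x.2 : V) y.1]
      ring
    · intro x y
      have h0 : (ω.fourForms T).form 1 x.1 y.1 = ω.form 1 x.1 y.1 := rfl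
      have h1 : (ω.fourForms T).form 3 x.2 y.2 = ω.form 1 (T x.2) (T y.2) := rfl
      have h3 : (ω.fourForms T).form 0 x.1 y.2 = ω.form 0 x.1 y.2 := rfl
      have h4 : (ω.fourForms T).form 0 x.2 y.1 = ω.form 0 x.2 y.1 := rfl
      rw [h0, h1, h3, h4, he, he, hT x.2, form_comm ω 0 x.1 y.2, hT y.2]
      simp only [map_add, LinearMap.add_apply, form_comm ω 1 x.1 (T y.2 : V)]
      ring
  refine ⟨U, ω.fourForms T, e, hd, hd.separated fun x y hxy => ?_, isIrreducible_iff.1 hirr, hE⟩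
  obtain ⟨hx, hy⟩ := (hK _ _).1 hxy
  have hx2 : x.2 = 0 := by
    have h1 : (T x.2 : V) ∈ U := by
      rw [he] at hx
      exact (Submodule.add_mem_iff_right U x.1.2).1 hx
    have h3 := Submodule.disjoint_def.1 hc.disjoint _ h1 (T x.2).2
    exact (map_eq_zero_iff T T.injective).1 (Subtype.ext h3)
  refine ⟨hx2, e.injective ?_⟩
  rw [hy]
  have h1 : (⟨e x, hx⟩ : U) = x.1 := Subtype.ext (by
    change e x = x.1
    rw [he]
    simp [hx2])
  rw [h1, he]
  simp

theorem Isomorphic.irred {ι A B : Type*} [AddCommGroup A] [Module k A] [AddCommGroup B] [Module k B]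
    {η : MultiQuad ι k A} {η' : MultiQuad ι k B} (h : η.Isomorphic η') (hη : η.Irred) :
    η'.Irred := by
  obtain ⟨e, he⟩ := h
  have := hη.1
  refine ⟨e.injective.nontrivial, fun N hN => ?_⟩
  have hI : η.Inv (N.comap e.toLinearMap) := fun g hg x hx => by
    have h1 : e.symm.trans (g.trans e) ∈ η'.Aut := fun i x y => by
      obtain ⟨x, rfl⟩ := e.surjective x
      obtain ⟨y, rfl⟩ := e.surjective y
      simp [he, mem_Aut.1 hg]
    simpa using hN _ h1 _ hx
  rcases hη.2 _ hI with h | h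
  · left
    rw [Submodule.eq_bot_iff] at h ⊢
    intro x hx
    obtain ⟨x, rfl⟩ := e.surjective x
    rw [h x hx, map_zero]
  · right
    rw [eq_top_iff]
    rintro x -
    obtain ⟨x, rfl⟩ := e.surjective x
    exact h.ge (mem_top (x := x))

theorem Isomorphic.relations_eq {ι A B : Type*} [Fintype ι] [AddCommGroup A] [Module k A]
    [AddCommGroup B] [Module k B] {η : MultiQuad ι k A} {η' : MultiQuad ι k B}
    (h : η.Isomorphic η') : η.relations = η'.relations := by
  obtain ⟨e, he⟩ := h
  ext c
  rw [mem_relations, mem_relations]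
  constructor
  · intro h
    ext x y
    obtain ⟨x, rfl⟩ := e.surjective x
    obtain ⟨y, rfl⟩ := e.surjective y
    have := LinearMap.congr_fun (LinearMap.congr_fun h x) y
    simpa [LinearMap.sum_apply, he] using this
  · intro h
    ext x y
    have := LinearMap.congr_fun (LinearMap.congr_fun h (e x)) (e y)
    simpa [LinearMap.sum_apply, he] using this

theorem IsDouble.typeIII {A : Type*} [AddCommGroup A] [Module k A] {η : MultiQuad (Fin 4) k A}
    {e : (A × A) ≃ₗ[k] V} (h : IsDouble ω η e) (hs : η.Separated) (hη : η.Irred) :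
    ω.TypeIII η.relations := by
  let i : A →ₗ[k] V := e.toLinearMap ∘ₗ LinearMap.inl k A A
  let j : A →ₗ[k] V := e.toLinearMap ∘ₗ LinearMap.inr k A A
  have hi : Function.Injective i := e.injective.comp LinearMap.inl_injective
  have hj : Function.Injective j := e.injective.comp LinearMap.inr_injective
  let Ei := LinearEquiv.ofInjective i hi
  let Ej := LinearEquiv.ofInjective j hj
  have hEi : ∀ x, (Ei x : V) = e (x, 0) := fun x => rfl
  have hEj : ∀ x, (Ej x : V) = e (0, x) := fun x => rfl
  let T := Ei.symm.trans Ej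
  have hT : ∀ x, T (Ei x) = Ej x := fun x => by simp [T]
  have hiso : η.Isomorphic (ω.fourForms T) := by
    refine ⟨Ei, fun l x y => ?_⟩
    fin_cases l
    · change ω.form 0 (Ei x) (Ei y) = _
      rw [hEi, hEi, h.form_zero]
      simp
    · change ω.form 1 (Ei x) (Ei y) = _
      rw [hEi, hEi, h.form_one]
      simp
    · change ω.form 0 (T (Ei x)) (T (Ei y)) = _
      rw [hT, hT, hEj, hEj, h.form_zero]
      simp
    · change ω.form 1 (T (Ei x)) (T (Ei y)) = _
      rw [hT, hT, hEj, hEj, h.form_one]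
      simp
  refine ⟨LinearMap.range i, LinearMap.range j, T, ?_, fun x y => ?_,
    isIrreducible_iff.2 (hiso.irred hη), hiso.relations_eq⟩
  · refine IsCompl.of_eq ?_ ?_
    · rw [Submodule.eq_bot_iff]
      rintro _ ⟨⟨a, rfl⟩, ⟨b, hb⟩⟩
      have := e.injective hb
      obtain rfl : 0 = a := congrArg Prod.fst this
      exact map_zero i
    · rw [eq_top_iff]
      rintro v -
      obtain ⟨x, rfl⟩ := e.surjective v
      have hx : e x = e (x.1, 0) + e (0, x.2) := by rw [← map_add]; simp
      rw [hx]
      exact add_mem_sup ⟨x.1, rfl⟩ ⟨x.2, rfl⟩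
  · obtain ⟨x, rfl⟩ := e.surjective x
    obtain ⟨y, rfl⟩ := e.surjective y
    rw [h.form_eq_iff_of_separated hs]
    constructor
    · rintro ⟨hx, rfl⟩
      obtain ⟨x, x'⟩ := x
      obtain rfl : x' = 0 := hx
      refine ⟨⟨x, rfl⟩, ?_⟩
      have : (⟨e (x, 0), ⟨x, rfl⟩⟩ : LinearMap.range i) = Ei x := rfl
      rw [this, hT]
      rfl
    · rintro ⟨⟨a, ha⟩, hy⟩
      obtain rfl : (a, 0) = x := e.injective ha
      have : (⟨e (a, 0), ⟨a, ha⟩⟩ : LinearMap.range i) = Ei a := rfl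
      rw [this, hT, hEj] at hy
      exact ⟨rfl, e.injective hy⟩

theorem TypeIII.goodSubspace (h : ω.TypeIII E) : GoodSubspace E := by
  obtain ⟨A, η, e, hd, hs, hη, rfl⟩ := h.exists_isDouble
  have := hη.1
  exact hs.goodSubspace

theorem TypeIII.length_eq_two (h : ω.TypeIII E) : ω.length = 2 := by
  obtain ⟨A, η, e, hd, hs, hη, rfl⟩ := h.exists_isDouble
  exact hd.length_eq_two hs hη

theorem TypeIII.commutant [IsAlgClosed k] [Uncountable k] (hr : Module.rank k V ≤ Cardinal.aleph0)
    (h : ω.TypeIII E) : Nonempty (ω.Commutant ≃ₐ[k] Matrix (Fin 2) (Fin 2) k) := by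
  obtain ⟨A, η, e, hd, hs, hη, rfl⟩ := h.exists_isDouble
  exact hd.commutant hs hη ((Submodule.rank_le _).trans hr)

theorem TypeIII.universal [IsAlgClosed k] [Uncountable k] (h2 : (2 : k) ≠ 0)
    (hr : Module.rank k V ≤ Cardinal.aleph0) (h : ω.TypeIII E) : ω.Universal := by
  obtain ⟨A, η, e, hd, hs, hη, rfl⟩ := h.exists_isDouble
  have := hη.1
  obtain ⟨m, R, S, hRS, hR⟩ := exists_section η.relations
  rw [← recombine_recombine η hRS hR] at hd
  refine hd.universal h2 (hη.nondeg_recombine ((Submodule.rank_le _).trans hr) hRS hR)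
    hs.not_finiteDimensional ?_
  rw [hR]
  exact hs.goodSubspace

/-- With the same `E`, one pair `R`, `S` reduces both four-form spaces to jointly nondegenerate
systems with the same number of forms, which are isomorphic. -/
theorem TypeIII.isomorphic [IsAlgClosed k] [Uncountable k] (h2 : (2 : k) ≠ 0)
    (hr : Module.rank k V ≤ Cardinal.aleph0) (hr' : Module.rank k V' ≤ Cardinal.aleph0)
    (h : ω.TypeIII E) (h' : ω'.TypeIII E) : ω.Isomorphic ω' := by
  obtain ⟨A, η, e, hd, hs, hη, rfl⟩ := h.exists_isDouble
  obtain ⟨A', η', e', hd', hs', hη', hE⟩ := h'.exists_isDouble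
  have := hη.1
  have := hη'.1
  obtain ⟨m, R, S, hRS, hR⟩ := exists_section η.relations
  have hR' := hR.trans hE
  refine hd.isomorphic hd' ?_
  rw [← recombine_recombine η hRS hR, ← recombine_recombine η' hRS hR']
  exact ((hη.nondeg_recombine ((Submodule.rank_le _).trans hr) hRS hR).exists_equiv h2
    (hη'.nondeg_recombine ((Submodule.rank_le _).trans hr') hRS hR') hs.not_finiteDimensional
    hs'.not_finiteDimensional ((Submodule.rank_le _).trans hr)
    ((Submodule.rank_le _).trans hr')).recombine R

end TypeIII

end MultiQuad

namespace MultiQuad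
open Submodule Module

/-! ### Consequences of length two -/

section LengthTwo

variable {ι k V : Type*} [Field k] [AddCommGroup V] [Module k V] {ω : MultiQuad ι k V}

theorem eq_of_le_of_length_eq_two (hl : ω.length = 2) {N N' : Submodule k V} (hN : ω.Inv N)
    (hN' : ω.Inv N') (hbot : N ≠ ⊥) (htop : N' ≠ ⊤) (hle : N ≤ N') : N = N' := by
  by_contra hne
  exact ((length_eq_two_iff.1 hl).2 N N' hN hN' (lt_of_le_of_ne hle hne)).elim hbot htop

theorem Irred.length_ne_two (h : ω.Irred) : ω.length ≠ 2 := fun hl => by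
  obtain ⟨N, hN, hbot, htop⟩ := (length_eq_two_iff.1 hl).1
  exact (h.2 N hN).elim hbot htop

theorem Inv.exists_restrict {N : Submodule k V} (hN : ω.Inv N) {g : V ≃ₗ[k] V} (hg : g ∈ ω.Aut) :
    ∃ h : N ≃ₗ[k] N, ∀ x, (h x : V) = g x := by
  refine ⟨LinearEquiv.ofBijective (g.toLinearMap.restrict (hN g hg)) ⟨fun x y hxy => ?_,
    fun y => ?_⟩,
    fun x => rfl⟩
  · exact Subtype.ext (g.injective (congrArg Subtype.val hxy))
  · refine ⟨⟨g.symm y, hN _ (inv_mem hg) y y.2⟩, Subtype.ext ?_⟩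
    exact g.apply_symm_apply y

/-- The system `η` on `N` need not be the restriction of `ω`; it suffices that automorphisms of `V`
preserve it. This is used with the four forms of Type III. -/
theorem irred_of_minimal {κ : Type*} {N : Submodule k V} (hN : ω.Inv N) (hne : N ≠ ⊥)
    (hmin : ∀ N', ω.Inv N' → N' ≤ N → N' ≠ ⊥ → N' = N) {η : MultiQuad κ k N}
    (hη : ∀ g ∈ ω.Aut, ∀ h : N ≃ₗ[k] N, (∀ x, (h x : V) = g x) → h ∈ η.Aut) : η.Irred := by
  refine ⟨Submodule.nontrivial_iff_ne_bot.2 hne, fun N' hN' => ?_⟩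
  have hI : ω.Inv (N'.map N.subtype) := by
    rintro g hg _ ⟨x, hx, rfl⟩
    obtain ⟨h, hh⟩ := hN.exists_restrict hg
    exact ⟨h x, hN' h (hη g hg h hh) x hx, hh x⟩
  rw [or_iff_not_imp_left]
  intro hbot
  have h1 := hmin _ hI (Submodule.map_subtype_le N N')
    (fun h0 => hbot (Submodule.map_injective_of_injective N.injective_subtype
      (h0.trans (Submodule.map_bot _).symm)))
  rw [eq_top_iff]
  rintro x -
  obtain ⟨y, hy, hyx⟩ := h1.ge x.2
  rwa [← Subtype.ext hyx]

/-- By Dixmier some `ψ = φ - c` is not bijective. If it were injective, the ranges of `ψ` and `ψ ∘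
ψ` would be nested, nonzero and proper, hence equal, and `ψ` would be onto. -/
theorem exists_not_injective_of_length_eq_two [IsAlgClosed k] [Uncountable k] [Nontrivial V]
    (hr : Module.rank k V ≤ Cardinal.aleph0) (hl : ω.length = 2) {φ : V →ₗ[k] V}
    (hφ : ω.Commutes φ) : ∃ c : k, ¬ Function.Injective (φ - c • (LinearMap.id : V →ₗ[k] V)) := by
  by_contra! H
  obtain ⟨c, hc⟩ := exists_not_bijective_sub_smul hr φ
  set ψ := φ - c • (LinearMap.id : V →ₗ[k] V)
  have hψ : ω.Commutes ψ := hφ.sub_smul c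
  have hinj := H c
  have hW : (⊤ : Submodule k V).map ψ ≠ ⊤ := fun h => hc ⟨hinj, by
    rwa [Submodule.map_top, LinearMap.range_eq_top] at h⟩
  have hI := hψ.inv_map (inv_top (ω := ω))
  have hne : ∀ N : Submodule k V, N ≠ ⊥ → N.map ψ ≠ ⊥ := fun N hN h0 =>
    hN (Submodule.map_injective_of_injective hinj (h0.trans (Submodule.map_bot _).symm))
  have h1 := eq_of_le_of_length_eq_two hl (hψ.inv_map hI) hI (hne _ (hne _ top_ne_bot)) hW
    (Submodule.map_mono le_top)
  exact hW (Submodule.map_injective_of_injective hinj h1)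

theorem exists_not_injective_of_minimal [IsAlgClosed k] [Uncountable k]
    (hr : Module.rank k V ≤ Cardinal.aleph0) {N : Submodule k V} (hN : ω.Inv N) (hne : N ≠ ⊥)
    (hmin : ∀ N', ω.Inv N' → N' ≤ N → N' ≠ ⊥ → N' = N) (φ : N →ₗ[k] N)
    (hφ : ∀ g ∈ ω.Aut, ∀ x y : N, (y : V) = g x → (φ y : V) = g (φ x)) :
    ∃ c : k, ¬ Function.Injective (φ - c • (LinearMap.id : N →ₗ[k] N)) := by
  by_contra! H
  have := Submodule.nontrivial_iff_ne_bot.2 hne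
  obtain ⟨c, hc⟩ := exists_not_bijective_sub_smul ((Submodule.rank_le N).trans hr) φ
  refine hc ⟨H c, ?_⟩
  set ψ := φ - c • (LinearMap.id : N →ₗ[k] N) with hψ
  have hI : ω.Inv ((LinearMap.range ψ).map N.subtype) := by
    rintro g hg _ ⟨_, ⟨x, rfl⟩, rfl⟩
    refine ⟨ψ ⟨g x, hN g hg x x.2⟩, ⟨_, rfl⟩, ?_⟩
    have := hφ g hg x ⟨g x, hN g hg x x.2⟩ rfl
    simp [hψ, this]
  have h1 := hmin _ hI (Submodule.map_subtype_le N _) (fun h0 => by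
    have h3 := Submodule.map_injective_of_injective N.injective_subtype
      (h0.trans (Submodule.map_bot _).symm)
    rw [LinearMap.range_eq_bot] at h3
    obtain ⟨x, hx⟩ := exists_ne (0 : N)
    exact hx (H c (by rw [← hψ, h3]; rfl)))
  intro y
  obtain ⟨_, ⟨x, rfl⟩, hx⟩ := h1.ge y.2
  exact ⟨x, Subtype.ext hx⟩

theorem quotTotalKer_form (ω : MultiQuad ι k V) (i : ι) (x y : V) :
    ω.quotTotalKer.form i (Submodule.Quotient.mk x) (Submodule.Quotient.mk y) = ω.form i x y := by
  rw [form_comm]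
  rfl

end LengthTwo

/-! ### Universal spaces of length two belong to the seven families -/

section Biquadratic

variable {k V : Type*} [Field k] [AddCommGroup V] [Module k V] {ω : MultiQuad (Fin 2) k V}
  {p : OnePoint k}

theorem Universal.pencil_ne_zero (h : ω.Universal) (p : OnePoint k) : ω.pencil p ≠ 0 := by
  intro h0
  have : Subsingleton (V ⧸ ω.nullspace p) := Submodule.Quotient.subsingleton_iff.2 (by
    rw [nullspace, h0, LinearMap.ker_zero])
  exact h.not_finiteDimensional_quotient p inferInstance

theorem Universal.nullspace_ne_top (h : ω.Universal) (p : OnePoint k) : ω.nullspace p ≠ ⊤ :=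
  fun htop => h.pencil_ne_zero p (LinearMap.ker_eq_top.1 htop)

theorem Universal.eq_zero_of_sum_smul_eq_zero (h : ω.Universal) {c : Fin 2 → k}
    (hc : ∑ i, c i • ω.form i = 0) : c = 0 := by
  by_contra hne
  obtain ⟨p, a, ha, hp⟩ := exists_sum_smul_eq_pencil ω hne
  rw [hc, eq_comm, smul_eq_zero] at hp
  exact h.pencil_ne_zero p (hp.resolve_left ha)

theorem Nondeg.not_finiteDimensional [Nontrivial V] (h : ω.Nondeg) : ¬ FiniteDimensional k V := by
  intro hV
  have hinj : Function.Injective ((ω.form 0).coprod (ω.form 1)) := by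
    rw [injective_iff_map_eq_zero]
    rintro ⟨x, y⟩ hxy
    have := h ![x, y] (by simpa [Fin.sum_univ_two] using hxy)
    exact Prod.ext (congrFun this 0) (congrFun this 1)
  have h1 := LinearMap.finrank_le_finrank_of_injective hinj
  rw [Module.finrank_prod, Subspace.dual_finrank_eq] at h1
  have := Module.finrank_pos (R := k) (M := V)
  omega

/-- Here `N_p` is the total kernel, and `V / N_p` is irreducible because preimages of its stable
subspaces are stable. Universality makes the two forms independent. -/
theorem typeIc_of_perp_eq_top [IsAlgClosed k] [Uncountable k] (h2 : (2 : k) ≠ 0)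
    (hr : Module.rank k V ≤ Cardinal.aleph0) (hu : ω.Universal) (hl : ω.length = 2)
    (hN : ω.nullspace p ≠ ⊥) (hperp : ω.perp (ω.nullspace p) = ⊤) : ∃ d, ω.TypeIc d := by
  have hK : ω.totalKer = ω.nullspace p := by
    refine le_antisymm (fun x hx => ((mem_totalKer_iff_pencil (ne_other p)).1 hx).1) fun x hx => ?_
    rw [mem_totalKer]
    intro i
    ext y
    rw [form_comm]
    exact (hperp.ge (mem_top (x := y))) i x hx
  have hQ : ¬ FiniteDimensional k (V ⧸ ω.totalKer) := hK ▸ hu.not_finiteDimensional_quotient p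
  have hirr : ω.quotTotalKer.Irred := by
    refine ⟨not_subsingleton_iff_nontrivial.1 fun _ => hQ inferInstance, fun N hN' => ?_⟩
    have hI : ω.Inv (N.comap ω.totalKer.mkQ) := by
      intro g hg x hx
      have hmap : ω.totalKer.map g.toLinearMap = ω.totalKer := by
        refine le_antisymm (Submodule.map_le_iff_le_comap.2 (inv_totalKer ω g hg)) fun y hy => ?_
        exact ⟨g.symm y, inv_totalKer ω _ (inv_mem hg) y hy, g.apply_symm_apply y⟩
      refine hN' (Submodule.Quotient.equiv _ _ g hmap) (fun i a b => ?_) _ hx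
      obtain ⟨a, rfl⟩ := Submodule.Quotient.mk_surjective _ a
      obtain ⟨b, rfl⟩ := Submodule.Quotient.mk_surjective _ b
      rw [quotTotalKer_form, ← hg i a b, ← quotTotalKer_form]
      rfl
    rw [or_iff_not_imp_right]
    intro htop
    have h1 := eq_of_le_of_length_eq_two hl (inv_totalKer ω) hI (hK ▸ hN) (fun h0 => htop (by
      rw [← Submodule.map_comap_eq_of_surjective ω.totalKer.mkQ_surjective N, h0, Submodule.map_top,
        Submodule.range_mkQ])) (fun x hx => by
      rw [Submodule.mem_comap, Submodule.mkQ_apply, (Submodule.Quotient.mk_eq_zero _).2 hx]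
      exact zero_mem N)
    rw [← Submodule.map_comap_eq_of_surjective ω.totalKer.mkQ_surjective N, ← h1,
      Submodule.mkQ_map_self]
  have hnd := hirr.nondeg ((rank_quotient_le _).trans hr) fun c hc =>
    hu.eq_zero_of_sum_smul_eq_zero (by
      ext x y
      have := LinearMap.congr_fun (LinearMap.congr_fun hc (Submodule.Quotient.mk x))
        (Submodule.Quotient.mk y)
      simpa [LinearMap.sum_apply, quotTotalKer_form] using this)
  exact ⟨_, hK ▸ hN, hnd.universal h2 hQ, hnd.homogeneous h2 hQ ((rank_quotient_le _).trans hr),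
    rfl⟩

/-- On `N_p` all `ω(q)` with `q ≠ p` are proportional, so an isomorphism `T` for one point gives one
for every other point by rescaling. -/
theorem typeIIa_of_forall_eq (hu : ω.Universal) (hN : ω.nullspace p ≠ ⊥)
    (hperp : ω.perp (ω.nullspace p) = ω.nullspace p) (T : (V ⧸ ω.nullspace p) ≃ₗ[k] ω.nullspace p)
    (hT : ∀ x, ω.pencil (other p) (T (Submodule.Quotient.mk x) : V) = ω.pencil p x) :
    ω.TypeIIa p := by
  refine ⟨hu, hN, hperp, fun q hq => ?_⟩
  obtain ⟨c, c', hc, hpq⟩ := exists_pencil_eq_smul_add (ne_other p) hq.symm ω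
  refine ⟨T.trans (LinearEquiv.smulOfNeZero k _ c⁻¹ (inv_ne_zero hc)), fun x => ?_⟩
  have h0 : ω.pencil p (T (Submodule.Quotient.mk x) : V) = 0 := (T (Submodule.Quotient.mk x)).2
  have h1 : ((T.trans (LinearEquiv.smulOfNeZero k _ c⁻¹ (inv_ne_zero hc)))
      (Submodule.Quotient.mk x) : V) = c⁻¹ • (T (Submodule.Quotient.mk x) : V) := rfl
  rw [h1, map_smul, hpq, LinearMap.add_apply, LinearMap.smul_apply, LinearMap.smul_apply, h0,
    smul_zero, add_zero, hT, smul_smul, inv_mul_cancel₀ hc, one_smul]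

theorem typeIIc_of_forall (hu : ω.Universal) (hN : ω.nullspace p ≠ ⊥)
    (hperp : ω.perp (ω.nullspace p) = ω.nullspace p) (hK : ω.totalKer = ⊥)
    (key : ∀ x y, ω.pencil (other p) x = ω.pencil p y → x = 0) : ω.TypeIIc p := by
  refine ⟨hu, hN, hperp, fun x y hxy hli => ?_, hK⟩
  induction p using OnePoint.rec with
  | infty =>
    have := key x (-y) (by
      rw [map_neg, eq_neg_iff_add_eq_zero, ← hxy]
      simp [other])
    exact hli.ne_zero 0 this
  | coe a =>
    have := key (y - a • x) (-x) (by
      rw [map_neg, eq_neg_iff_add_eq_zero, ← hxy]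
      simp only [other, OnePoint.elim_some, pencil_coe, pencil_infty,
        LinearMap.add_apply, LinearMap.smul_apply, map_sub, map_smul]
      abel)
    rw [LinearIndependent.pair_iff] at hli
    exact one_ne_zero (hli (-a) 1 (by rw [← this]; module)).2

theorem typeIIa_or_typeIIc (hu : ω.Universal) (hl : ω.length = 2) (hN : ω.nullspace p ≠ ⊥)
    (hperp : ω.perp (ω.nullspace p) = ω.nullspace p) : ω.TypeIIa p ∨ ω.TypeIIc p := by
  have hNI := inv_nullspace ω p
  have hNtop := hu.nullspace_ne_top p
  have hK : ω.totalKer = ⊥ := by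
    by_contra hne
    have h1 := eq_of_le_of_length_eq_two hl (inv_totalKer ω) hNI hne hNtop fun x hx =>
      ((mem_totalKer_iff_pencil (ne_other p)).1 hx).1
    refine hNtop (hperp ▸ eq_top_iff.2 fun x _ i y hy => ?_)
    rw [← h1] at hy
    rw [form_comm, mem_totalKer.1 hy i]
    rfl
  set α := ω.pencil p with hα
  set β := ω.pencil (other p) with hβ
  have hinj : ∀ n ∈ ω.nullspace p, β n = 0 → n = 0 := fun n hn h0 => by
    have : n ∈ ω.totalKer := (mem_totalKer_iff_pencil (ne_other p)).2 ⟨hn, h0⟩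
    rwa [hK, mem_bot] at this
  have hequiv : ∀ g ∈ ω.Aut, ∀ x y, β x = α y → β (g x) = α (g y) := by
    intro g hg x y hxy
    ext z
    obtain ⟨z, rfl⟩ := g.surjective z
    obtain ⟨h1, -⟩ := (mem_Aut_iff_pencil (ne_other p)).1 hg y z
    obtain ⟨-, h3⟩ := (mem_Aut_iff_pencil (ne_other p)).1 hg x z
    rw [h1, h3, ← hα, ← hβ, hxy]
  let M : Submodule k V := ((ω.nullspace p).map β).comap α
  have hMI : ω.Inv M := by
    rintro g hg x ⟨n, hn, hnx⟩
    exact ⟨g n, hNI g hg n hn, hequiv g hg n x hnx⟩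
  have hNM : ω.nullspace p ≤ M := fun x hx => ⟨0, zero_mem _, by
    rw [map_zero]
    exact (mem_nullspace.1 hx).symm⟩
  by_cases hM : M = ⊤
  · left
    have hMx : ∀ x, ∃ n ∈ ω.nullspace p, β n = α x := fun x => hM.ge (mem_top (x := x))
    let M' : Submodule k V := ω.nullspace p ⊓ (LinearMap.range α).comap β
    have hM'I : ω.Inv M' := by
      rintro g hg n ⟨hn, x, hx⟩
      exact ⟨hNI g hg n hn, g x, (hequiv g hg n x hx.symm).symm⟩
    have hM' : M' = ω.nullspace p := by
      refine eq_of_le_of_length_eq_two hl hM'I hNI ?_ hNtop inf_le_left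
      obtain ⟨x, -, hx⟩ := SetLike.exists_of_lt (lt_top_iff_ne_top.2 hNtop)
      obtain ⟨n, hn, hnx⟩ := hMx x
      refine (Submodule.ne_bot_iff _).2 ⟨n, ⟨hn, x, hnx.symm⟩, ?_⟩
      rintro rfl
      rw [map_zero] at hnx
      exact hx (mem_nullspace.2 hnx.symm)
    let j : ω.nullspace p →ₗ[k] Module.Dual k V := β ∘ₗ (ω.nullspace p).subtype
    have hj : Function.Injective j := by
      rw [injective_iff_map_eq_zero]
      exact fun n hn => Subtype.ext (hinj n n.2 hn)
    let a : (V ⧸ ω.nullspace p) →ₗ[k] Module.Dual k V := (ω.nullspace p).liftQ α le_rfl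
    have ha : Function.Injective a := by
      rw [← LinearMap.ker_eq_bot]
      exact Submodule.ker_liftQ_eq_bot _ _ _ le_rfl
    have hrange : LinearMap.range a = LinearMap.range j := by
      refine le_antisymm ?_ ?_
      · rintro _ ⟨x, rfl⟩
        obtain ⟨x, rfl⟩ := Submodule.Quotient.mk_surjective _ x
        obtain ⟨n, hn, hnx⟩ := hMx x
        exact ⟨⟨n, hn⟩, hnx⟩
      · rintro _ ⟨n, rfl⟩
        obtain ⟨-, x, hx⟩ := hM'.ge n.2
        exact ⟨Submodule.Quotient.mk x, hx⟩
    let T := ((LinearEquiv.ofInjective a ha).trans (LinearEquiv.ofEq _ _ hrange)).trans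
      (LinearEquiv.ofInjective j hj).symm
    have hT : ∀ x, β (T (Submodule.Quotient.mk x) : V) = α x := by
      intro x
      have h1 : LinearEquiv.ofInjective j hj (T (Submodule.Quotient.mk x)) =
          LinearEquiv.ofEq _ _ hrange (LinearEquiv.ofInjective a ha (Submodule.Quotient.mk x)) := by
        simp [T]
      exact congrArg Subtype.val h1
    exact typeIIa_of_forall_eq hu hN hperp T hT
  · right
    have hMN := eq_of_le_of_length_eq_two hl hNI hMI hN hM hNM
    -- Since `α y` vanishes on `N_p`, the vector `x` is orthogonal to `N_p`, hence in it. Then `y ∈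
    -- M = N_p`, so `β x = α y = 0`.
    have key : ∀ x y, β x = α y → x = 0 := by
      intro x y hxy
      have hx : x ∈ ω.nullspace p := by
        rw [← hperp, mem_perp_nullspace (ne_other p)]
        intro n hn
        rw [← hβ, hxy, hα, pencil_comm, mem_nullspace.1 hn]
        rfl
      have hy : y ∈ ω.nullspace p := hMN.ge ⟨x, hx, hxy⟩
      exact hinj x hx (hxy.trans hy)
    exact typeIIc_of_forall hu hN hperp hK key

/-- `V` splits as `N_p^⊥ ⊕ N_p`. Independent forms on the irreducible `N_p^⊥` are jointly
nondegenerate (Ib). A dependence says that some `ω(r)` vanishes on `N_p^⊥`, which is then `N_r`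
(Ia). -/
theorem typeIa_or_typeIb [IsAlgClosed k] [Uncountable k] (h2 : (2 : k) ≠ 0)
    (hr : Module.rank k V ≤ Cardinal.aleph0) (hu : ω.Universal) (hl : ω.length = 2)
    (hN : ω.nullspace p ≠ ⊥) (hinf : ω.nullspace p ⊓ ω.perp (ω.nullspace p) = ⊥)
    (hP : ω.perp (ω.nullspace p) ≠ ⊥) : (∃ S, ω.TypeIa S) ∨ ∃ d, ω.TypeIb d p := by
  have hNI := inv_nullspace ω p
  have hPI := hNI.perp
  have hPtop : ω.perp (ω.nullspace p) ≠ ⊤ := fun h => hN (by rwa [h, inf_top_eq] at hinf)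
  have hc : IsCompl (ω.perp (ω.nullspace p)) (ω.nullspace p) := by
    refine IsCompl.of_eq (by rwa [inf_comm] at hinf) ?_
    by_contra hne
    have h1 := eq_of_le_of_length_eq_two hl hPI (hPI.sup hNI) hP hne le_sup_left
    have h3 : ω.nullspace p ≤ ω.perp (ω.nullspace p) := h1 ▸ le_sup_right
    exact hN (by rwa [inf_eq_left.2 h3] at hinf)
  have hirr : (ω.restrict (ω.perp (ω.nullspace p))).Irred :=
    irred_of_minimal hPI hP (fun N' hN' hle hne =>
      eq_of_le_of_length_eq_two hl hN' hPI hne hPtop hle) fun g hg h hh i x y => by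
        change ω.form i (h x) (h y) = ω.form i x y
        rw [hh, hh, hg]
  have := hirr.1
  have hr' := (Submodule.rank_le (ω.perp (ω.nullspace p))).trans hr
  by_cases hli : ∀ c : Fin 2 → k, ∑ i, c i • (ω.restrict (ω.perp (ω.nullspace p))).form i = 0 →
    c = 0
  · right
    have hnd := hirr.nondeg hr' hli
    exact ⟨_, hN, hnd.universal h2 hnd.not_finiteDimensional,
      hnd.homogeneous h2 hnd.not_finiteDimensional hr', hc, rfl⟩
  · left
    push Not at hli
    obtain ⟨c, hc0, hcne⟩ := hli
    obtain ⟨r, a, ha, hra⟩ := exists_sum_smul_eq_pencil (ω.restrict (ω.perp (ω.nullspace p))) hcne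
    rw [hc0, eq_comm, smul_eq_zero, or_iff_right ha] at hra
    have hle : ω.perp (ω.nullspace p) ≤ ω.nullspace r := by
      intro x hx
      rw [mem_nullspace]
      ext y
      have hy : y ∈ ω.perp (ω.nullspace p) ⊔ ω.nullspace p := by rw [hc.sup_eq_top]; trivial
      obtain ⟨y, hyP, n, hn, rfl⟩ := mem_sup.1 hy
      have h1 : ω.pencil r x y = 0 := by
        rw [← pencil_restrict ω _ r ⟨x, hx⟩ ⟨y, hyP⟩, hra]
        rfl
      have h3 : ω.pencil r x n = ω.pencil r 0 n :=
        pencil_eq_of_form_eq (fun i => by rw [hx i n hn]; simp) r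
      rw [map_add, h1, h3]
      simp
    have heq := eq_of_le_of_length_eq_two hl hPI (inv_nullspace ω r) hP (hu.nullspace_ne_top r) hle
    have hrp : r ≠ p := by
      rintro rfl
      exact hN (by rwa [heq, inf_idem] at hinf)
    rw [heq] at hc
    refine ⟨{r, p}, r, p, hrp, rfl, fun hfd => ?_, fun hfd => ?_, hc⟩
    · exact hu.not_finiteDimensional_quotient p
        (Submodule.quotientEquivOfIsCompl _ _ hc.symm).symm.finiteDimensional
    · exact hu.not_finiteDimensional_quotient r
        (Submodule.quotientEquivOfIsCompl _ _ hc).symm.finiteDimensional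

theorem exists_typeIII [IsAlgClosed k] [Uncountable k] (h2 : (2 : k) ≠ 0)
    (hr : Module.rank k V ≤ Cardinal.aleph0) (hu : ω.Universal) (hl : ω.length = 2)
    (hN : ∀ p, ω.nullspace p = ⊥) : ∃ E, ω.TypeIII E := by
  have hVinf := hu.not_finiteDimensional
  have : Nontrivial V := not_subsingleton_iff_nontrivial.1 fun _ => hVinf inferInstance
  have hN' : ∀ p x, ω.pencil p x = 0 → x = 0 := fun p x hx => by
    have : x ∈ ω.nullspace p := hx
    rwa [hN, mem_bot] at this
  have h0 : ∀ x, ω.form 0 x = 0 → x = 0 := fun x hx => hN' ((0 : k) : OnePoint k) x (by simp [hx])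
  have h1 : ∀ x, ω.form 1 x = 0 → x = 0 := hN' ∞
  have hinj0 : Function.Injective (ω.form 0) := (injective_iff_map_eq_zero _).2 h0
  have hinj1 : Function.Injective (ω.form 1) := (injective_iff_map_eq_zero _).2 h1
  have hequiv : ∀ g ∈ ω.Aut, ∀ x y, ω.form 0 x = ω.form 1 y → ω.form 0 (g x) = ω.form 1 (g y) := by
    intro g hg x y hxy
    ext z
    obtain ⟨z, rfl⟩ := g.surjective z
    rw [hg, hg, hxy]
  -- `U` and `U'` collect the `x` and the `y` occurring in solutions of `ω_x = ω'_y`; as both forms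
  -- are nondegenerate, each determines the other.
  let U : Submodule k V := (LinearMap.range (ω.form 1)).comap (ω.form 0)
  let U' : Submodule k V := (LinearMap.range (ω.form 0)).comap (ω.form 1)
  have hUI : ω.Inv U := by
    rintro g hg x ⟨y, hy⟩
    exact ⟨g y, (hequiv g hg x y hy.symm).symm⟩
  have hU'I : ω.Inv U' := by
    rintro g hg y ⟨x, hx⟩
    exact ⟨g x, hequiv g hg x y hx⟩
  let i : U →ₗ[k] Module.Dual k V := ω.form 0 ∘ₗ U.subtype
  let i' : U' →ₗ[k] Module.Dual k V := ω.form 1 ∘ₗ U'.subtype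
  have hi : Function.Injective i := hinj0.comp U.injective_subtype
  have hi' : Function.Injective i' := hinj1.comp U'.injective_subtype
  have hrange : LinearMap.range i = LinearMap.range i' := by
    refine le_antisymm ?_ ?_
    · rintro _ ⟨⟨x, y, hy⟩, rfl⟩
      exact ⟨⟨y, x, hy.symm⟩, hy⟩
    · rintro _ ⟨⟨y, x, hx⟩, rfl⟩
      exact ⟨⟨x, y, hx.symm⟩, hx⟩
  let T : U ≃ₗ[k] U' := ((LinearEquiv.ofInjective i hi).trans (LinearEquiv.ofEq _ _ hrange)).trans
    (LinearEquiv.ofInjective i' hi').symm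
  have hT : ∀ x : U, ω.form 0 (x : V) = ω.form 1 (T x : V) := by
    intro x
    have h1 : LinearEquiv.ofInjective i' hi' (T x) =
      LinearEquiv.ofEq _ _ hrange (LinearEquiv.ofInjective i hi x) := by simp [T]
    exact (congrArg Subtype.val h1).symm
  have hK : ∀ x y : V, ω.form 0 x = ω.form 1 y ↔ ∃ hx : x ∈ U, y = T ⟨x, hx⟩ := by
    intro x y
    constructor
    · intro hxy
      have hx : x ∈ U := ⟨y, hxy.symm⟩
      exact ⟨hx, hinj1 (hxy.symm.trans (hT ⟨x, hx⟩))⟩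
    · rintro ⟨hx, rfl⟩
      exact hT ⟨x, hx⟩
  have hTg : ∀ g ∈ ω.Aut, ∀ x y : U, (y : V) = g x → (T y : V) = g (T x) := by
    intro g hg x y hxy
    refine hinj1 ?_
    rw [← hT, hxy]
    exact hequiv g hg _ _ (hT x)
  have heig : ∀ (c : k) x, ω.form 0 x = c • ω.form 1 x → x = 0 := fun c x hx =>
    hN' ((-c : k) : OnePoint k) x (by simp [hx])
  have heig' : ∀ (c : k) x, ω.form 1 x = c • ω.form 0 x → x = 0 := by
    intro c x hx
    by_cases hc : c = 0
    · rw [hc, zero_smul] at hx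
      exact h1 x hx
    · exact heig c⁻¹ x (by rw [hx, smul_smul, inv_mul_cancel₀ hc, one_smul])
  -- `U = 0` means joint nondegeneracy, so `V` would be irreducible.
  have hUbot : U ≠ ⊥ := by
    intro hbot
    refine Irred.length_ne_two (Nondeg.irred (ω := ω) h2 (fun x hx => ?_) hVinf hr) hl
    rw [Fin.sum_univ_two] at hx
    have hx0 : x 0 = 0 := by
      have : x 0 ∈ U := ⟨-x 1, by rw [map_neg]; exact (eq_neg_of_add_eq_zero_left hx).symm⟩
      rwa [hbot, mem_bot] at this
    rw [hx0, map_zero, zero_add] at hx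
    funext j
    fin_cases j
    exacts [hx0, h1 _ hx]
  have hU'bot : U' ≠ ⊥ := by
    obtain ⟨x, hx, hx0⟩ := (Submodule.ne_bot_iff U).1 hUbot
    refine (Submodule.ne_bot_iff U').2 ⟨T ⟨x, hx⟩, (T ⟨x, hx⟩).2, fun h => hx0 ?_⟩
    exact congrArg Subtype.val ((map_eq_zero_iff T T.injective).1 (Subtype.ext h))
  -- If `U = V`, then `T` is an equivariant endomorphism of `V`. A vector killed by `T - c`
  -- satisfies `ω_x = c ω'_x`, so it lies in `N_(-c) = 0`.
  have hUtop : U ≠ ⊤ := by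
    intro htop
    let φ : V →ₗ[k] V := U'.subtype ∘ₗ T.toLinearMap ∘ₗ
      (LinearMap.id : V →ₗ[k] V).codRestrict U fun x => htop.ge mem_top
    have hφ : ∀ x, ω.form 0 x = ω.form 1 (φ x) := fun x => hT ⟨x, _⟩
    obtain ⟨c, hc⟩ := exists_not_injective_of_length_eq_two hr hl (φ := φ) fun g hg x =>
      hinj1 ((hφ (g x)).symm.trans (hequiv g hg x _ (hφ x)))
    refine hc ((injective_iff_map_eq_zero _).2 fun x hx => heig c x ?_)
    rw [LinearMap.sub_apply, sub_eq_zero] at hx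
    rw [hφ, hx]
    simp
  have hU'top : U' ≠ ⊤ := by
    intro htop
    let φ : V →ₗ[k] V := U.subtype ∘ₗ T.symm.toLinearMap ∘ₗ
      (LinearMap.id : V →ₗ[k] V).codRestrict U' fun x => htop.ge mem_top
    have hφ : ∀ x, ω.form 0 (φ x) = ω.form 1 x := fun x => by
      have := hT (T.symm ⟨x, htop.ge mem_top⟩)
      rwa [LinearEquiv.apply_symm_apply] at this
    obtain ⟨c, hc⟩ := exists_not_injective_of_length_eq_two hr hl (φ := φ) fun g hg x =>
      hinj0 ((hφ (g x)).trans (hequiv g hg _ x (hφ x)).symm)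
    refine hc ((injective_iff_map_eq_zero _).2 fun x hx => heig' c x ?_)
    rw [LinearMap.sub_apply, sub_eq_zero] at hx
    rw [← hφ, hx]
    simp
  have hmin : ∀ N', ω.Inv N' → N' ≤ U → N' ≠ ⊥ → N' = U := fun N' hN' hle hne =>
    eq_of_le_of_length_eq_two hl hN' hUI hne hUtop hle
  -- The same eigenvector argument, now for `T` as an endomorphism of the minimal stable subspace
  -- `U`.
  have hne : U ≠ U' := by
    intro heq
    let φ : U →ₗ[k] U := (LinearEquiv.ofEq U' U heq.symm).toLinearMap ∘ₗ T.toLinearMap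
    have hφ : ∀ x, (φ x : V) = T x := fun x => rfl
    obtain ⟨c, hc⟩ := exists_not_injective_of_minimal hr hUI hUbot hmin φ fun g hg x y hxy => by
      rw [hφ, hφ]
      exact hTg g hg x y hxy
    refine hc ((injective_iff_map_eq_zero _).2 fun x hx => Subtype.ext (heig c x ?_))
    rw [LinearMap.sub_apply, sub_eq_zero] at hx
    rw [hT, ← hφ, hx]
    simp
  have hdisj : U ⊓ U' = ⊥ := by
    by_contra hbot
    have h3 := eq_of_le_of_length_eq_two hl (hUI.inf hU'I) hUI hbot hUtop inf_le_left
    have h4 := eq_of_le_of_length_eq_two hl (hUI.inf hU'I) hU'I hbot hU'top inf_le_right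
    exact hne (h3.symm.trans h4)
  have hsup : U ⊔ U' = ⊤ := by
    by_contra htop
    have h3 := eq_of_le_of_length_eq_two hl hUI (hUI.sup hU'I) hUbot htop le_sup_left
    have h4 : U' ≤ U := h3 ▸ le_sup_right
    exact hU'bot (by rwa [inf_eq_right.2 h4] at hdisj)
  refine ⟨_, U, U', T, IsCompl.of_eq hdisj hsup, hK, isIrreducible_iff.2 ?_, rfl⟩
  refine irred_of_minimal hUI hUbot hmin fun g hg h hh l x y => ?_
  have hTh : ∀ x, (T (h x) : V) = g (T x) := fun x => hTg g hg x (h x) (hh x)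
  fin_cases l
  · change ω.form 0 (h x) (h y) = ω.form 0 x y
    rw [hh, hh, hg]
  · change ω.form 1 (h x) (h y) = ω.form 1 x y
    rw [hh, hh, hg]
  · change ω.form 0 (T (h x)) (T (h y)) = ω.form 0 (T x) (T y)
    rw [hTh, hTh, hg]
  · change ω.form 1 (T (h x)) (T (h y)) = ω.form 1 (T x) (T y)
    rw [hTh, hTh, hg]

theorem exists_type_of_length_eq_two [IsAlgClosed k] [Uncountable k] (h2 : (2 : k) ≠ 0)
    (hr : Module.rank k V ≤ Cardinal.aleph0) (hu : ω.Universal) (hl : ω.length = 2) :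
    (∃ S, ω.TypeIa S) ∨ (∃ d p, ω.TypeIb d p) ∨ (∃ d, ω.TypeIc d) ∨
      (∃ p, ω.TypeIIa p) ∨ (∃ p, ω.TypeIIb p) ∨ (∃ p, ω.TypeIIc p) ∨ (∃ E, ω.TypeIII E) := by
  by_cases hN : ∀ p, ω.nullspace p = ⊥
  · have := exists_typeIII h2 hr hu hl hN
    tauto
  push Not at hN
  obtain ⟨p, hp⟩ := hN
  have hNI := inv_nullspace ω p
  by_cases hinf : ω.nullspace p ⊓ ω.perp (ω.nullspace p) = ⊥
  · by_cases hP : ω.perp (ω.nullspace p) = ⊥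
    · have : ω.TypeIIb p := ⟨hu, hp, hP⟩
      tauto
    · rcases typeIa_or_typeIb h2 hr hu hl hp hinf hP with h | ⟨d, h⟩
      · exact Or.inl h
      · exact Or.inr (Or.inl ⟨d, p, h⟩)
  · have h1 := eq_of_le_of_length_eq_two hl (hNI.inf hNI.perp) hNI hinf (hu.nullspace_ne_top p)
      inf_le_left
    by_cases hP : ω.perp (ω.nullspace p) = ⊤
    · have := typeIc_of_perp_eq_top h2 hr hu hl hp hP
      tauto
    · have h3 := eq_of_le_of_length_eq_two hl hNI hNI.perp hp hP (inf_eq_left.1 h1)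
      have := typeIIa_or_typeIIc hu hl hp h3.symm
      rcases this with h | h
      · exact Or.inr (Or.inr (Or.inr (Or.inl ⟨p, h⟩)))
      · exact Or.inr (Or.inr (Or.inr (Or.inr (Or.inr (Or.inl ⟨p, h⟩)))))

end Biquadratic

end MultiQuad

namespace MultiQuad
open Submodule Module

/-! ### An explicit jointly nondegenerate system -/

section Free

variable {k : Type*} [Field k]

theorem gramForm_apply_single (M : ℕ → ℕ → k) (x : ℕ →₀ k) (j : ℕ) :
    gramForm Finsupp.basisSingleOne M x (Finsupp.basisSingleOne j) = x.sum fun b c =>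
      c * M b j := by
  rw [gramForm, Basis.constr_apply, Finsupp.sum, LinearMap.sum_apply]
  simp only [LinearMap.smul_apply, Basis.constr_basis, smul_eq_mul]
  rfl

/-- A nondegenerate system of `r` forms on a space of countable dimension. -/
def free (k : Type*) [Field k] (r : ℕ) : MultiQuad (Fin r) k (ℕ →₀ k) where
  form i := gramForm Finsupp.basisSingleOne fun a b =>
    (if b = Nat.pair a i + 1 then 1 else 0) + (if a = Nat.pair b i + 1 then 1 else 0)
  symm _ := gramForm_symm _ fun _ _ => add_comm _ _

/-- The basis vector of index `Nat.pair a i + 1` serves as a witness for the vector of index `a` in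
the `i`-th form. Applied to the largest index `a` in the supports of a relation, it isolates one
nonzero coefficient. -/
theorem free_nondeg (r : ℕ) : (free k r).Nondeg := by
  classical
  intro x hx
  by_contra hne
  obtain ⟨i₀, hi₀⟩ := Function.ne_iff.1 hne
  let S : Finset ℕ := Finset.univ.biUnion fun i => (x i).support
  have hS : S.Nonempty := by
    obtain ⟨a, ha⟩ := Finsupp.support_nonempty_iff.2 hi₀
    exact ⟨a, Finset.mem_biUnion.2 ⟨i₀, Finset.mem_univ _, ha⟩⟩
  obtain ⟨i, -, hi⟩ := Finset.mem_biUnion.1 (S.max'_mem hS)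
  set a := S.max' hS with ha
  have hle : ∀ l b, b ∈ (x l).support → b ≤ a := fun l b hb =>
    S.le_max' b (Finset.mem_biUnion.2 ⟨l, Finset.mem_univ _, hb⟩)
  -- The shift by one puts this index strictly above `a`, so the transposed terms in the Gram matrix
  -- would need an index beyond every support.
  have h1 := LinearMap.congr_fun hx (Finsupp.basisSingleOne (Nat.pair a i + 1))
  rw [LinearMap.sum_apply, Finset.sum_eq_single i] at h1
  · simp only [free, gramForm_apply_single] at h1
    rw [Finsupp.sum, Finset.sum_eq_single a] at h1
    · have h3 : a ≠ Nat.pair (Nat.pair a i + 1) i + 1 := by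
        have := Nat.left_le_pair (Nat.pair a i + 1) i
        have := Nat.left_le_pair a i
        omega
      simp [h3] at h1
      exact (Finsupp.mem_support_iff.1 hi) h1
    · intro b hb hba
      have h3 : b ≠ Nat.pair (Nat.pair a i + 1) i + 1 := by
        have := Nat.left_le_pair (Nat.pair a i + 1) i
        have := Nat.left_le_pair a i
        have := hle i b hb
        omega
      simp [h3, Nat.pair_eq_pair, Ne.symm hba]
    · exact fun h => absurd hi h
  · intro l _ hli
    simp only [free, gramForm_apply_single]
    refine Finset.sum_eq_zero fun b hb => ?_
    have h3 : b ≠ Nat.pair (Nat.pair a i + 1) l + 1 := by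
      have := Nat.left_le_pair (Nat.pair a i + 1) l
      have := Nat.left_le_pair a i
      have := hle l b hb
      omega
    have h4 : ¬ (i : ℕ) = l := fun h => hli (Fin.ext h.symm)
    simp [h3, Nat.pair_eq_pair, h4]
  · simp

theorem not_finiteDimensional_finsupp_nat : ¬ FiniteDimensional k (ℕ →₀ k) := by
  intro h
  have := Module.rank_lt_aleph0 k (ℕ →₀ k)
  rw [rank_finsupp_self, Cardinal.mk_nat] at this
  simp at this

theorem rank_finsupp_le (α : Type) [Countable α] : Module.rank k (α →₀ k) ≤ Cardinal.aleph0 := by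
  rw [rank_finsupp_self, Cardinal.lift_le_aleph0]
  exact Cardinal.mk_le_aleph0

theorem nonempty_equiv_nat {X : Type*} [AddCommGroup X] [Module k X] :
    Module.rank k X ≤ Cardinal.aleph0 → Nonempty (((ℕ →₀ k) × X) ≃ₗ[k] (ℕ →₀ k)) := by
  intro hX
  have hr : Module.rank k ((ℕ →₀ k) × X) ≤ Cardinal.aleph0 := by
    rw [rank_prod]
    exact Cardinal.add_le_aleph0.2 ⟨Cardinal.lift_le_aleph0.2 (rank_finsupp_le ℕ),
      Cardinal.lift_le_aleph0.2 hX⟩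
  obtain ⟨b⟩ := nonempty_basis_nat hr fun _ => not_finiteDimensional_finsupp_nat
    (FiniteDimensional.of_injective (LinearMap.inl k (ℕ →₀ k) X) LinearMap.inl_injective)
  exact ⟨b.repr⟩

end Free

/-! ### Realizing the parameters of Types Ia, Ib, Ic and III -/

section Examples

variable {k V X : Type*} [Field k] [AddCommGroup V] [Module k V] [AddCommGroup X] [Module k X]
  {ω : MultiQuad (Fin 2) k V} {p q : OnePoint k}

theorem exists_pencil_apply_eq (hpq : p ≠ q) (e : X ≃ₗ[k] V) {B B' : LinearMap.BilinForm k X}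
    (hB : B.IsSymm) (hB' : B'.IsSymm) : ∃ ω : MultiQuad (Fin 2) k V, ∀ x y,
      ω.pencil p (e x) (e y) = B x y ∧ ω.pencil q (e x) (e y) = B' x y := by
  obtain ⟨ω, hp, hq⟩ := exists_pencil_eq hpq (B := B.comp e.symm.toLinearMap e.symm.toLinearMap)
    (B' := B'.comp e.symm.toLinearMap e.symm.toLinearMap)
    ⟨fun x y => hB.eq (e.symm x) (e.symm y)⟩ ⟨fun x y => hB'.eq (e.symm x) (e.symm y)⟩
  exact ⟨ω, fun x y => by simp [hp, hq]⟩

theorem exists_isSum {ι A B : Type*} [AddCommGroup A] [Module k A] [AddCommGroup B] [Module k B]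
    (η : MultiQuad ι k A) (η' : MultiQuad ι k B) (e : (A × B) ≃ₗ[k] V) :
    ∃ ω : MultiQuad ι k V, IsSum ω η η' e := by
  let f := LinearMap.fst k A B ∘ₗ e.symm.toLinearMap
  let g := LinearMap.snd k A B ∘ₗ e.symm.toLinearMap
  exact ⟨⟨fun i => (η.form i).comp f f + (η'.form i).comp g g, fun i => ⟨fun x y => by
    simp [form_comm η i (f x), form_comm η' i (g x)]⟩⟩, fun i x y => by simp [f, g]⟩

theorem exists_isDouble {A : Type*} [AddCommGroup A] [Module k A] (η : MultiQuad (Fin 4) k A)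
    (e : (A × A) ≃ₗ[k] V) : ∃ ω : MultiQuad (Fin 2) k V, IsDouble ω η e := by
  let f := LinearMap.fst k A A ∘ₗ e.symm.toLinearMap
  let g := LinearMap.snd k A A ∘ₗ e.symm.toLinearMap
  refine ⟨⟨![(η.form 0).comp f f + (η.form 2).comp g g + (η.form 3).comp f g + (η.form 3).comp g f,
    (η.form 1).comp f f + (η.form 3).comp g g + (η.form 0).comp f g + (η.form 0).comp g f],
    fun i => ⟨fun x y => ?_⟩⟩, ⟨fun x y => by simp [f, g], fun x y => by simp [f, g]⟩⟩
  fin_cases i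
  · simp [form_comm η _ (f x), form_comm η _ (g x)]
    ring
  · simp [form_comm η _ (f x), form_comm η _ (g x)]
    ring

theorem exists_typeIa (hpq : p ≠ q) : ∃ ω : MultiQuad (Fin 2) k (ℕ →₀ k), ω.TypeIa {p, q} := by
  obtain ⟨e⟩ := nonempty_equiv_nat (k := k) (rank_finsupp_le ℕ)
  obtain ⟨ω, hω⟩ := exists_pencil_apply_eq hpq e
    (B := (dotForm k).comp (.snd k _ _) (.snd k _ _))
    (B' := (dotForm k).comp (.fst k _ _) (.fst k _ _))
    ⟨fun x y => dotForm_comm _ _⟩ ⟨fun x y => dotForm_comm _ _⟩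
  have hp : ∀ x, e x ∈ ω.nullspace p ↔ x.2 = 0 := by
    intro x
    rw [mem_nullspace]
    constructor
    · intro h
      refine dotForm_nondeg _ (LinearMap.ext fun y => ?_)
      exact (hω x (0, y)).1.symm.trans (LinearMap.congr_fun h _)
    · intro h
      refine LinearMap.ext fun y => ?_
      obtain ⟨y, rfl⟩ := e.surjective y
      simp [(hω x y).1, h]
  have hq : ∀ x, e x ∈ ω.nullspace q ↔ x.1 = 0 := by
    intro x
    rw [mem_nullspace]
    constructor
    · intro h
      refine dotForm_nondeg _ (LinearMap.ext fun y => ?_)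
      exact (hω x (y, 0)).2.symm.trans (LinearMap.congr_fun h _)
    · intro h
      refine LinearMap.ext fun y => ?_
      obtain ⟨y, rfl⟩ := e.surjective y
      simp [(hω x y).2, h]
  have hinf : ∀ (U : Submodule k (ℕ →₀ k)) (i : (ℕ →₀ k) →ₗ[k] ((ℕ →₀ k) × (ℕ →₀ k))),
      Function.Injective i → (∀ x, e (i x) ∈ U) → ¬ FiniteDimensional k U := by
    intro U i hi hU _
    have hj : Function.Injective ((e.toLinearMap ∘ₗ i).codRestrict U hU) := fun x y hxy =>
      hi (e.injective (congrArg Subtype.val hxy))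
    have : FiniteDimensional k (ℕ →₀ k) := FiniteDimensional.of_injective (V₂ := U)
      ((e.toLinearMap ∘ₗ i).codRestrict U hU) hj
    exact not_finiteDimensional_finsupp_nat this
  refine ⟨ω, p, q, hpq, rfl, hinf _ (.inl k _ _) LinearMap.inl_injective fun x => (hp _).2 rfl,
    hinf _ (.inr k _ _) LinearMap.inr_injective fun x => (hq _).2 rfl, IsCompl.of_eq ?_ ?_⟩
  · rw [Submodule.eq_bot_iff]
    rintro v ⟨h1, h3⟩
    obtain ⟨x, rfl⟩ := e.surjective v
    rw [show x = 0 from Prod.ext ((hq x).1 h3) ((hp x).1 h1), map_zero]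
  · rw [eq_top_iff]
    rintro v -
    obtain ⟨x, rfl⟩ := e.surjective v
    have hx : e x = e (x.1, 0) + e (0, x.2) := by rw [← map_add]; simp
    rw [hx]
    exact add_mem_sup ((hp _).2 rfl) ((hq _).2 rfl)

theorem Nondeg.eq_zero_of_pencil_eq_zero {η : MultiQuad (Fin 2) k V} (h : η.Nondeg) {x : V}
    (hx : η.pencil p x = 0) : x = 0 := by
  induction p using OnePoint.rec with
  | infty => exact congrFun (h ![0, x] (by simpa [Fin.sum_univ_two] using hx)) 1
  | coe a => exact congrFun (h ![x, a • x] (by simpa [Fin.sum_univ_two] using hx)) 0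

theorem toENat_rank_idx (d : ℕ∞) : Cardinal.toENat (Module.rank k (Idx d →₀ k)) = d := by
  rw [rank_finsupp_self, Cardinal.toENat_lift]
  induction d using ENat.recTopCoe with
  | top =>
    have : Infinite (Idx ⊤) := Infinite.of_injective (fun n : ℕ =>
      (⟨n, ENat.natCast_lt_top n⟩ : Idx ⊤))
      fun a b h => congrArg Subtype.val h
    exact Cardinal.toENat_eq_top.2 (Cardinal.aleph0_le_mk _)
  | coe n =>
    let σ : Fin n ≃ Idx n :=
      { toFun := fun i => ⟨i, Nat.cast_lt.2 i.2⟩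
        invFun := fun i => ⟨i, Nat.cast_lt.1 i.2⟩
        left_inv := fun _ => rfl
        right_inv := fun _ => rfl }
    rw [← Cardinal.mk_congr σ, Cardinal.mk_fin, Cardinal.toENat_nat]

theorem toENat_rank_eq_of_equiv {R M M' : Type*} [Semiring R] [AddCommMonoid M] [AddCommMonoid M']
    [Module R M] [Module R M'] (e : M ≃ₗ[R] M') :
    Cardinal.toENat (Module.rank R M) = Cardinal.toENat (Module.rank R M') := by
  rw [← Cardinal.toENat_lift, e.lift_rank_eq, Cardinal.toENat_lift]

theorem idx_nonempty {d : ℕ∞} (hd : 1 ≤ d) : Nonempty (Idx d) :=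
  ⟨⟨0, lt_of_lt_of_le (by simp) hd⟩⟩

theorem exists_linearEquiv_of_mem_iff {A B : Type*} [AddCommGroup A] [Module k A] [AddCommGroup B]
    [Module k B] (e : (A × B) ≃ₗ[k] V) {U : Submodule k V} (hU : ∀ x, e x ∈ U ↔ x.1 = 0) :
    ∃ f : B ≃ₗ[k] U, ∀ b, (f b : V) = e (0, b) := by
  refine ⟨LinearEquiv.ofBijective ((e.toLinearMap ∘ₗ LinearMap.inr k A B).codRestrict U
    fun b => (hU _).2 rfl) ⟨fun x y hxy => ?_, fun u => ?_⟩, fun b => rfl⟩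
  · exact LinearMap.inr_injective (e.injective (Subtype.ext_iff.1 hxy))
  · obtain ⟨x, hx⟩ := e.surjective u
    have h0 := (hU x).1 (hx ▸ u.2)
    refine ⟨x.2, Subtype.ext ?_⟩
    rw [← hx]
    exact congrArg e (Prod.ext h0.symm rfl)

/-- The example is the orthogonal sum of `free k 2` and a `d`-dimensional space on which `ω(p)` is
zero and `ω(q)` has an orthonormal basis. -/
theorem exists_typeIb [IsAlgClosed k] (h2 : (2 : k) ≠ 0) {d : ℕ∞} (hd : 1 ≤ d) (p : OnePoint k) :
    ∃ ω : MultiQuad (Fin 2) k (ℕ →₀ k), ω.TypeIb d p := by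
  classical
  have := idx_nonempty hd
  let B := Idx d →₀ k
  obtain ⟨e⟩ := nonempty_equiv_nat (k := k) (rank_finsupp_le (Idx d))
  let D : LinearMap.BilinForm k B := gramForm Finsupp.basisSingleOne fun i j =>
    if i = j then 1 else 0
  have hDb : ∀ i j, D (Finsupp.basisSingleOne i) (Finsupp.basisSingleOne j) =
    if i = j then 1 else 0 := gramForm_basis _ _
  have hD : D.IsSymm := gramForm_symm _ fun i j => by simp [eq_comm]
  have hDnd : ∀ x, D x = 0 → x = 0 := fun x hx => Finsupp.basisSingleOne.ext_elem fun i => by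
    rw [← apply_basis_of_orthonormal hDb, hx]
    simp
  obtain ⟨ζ, hζp, hζq⟩ := exists_pencil_eq (ne_other p) (B := (0 : LinearMap.BilinForm k B))
    (B' := D)
    ⟨fun x y => by simp⟩ hD
  obtain ⟨ω, hω⟩ := exists_isSum (free k 2) ζ e
  have hpen : ∀ r x y, ω.pencil r (e x) (e y) =
      (free k 2).pencil r x.1 y.1 + ζ.pencil r x.2 y.2 := by
    intro r x y
    induction r using OnePoint.rec with
    | infty => exact hω 1 x y
    | coe a =>
      simp only [pencil_coe, LinearMap.add_apply, LinearMap.smul_apply, hω _ x y, smul_eq_mul]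
      ring
  have hN : ∀ x, e x ∈ ω.nullspace p ↔ x.1 = 0 := by
    intro x
    rw [mem_nullspace]
    constructor
    · intro h
      refine (free_nondeg 2).eq_zero_of_pencil_eq_zero (p := p) (LinearMap.ext fun y => ?_)
      have := hpen p x (y, 0)
      rw [h, hζp] at this
      simpa using this.symm
    · intro h
      refine LinearMap.ext fun y => ?_
      obtain ⟨y, rfl⟩ := e.surjective y
      rw [hpen, h, hζp]
      simp
  have hP : ∀ x, e x ∈ ω.perp (ω.nullspace p) ↔ x.2 = 0 := by
    intro x
    rw [mem_perp_nullspace (ne_other p)]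
    constructor
    · intro h
      refine hDnd _ (LinearMap.ext fun y => ?_)
      have := hpen (other p) x (0, y)
      rw [h _ ((hN _).2 rfl), hζq] at this
      simpa using this.symm
    · intro h y hy
      obtain ⟨y, rfl⟩ := e.surjective y
      rw [hpen, (hN y).1 hy, h]
      simp
  obtain ⟨f, -⟩ := exists_linearEquiv_of_mem_iff e hN
  have hNbot : ω.nullspace p ≠ ⊥ := by
    rw [← Submodule.nontrivial_iff_ne_bot]
    exact f.symm.toEquiv.nontrivial
  have hnd : (ω.restrict (ω.perp (ω.nullspace p))).Nondeg := by
    intro x hx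
    have hx2 : ∀ i, (e.symm (x i)).2 = 0 := fun i => (hP _).1 (by
      rw [LinearEquiv.apply_symm_apply]
      exact (x i).2)
    have h1 := (free_nondeg 2) (fun i => (e.symm (x i)).1) (LinearMap.ext fun y => by
      have h3 := LinearMap.congr_fun hx ⟨e (y, 0), (hP _).2 rfl⟩
      rw [LinearMap.sum_apply] at h3 ⊢
      refine Eq.trans (Finset.sum_congr rfl fun i _ => ?_) h3
      have h4 := hω i (e.symm (x i)) (y, 0)
      rw [LinearEquiv.apply_symm_apply] at h4
      refine Eq.trans ?_ h4.symm
      simp)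
    funext i
    have h5 : e.symm (x i) = 0 := Prod.ext (congrFun h1 i) (hx2 i)
    exact Subtype.ext ((map_eq_zero_iff e.symm e.symm.injective).1 h5)
  have hr := rank_finsupp_le (k := k) ℕ
  have hinf : ¬ FiniteDimensional k (ω.perp (ω.nullspace p)) := fun _ =>
    not_finiteDimensional_finsupp_nat (FiniteDimensional.of_injective
      ((e.toLinearMap ∘ₗ LinearMap.inl k (ℕ →₀ k) B).codRestrict (ω.perp (ω.nullspace p))
        fun x => (hP _).2 rfl)
      fun x y hxy => LinearMap.inl_injective (e.injective (Subtype.ext_iff.1 hxy)))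
  refine ⟨ω, hNbot, hnd.universal h2 hinf, hnd.homogeneous h2 hinf ((Submodule.rank_le _).trans hr),
    IsCompl.of_eq ?_ ?_, ?_⟩
  · rw [Submodule.eq_bot_iff]
    rintro v ⟨h1, h3⟩
    obtain ⟨x, rfl⟩ := e.surjective v
    rw [show x = 0 from Prod.ext ((hN x).1 h3) ((hP x).1 h1), map_zero]
  · rw [eq_top_iff]
    rintro v -
    obtain ⟨x, rfl⟩ := e.surjective v
    have hx : e x = e (x.1, 0) + e (0, x.2) := by rw [← map_add]; simp
    rw [hx]
    exact add_mem_sup ((hP _).2 rfl) ((hN _).2 rfl)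
  · exact (toENat_rank_idx (k := k) d).symm.trans (toENat_rank_eq_of_equiv f)

theorem exists_typeIc [IsAlgClosed k] (h2 : (2 : k) ≠ 0) {d : ℕ∞} (hd : 1 ≤ d) :
    ∃ ω : MultiQuad (Fin 2) k (ℕ →₀ k), ω.TypeIc d := by
  have := idx_nonempty hd
  let B := Idx d →₀ k
  obtain ⟨e⟩ := nonempty_equiv_nat (k := k) (rank_finsupp_le (Idx d))
  obtain ⟨ω, hω⟩ := exists_isSum (free k 2) ⟨fun _ => (0 : LinearMap.BilinForm k B),
    fun _ => ⟨fun x y => by simp⟩⟩ e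
  replace hω : ∀ i x y, ω.form i (e x) (e y) = (free k 2).form i x.1 y.1 := fun i x y =>
    (hω i x y).trans (add_zero _)
  have hN : ∀ x, e x ∈ ω.totalKer ↔ x.1 = 0 := by
    intro x
    rw [mem_totalKer]
    constructor
    · intro h
      refine (free_nondeg 2).eq_zero_of_pencil_eq_zero (p := ∞) (LinearMap.ext fun y => ?_)
      exact (hω 1 x (y, 0)).symm.trans (by rw [h]; rfl)
    · intro h i
      refine LinearMap.ext fun y => ?_
      obtain ⟨y, rfl⟩ := e.surjective y
      rw [hω, h]
      simp
  obtain ⟨f, -⟩ := exists_linearEquiv_of_mem_iff e hN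
  have hNbot : ω.totalKer ≠ ⊥ := by
    rw [← Submodule.nontrivial_iff_ne_bot]
    exact f.symm.toEquiv.nontrivial
  have hnd : ω.quotTotalKer.Nondeg := by
    intro x hx
    choose z hz using fun i => Submodule.Quotient.mk_surjective ω.totalKer (x i)
    have h1 := (free_nondeg 2) (fun i => (e.symm (z i)).1) (LinearMap.ext fun y => by
      have h3 := LinearMap.congr_fun hx (Submodule.Quotient.mk (e (y, 0)))
      rw [LinearMap.sum_apply] at h3 ⊢
      refine Eq.trans (Finset.sum_congr rfl fun i _ => ?_) h3
      have h4 := hω i (e.symm (z i)) (y, 0)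
      rw [LinearEquiv.apply_symm_apply] at h4
      rw [← hz, quotTotalKer_form, h4])
    funext i
    have h5 := (hN (e.symm (z i))).2 (congrFun h1 i)
    rw [LinearEquiv.apply_symm_apply] at h5
    rw [← hz, (Submodule.Quotient.mk_eq_zero _).2 h5]
    rfl
  have hr := rank_finsupp_le (k := k) ℕ
  have hinf : ¬ FiniteDimensional k ((ℕ →₀ k) ⧸ ω.totalKer) := fun _ =>
    not_finiteDimensional_finsupp_nat (FiniteDimensional.of_injective
      (ω.totalKer.mkQ ∘ₗ e.toLinearMap ∘ₗ LinearMap.inl k (ℕ →₀ k) B) (by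
        rw [injective_iff_map_eq_zero]
        intro x hx
        exact (hN (x, 0)).1 ((Submodule.Quotient.mk_eq_zero _).1 hx)))
  exact ⟨ω, hNbot, hnd.universal h2 hinf, hnd.homogeneous h2 hinf ((rank_quotient_le _).trans hr),
    (toENat_rank_idx (k := k) d).symm.trans (toENat_rank_eq_of_equiv f)⟩

/-- The four forms are combinations of the jointly nondegenerate `free k m`, with coefficients given
by a surjection `R` from `k^4` with kernel `E`; their relations are then exactly `E`. -/
theorem exists_typeIII_of_goodSubspace [IsAlgClosed k] (h2 : (2 : k) ≠ 0)
    {E : Submodule k (Fin 4 → k)}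
    (hE : GoodSubspace E) : ∃ ω : MultiQuad (Fin 2) k (ℕ →₀ k), ω.TypeIII E := by
  obtain ⟨e⟩ := nonempty_equiv_nat (k := k) (rank_finsupp_le ℕ)
  obtain ⟨m, R, S, hRS, rfl⟩ := exists_section E
  obtain ⟨ω, hω⟩ := exists_isDouble ((free k m).recombine R) e
  have hirr := (free_nondeg (k := k) m).irred h2 not_finiteDimensional_finsupp_nat
    (rank_finsupp_le ℕ)
  have := hω.typeIII (separated_recombine (free_nondeg m) hE)
    ⟨hirr.1, fun N hN => hirr.2 N fun g hg => hN g (aut_le_aut_recombine _ _ hg)⟩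
  rw [relations_recombine (free_nondeg m)] at this
  exact ⟨ω, this⟩

end Examples

/-! ### Realizing the parameters of Types IIa, IIb and IIc -/

section TypeIIExamples

variable {k V : Type*} [Field k] [AddCommGroup V] [Module k V] {ω : MultiQuad (Fin 2) k V}
  {p : OnePoint k} {e : ((ℕ →₀ k) × (ℕ →₀ k)) ≃ₗ[k] V} {A B C : LinearMap.BilinForm k (ℕ →₀ k)}

theorem mem_nullspace_of_pencil_eq (hA : ∀ x, A x = 0 → x = 0)
    (hp : ∀ x y, ω.pencil p (e x) (e y) = A x.2 y.2) (x : (ℕ →₀ k) × (ℕ →₀ k)) :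
    e x ∈ ω.nullspace p ↔ x.2 = 0 := by
  rw [mem_nullspace]
  constructor
  · intro h
    refine hA _ (LinearMap.ext fun y => ?_)
    exact (hp x (0, y)).symm.trans (LinearMap.congr_fun h _)
  · intro h
    refine LinearMap.ext fun y => ?_
    obtain ⟨y, rfl⟩ := e.surjective y
    rw [hp, h]
    simp

theorem nullspace_ne_bot_of_pencil_eq (hA : ∀ x, A x = 0 → x = 0)
    (hp : ∀ x y, ω.pencil p (e x) (e y) = A x.2 y.2) : ω.nullspace p ≠ ⊥ :=
  (Submodule.ne_bot_iff _).2 ⟨e (Finsupp.single 0 1, 0),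
    (mem_nullspace_of_pencil_eq hA hp _).2 rfl, by simp [Prod.ext_iff]⟩

theorem perp_nullspace_of_pencil_eq (hA : ∀ x, A x = 0 → x = 0) (hC : ∀ x, C x = 0 → x = 0)
    (hp : ∀ x y, ω.pencil p (e x) (e y) = A x.2 y.2)
    (hq : ∀ x y, ω.pencil (other p) (e x) (e y) = C x.1 y.2 + C x.2 y.1) :
    ω.perp (ω.nullspace p) = ω.nullspace p := by
  ext v
  obtain ⟨x, rfl⟩ := e.surjective v
  rw [mem_nullspace_of_pencil_eq hA hp, mem_perp_nullspace (ne_other p)]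
  constructor
  · intro h
    refine hC _ (LinearMap.ext fun y => ?_)
    have := hq x (y, 0)
    rw [h _ ((mem_nullspace_of_pencil_eq hA hp _).2 rfl)] at this
    simpa using this.symm
  · intro h y hy
    obtain ⟨y, rfl⟩ := e.surjective y
    rw [hq, h, (mem_nullspace_of_pencil_eq hA hp y).1 hy]
    simp

theorem universal_of_pencil_eq
    (h : ∀ (n : ℕ) (B B' : LinearMap.BilinForm k (Fin n → k)), B.IsSymm → B'.IsSymm →
      ∃ F : ((Fin n → k) × (Fin n → k)) →ₗ[k] (ℕ →₀ k), Function.Injective F ∧ ∀ x y,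
        ω.pencil p (e (F (x, 0), F (0, x))) (e (F (y, 0), F (0, y))) = B x y ∧
        ω.pencil (other p) (e (F (x, 0), F (0, x))) (e (F (y, 0), F (0, y))) = B' x y) :
    ω.Universal := by
  refine universal_of_exists_pencil_embedding (ne_other p) fun n B B' hB hB' => ?_
  obtain ⟨F, hF, hF'⟩ := h n B B' hB hB'
  refine ⟨e.toLinearMap ∘ₗ (F ∘ₗ LinearMap.inl k _ _).prod (F ∘ₗ LinearMap.inr k _ _), ?_, hF'⟩
  intro x y hxy
  exact LinearMap.inl_injective (hF (congrArg Prod.fst (e.injective hxy)))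

/-- This form on `W × W` has `B` on the second copy and half of `B'` across; a pairing that adds
both cross terms then returns `B'`. -/
theorem crossForm_isSymm {W : Type*} [AddCommGroup W] [Module k W] {B B' : LinearMap.BilinForm k W}
    (hB : B.IsSymm) (hB' : B'.IsSymm) : ∃ D : LinearMap.BilinForm k (W × W), D.IsSymm ∧
      ∀ x y, D x y = B x.2 y.2 + (2 : k)⁻¹ * (B' x.1 y.2 + B' x.2 y.1) := by
  refine ⟨B.comp (.snd k W W) (.snd k W W) + (2 : k)⁻¹ • (B'.comp (.fst k W W) (.snd k W W) +
    B'.comp (.snd k W W) (.fst k W W)), ⟨fun x y => ?_⟩, fun x y => by simp [mul_add]⟩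
  have h1 : B x.2 y.2 = B y.2 x.2 := hB.eq x.2 y.2
  have h3 : B' x.1 y.2 = B' y.2 x.1 := hB'.eq x.1 y.2
  have h4 : B' x.2 y.1 = B' y.1 x.2 := hB'.eq x.2 y.1
  simp [h1, h3, h4]
  ring

theorem exists_quot_nullspace_equiv
    (hA : ∀ x, A x = 0 → x = 0) (hp : ∀ x y, ω.pencil p (e x) (e y) = A x.2 y.2)
    (hq : ∀ x y, ω.pencil (other p) (e x) (e y) = A x.1 y.2 + A x.2 y.1) :
    ∃ T : (V ⧸ ω.nullspace p) ≃ₗ[k] ω.nullspace p,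
      ∀ v : V, ω.pencil (other p) (T (Submodule.Quotient.mk v)) = ω.pencil p v := by
  have hmem := mem_nullspace_of_pencil_eq hA hp
  let φ : V →ₗ[k] ω.nullspace p := (e.toLinearMap ∘ₗ LinearMap.inl k _ _ ∘ₗ
    LinearMap.snd k _ _ ∘ₗ e.symm.toLinearMap).codRestrict _ fun x => (hmem _).2 rfl
  have hφ : ∀ x, (φ (e x) : V) = e (x.2, 0) := fun x =>
    congrArg (fun z : (ℕ →₀ k) × (ℕ →₀ k) => e (z.2, 0)) (e.symm_apply_apply x)
  have hφs : Function.Surjective φ := by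
    rintro ⟨v, hv⟩
    obtain ⟨x, rfl⟩ := e.surjective v
    refine ⟨e (0, x.1), Subtype.ext ?_⟩
    rw [hφ]
    exact congrArg e (Prod.ext rfl ((hmem x).1 hv).symm)
  have hφk : ω.nullspace p = LinearMap.ker φ := by
    ext v
    obtain ⟨x, rfl⟩ := e.surjective v
    rw [hmem, LinearMap.mem_ker, ← Submodule.coe_eq_zero, hφ, map_eq_zero_iff e e.injective]
    simp [Prod.ext_iff]
  refine ⟨(Submodule.quotEquivOfEq _ _ hφk).trans (φ.quotKerEquivOfSurjective hφs), fun v => ?_⟩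
  obtain ⟨x, rfl⟩ := e.surjective v
  change ω.pencil (other p) (φ (e x) : V) = _
  rw [hφ]
  refine LinearMap.ext fun w => ?_
  obtain ⟨y, rfl⟩ := e.surjective w
  rw [hp, hq]
  simp

theorem exists_typeIIa [IsAlgClosed k] (h2 : (2 : k) ≠ 0) (p : OnePoint k) :
    ∃ ω : MultiQuad (Fin 2) k (ℕ →₀ k), ω.TypeIIa p := by
  obtain ⟨e⟩ := nonempty_equiv_nat (k := k) (rank_finsupp_le ℕ)
  let π₁ := LinearMap.fst k (ℕ →₀ k) (ℕ →₀ k)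
  let π₂ := LinearMap.snd k (ℕ →₀ k) (ℕ →₀ k)
  obtain ⟨ω, hω⟩ := exists_pencil_apply_eq (ne_other p) e (B := (dotForm k).comp π₂ π₂)
    (B' := (dotForm k).comp π₁ π₂ + (dotForm k).comp π₂ π₁)
    ⟨fun x y => dotForm_comm _ _⟩ ⟨fun x y => by
      simp [dotForm_comm (π₁ x), dotForm_comm (π₂ x), add_comm]⟩
  have hp : ∀ x y, ω.pencil p (e x) (e y) = dotForm k x.2 y.2 := fun x y => (hω x y).1
  have hq : ∀ x y, ω.pencil (other p) (e x) (e y) = dotForm k x.1 y.2 + dotForm k x.2 y.1 :=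
    fun x y => (hω x y).2
  obtain ⟨T, hT⟩ := exists_quot_nullspace_equiv dotForm_nondeg hp hq
  refine ⟨ω, typeIIa_of_forall_eq (universal_of_pencil_eq (p := p) (e := e) fun n B B' hB hB' => ?_)
    (nullspace_ne_bot_of_pencil_eq dotForm_nondeg hp)
    (perp_nullspace_of_pencil_eq dotForm_nondeg dotForm_nondeg hp hq) T hT⟩
  obtain ⟨D, hD, hD'⟩ := crossForm_isSymm hB hB'
  obtain ⟨F, hF, hF'⟩ := ((single_nondeg (hB := dotForm_isSymm)
    dotForm_nondeg).universal h2 not_finiteDimensional_finsupp_nat).exists_embedding (single D hD)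
  replace hF' : ∀ x y, dotForm k (F x) (F y) = D x y := hF' ()
  refine ⟨F, hF, fun x y => ⟨?_, ?_⟩⟩
  · rw [hp, hF', hD']
    simp
  · rw [hq, hF', hF', hD', hD']
    simp
    field_simp
    ring

/-- With `A`, `C` jointly nondegenerate, `ω(p)` is `A` on the second copy, and `ω(q)` is `A` on the
first copy plus `C` across. Orthogonality of `(x₁, x₂)` to `N_p`, the first copy, reads `A x₁ + C x₂
= 0`. -/
theorem exists_typeIIb [IsAlgClosed k] (h2 : (2 : k) ≠ 0) (p : OnePoint k) :
    ∃ ω : MultiQuad (Fin 2) k (ℕ →₀ k), ω.TypeIIb p := by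
  obtain ⟨e⟩ := nonempty_equiv_nat (k := k) (rank_finsupp_le ℕ)
  let π₁ := LinearMap.fst k (ℕ →₀ k) (ℕ →₀ k)
  let π₂ := LinearMap.snd k (ℕ →₀ k) (ℕ →₀ k)
  let A := (free k 2).form 0
  let C := (free k 2).form 1
  have hA : ∀ x y, A x y = A y x := form_comm _ 0
  have hC : ∀ x y, C x y = C y x := form_comm _ 1
  have hAnd : ∀ x, A x = 0 → x = 0 := fun x hx =>
    (free_nondeg 2).eq_zero_of_pencil_eq_zero (p := ((0 : k) : OnePoint k)) (by simpa [A] using hx)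
  obtain ⟨ω, hω⟩ := exists_pencil_apply_eq (ne_other p) e (B := A.comp π₂ π₂)
    (B' := A.comp π₁ π₁ + (C.comp π₁ π₂ + C.comp π₂ π₁))
    ⟨fun x y => hA _ _⟩ ⟨fun x y => by simp [hC (π₁ x), hC (π₂ x), hA (π₁ x), add_comm]⟩
  have hp : ∀ x y, ω.pencil p (e x) (e y) = A x.2 y.2 := fun x y => (hω x y).1
  have hq : ∀ x y, ω.pencil (other p) (e x) (e y) = A x.1 y.1 + (C x.1 y.2 + C x.2 y.1) :=
    fun x y => (hω x y).2
  refine ⟨ω, universal_of_pencil_eq (p := p) (e := e) fun n B B' hB hB' => ?_,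
    nullspace_ne_bot_of_pencil_eq hAnd hp, ?_⟩
  · let W := Fin n → k
    obtain ⟨F, hF, hF'⟩ := ((free_nondeg 2).universal h2
      not_finiteDimensional_finsupp_nat).exists_embedding (W := W × W)
      ⟨![B'.comp (.fst k W W) (.fst k W W) + B.comp (.snd k W W) (.snd k W W), 0], fun i => by
        fin_cases i
        · exact ⟨fun x y => congrArg₂ (· + ·) (hB'.eq x.1 y.1) (hB.eq x.2 y.2)⟩
        · exact ⟨fun x y => rfl⟩⟩
    have hF0 : ∀ x y, A (F x) (F y) = B' x.1 y.1 + B x.2 y.2 := hF' 0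
    have hF1 : ∀ x y, C (F x) (F y) = 0 := hF' 1
    refine ⟨F, hF, fun x y => ⟨?_, ?_⟩⟩
    · rw [hp, hF0]
      simp
    · rw [hq, hF0, hF1, hF1]
      simp
  · rw [Submodule.eq_bot_iff]
    intro v hv
    obtain ⟨x, rfl⟩ := e.surjective v
    rw [mem_perp_nullspace (ne_other p)] at hv
    have h0 := free_nondeg 2 ![x.1, x.2] (LinearMap.ext fun y => by
      have := hv (e (y, 0)) ((mem_nullspace_of_pencil_eq hAnd hp _).2 rfl)
      rw [hq] at this
      simpa [Fin.sum_univ_two, A, C] using this)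
    rw [show x = 0 from Prod.ext (congrFun h0 0) (congrFun h0 1), map_zero]

/-- Here `ω(p)` is `A` on the second copy and `ω(q)` is `C` across. The equation `ω(q)_v = ω(p)_w`
becomes `C x₂ = 0` and `C x₁ = A y₂`, so joint nondegeneracy of `A`, `C` gives `v = 0`. -/
theorem exists_typeIIc [IsAlgClosed k] (h2 : (2 : k) ≠ 0) (p : OnePoint k) :
    ∃ ω : MultiQuad (Fin 2) k (ℕ →₀ k), ω.TypeIIc p := by
  obtain ⟨e⟩ := nonempty_equiv_nat (k := k) (rank_finsupp_le ℕ)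
  let π₁ := LinearMap.fst k (ℕ →₀ k) (ℕ →₀ k)
  let π₂ := LinearMap.snd k (ℕ →₀ k) (ℕ →₀ k)
  let A := (free k 2).form 0
  let C := (free k 2).form 1
  have hA : ∀ x y, A x y = A y x := form_comm _ 0
  have hC : ∀ x y, C x y = C y x := form_comm _ 1
  have hAnd : ∀ x, A x = 0 → x = 0 := fun x hx =>
    (free_nondeg 2).eq_zero_of_pencil_eq_zero (p := ((0 : k) : OnePoint k)) (by simpa [A] using hx)
  have hCnd : ∀ x, C x = 0 → x = 0 := fun x hx =>
    (free_nondeg 2).eq_zero_of_pencil_eq_zero (p := ∞) hx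
  obtain ⟨ω, hω⟩ := exists_pencil_apply_eq (ne_other p) e (B := A.comp π₂ π₂)
    (B' := C.comp π₁ π₂ + C.comp π₂ π₁)
    ⟨fun x y => hA _ _⟩ ⟨fun x y => by simp [hC (π₁ x), hC (π₂ x), add_comm]⟩
  have hp : ∀ x y, ω.pencil p (e x) (e y) = A x.2 y.2 := fun x y => (hω x y).1
  have hq : ∀ x y, ω.pencil (other p) (e x) (e y) = C x.1 y.2 + C x.2 y.1 :=
    fun x y => (hω x y).2
  have key : ∀ v w, ω.pencil (other p) v = ω.pencil p w → v = 0 := by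
    intro v w hvw
    obtain ⟨x, rfl⟩ := e.surjective v
    obtain ⟨y, rfl⟩ := e.surjective w
    have h1 : ∀ z : (ℕ →₀ k) × (ℕ →₀ k), C x.1 z.2 + C x.2 z.1 = A y.2 z.2 := fun z => by
      rw [← hp, ← hq, hvw]
    have hx2 : x.2 = 0 := hCnd _ (LinearMap.ext fun z => by simpa using h1 (z, 0))
    have h0 := free_nondeg 2 ![-y.2, x.1] (LinearMap.ext fun z => by
      have := h1 (0, z)
      simp only [map_zero, add_zero] at this
      simp only [Fin.sum_univ_two, Matrix.cons_val_zero, Matrix.cons_val_one, map_neg,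
        LinearMap.add_apply, LinearMap.neg_apply, LinearMap.zero_apply]
      exact neg_add_eq_zero.2 this.symm)
    rw [show x = 0 from Prod.ext (congrFun h0 1) hx2, map_zero]
  refine ⟨ω, typeIIc_of_forall (universal_of_pencil_eq (p := p) (e := e) fun n B B' hB hB' => ?_)
    (nullspace_ne_bot_of_pencil_eq hAnd hp) (perp_nullspace_of_pencil_eq hAnd hCnd hp hq) ?_ key⟩
  · let W := Fin n → k
    obtain ⟨D, hD, hD'⟩ := crossForm_isSymm (B := (0 : LinearMap.BilinForm k W))
      ⟨fun x y => by simp⟩ hB'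
    obtain ⟨F, hF, hF'⟩ := ((free_nondeg 2).universal h2
      not_finiteDimensional_finsupp_nat).exists_embedding (W := W × W)
      ⟨![B.comp (.snd k W W) (.snd k W W), D], fun i => by
        fin_cases i
        · exact ⟨fun x y => hB.eq x.2 y.2⟩
        · exact hD⟩
    have hF0 : ∀ x y, A (F x) (F y) = B x.2 y.2 := hF' 0
    have hF1 : ∀ x y, C (F x) (F y) = D x y := hF' 1
    refine ⟨F, hF, fun x y => ⟨?_, ?_⟩⟩
    · rw [hp, hF0]
    · rw [hq, hF1, hF1, hD', hD']
      simp
      field_simp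
      ring
  · rw [Submodule.eq_bot_iff]
    intro v hv
    exact key v 0 (by rw [map_zero, ((mem_totalKer_iff_pencil (ne_other p)).1 hv).2])

end TypeIIExamples

end MultiQuad

namespace MultiQuad
open Submodule Module

/-! ### The parameters are isomorphism invariants -/

section Invariance

variable {k V V' : Type*} [Field k] [AddCommGroup V] [Module k V] [AddCommGroup V'] [Module k V']
  {ω : MultiQuad (Fin 2) k V} {ω' : MultiQuad (Fin 2) k V'} {e : V ≃ₗ[k] V'} {p q r : OnePoint k}
  {d d' : ℕ∞} {E E' : Submodule k (Fin 4 → k)}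

theorem nonempty_equiv_of_mem_iff (e : V ≃ₗ[k] V') {U : Submodule k V} {U' : Submodule k V'}
    (h : ∀ x, x ∈ U ↔ e x ∈ U') : Nonempty (U ≃ₗ[k] U') := by
  refine ⟨e.ofSubmodules U U' (Submodule.ext fun y => ?_)⟩
  obtain ⟨x, rfl⟩ := e.surjective y
  rw [← h]
  exact e.injective.mem_set_image

theorem Isomorphic.nullspace_equiv (h : ω.Isomorphic ω') (p : OnePoint k) :
    Nonempty (ω.nullspace p ≃ₗ[k] ω'.nullspace p) := by
  obtain ⟨e, he⟩ := h
  refine nonempty_equiv_of_mem_iff e fun x => ?_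
  rw [mem_nullspace, mem_nullspace]
  have key : ∀ y, ω'.pencil p (e x) (e y) = ω.pencil p x y := fun y =>
    pencil_eq_of_form_eq (fun i => he i x y) p
  constructor
  · intro hx
    refine LinearMap.ext fun y => ?_
    obtain ⟨y, rfl⟩ := e.surjective y
    rw [key, hx]
    rfl
  · intro hx
    refine LinearMap.ext fun y => ?_
    rw [← key, hx]
    rfl

theorem Isomorphic.totalKer_equiv {ι : Type*} {ω : MultiQuad ι k V} {ω' : MultiQuad ι k V'}
    (h : ω.Isomorphic ω') : Nonempty (ω.totalKer ≃ₗ[k] ω'.totalKer) := by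
  obtain ⟨e, he⟩ := h
  refine nonempty_equiv_of_mem_iff e fun x => ?_
  rw [mem_totalKer, mem_totalKer]
  refine forall_congr' fun i => ⟨fun hx => LinearMap.ext fun y => ?_, fun hx =>
    LinearMap.ext fun y => ?_⟩
  · obtain ⟨y, rfl⟩ := e.surjective y
    rw [he, hx]
    rfl
  · rw [← he, hx]
    rfl

theorem Isomorphic.nullspace_eq_bot_iff (h : ω.Isomorphic ω') (p : OnePoint k) :
    ω.nullspace p = ⊥ ↔ ω'.nullspace p = ⊥ := by
  obtain ⟨f⟩ := h.nullspace_equiv p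
  rw [← Submodule.subsingleton_iff_eq_bot, ← Submodule.subsingleton_iff_eq_bot]
  exact f.toEquiv.subsingleton_congr

/-- For any other point `r`, the space `N_r` is orthogonal to `N_p` and to `N_q`. As `ω(q)` is
nondegenerate on `N_p` and `ω(p)` on `N_q`, a vector of `N_r` has no component in either. -/
theorem TypeIa.parameter_eq {S : Set (OnePoint k)} (h : ω.TypeIa S) :
    S = {r | ω.nullspace r ≠ ⊥} := by
  obtain ⟨p, q, hpq, rfl, hp, hq, hc⟩ := h
  ext r
  simp only [Set.mem_insert_iff, Set.mem_singleton_iff, Set.mem_ofPred_eq]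
  constructor
  · rintro (rfl | rfl) h0
    · exact hp (by rw [h0]; infer_instance)
    · exact hq (by rw [h0]; infer_instance)
  · contrapose!
    rintro ⟨hrp, hrq⟩
    rw [Submodule.eq_bot_iff]
    intro x hx
    have hx' := mem_nullspace.1 hx
    have aux : ∀ {p q : OnePoint k}, p ≠ q → IsCompl (ω.nullspace p) (ω.nullspace q) → r ≠ p →
        x ∈ ω.nullspace q := by
      intro p q hpq hc hrp
      obtain ⟨a, ha, b, hb, rfl⟩ := mem_sup.1 (hc.sup_eq_top ▸ mem_top : x ∈ _ ⊔ _)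
      have h1 := (mem_perp_nullspace hpq).1 ((mem_perp_nullspace (p := p) hrp.symm).2 fun y _ => by
        rw [hx']
        rfl)
      have h0 : (⟨a, ha⟩ : ω.nullspace p) = 0 := pencil_restrict_nondeg hc _ (by
        ext y
        have := h1 y y.2
        rw [map_add, mem_nullspace.1 hb, add_zero] at this
        rw [pencil_restrict, this]
        rfl)
      rw [show a = 0 from congrArg Subtype.val h0, zero_add]
      exact hb
    exact Submodule.disjoint_def.1 hc.disjoint x (aux hpq.symm hc.symm hrq) (aux hpq hc hrp)

theorem TypeIb.nullspace_eq_bot (h : ω.TypeIb d p) (hpq : p ≠ q) : ω.nullspace q = ⊥ := by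
  rw [Submodule.eq_bot_iff]
  intro x hx
  have hx' := mem_nullspace.1 hx
  have hxp : x ∈ ω.perp (ω.nullspace p) := (mem_perp_nullspace hpq).2 fun y _ => by
    rw [hx']
    rfl
  refine congrArg Subtype.val (h.nondeg.eq_zero_of_pencil_eq_zero (p := q) (x := ⟨x, hxp⟩)
    (LinearMap.ext fun y => ?_))
  rw [pencil_restrict, hx']
  rfl

theorem TypeIa.parameter_unique {S S' : Set (OnePoint k)} (hi : ω.Isomorphic ω')
    (h : ω.TypeIa S) (h' : ω'.TypeIa S') : S = S' := by
  rw [h.parameter_eq, h'.parameter_eq]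
  ext r
  exact not_congr (hi.nullspace_eq_bot_iff r)

theorem Isomorphic.point_unique (hi : ω.Isomorphic ω') (h : ω.nullspace p ≠ ⊥)
    (h' : ∀ r, q ≠ r → ω'.nullspace r = ⊥) : p = q := by
  by_contra hpq
  exact h ((hi.nullspace_eq_bot_iff p).2 (h' p (Ne.symm hpq)))

theorem TypeIb.parameter_unique (hi : ω.Isomorphic ω') (h : ω.TypeIb d p) (h' : ω'.TypeIb d' q) :
    d = d' ∧ p = q := by
  obtain rfl := hi.point_unique h.1 fun r => h'.nullspace_eq_bot
  obtain ⟨f⟩ := hi.nullspace_equiv p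
  exact ⟨h.2.2.2.2.trans ((toENat_rank_eq_of_equiv f).trans h'.2.2.2.2.symm), rfl⟩

theorem TypeIc.parameter_unique (hi : ω.Isomorphic ω') (h : ω.TypeIc d) (h' : ω'.TypeIc d') :
    d = d' := by
  obtain ⟨f⟩ := hi.totalKer_equiv
  exact h.2.2.2.trans ((toENat_rank_eq_of_equiv f).trans h'.2.2.2.symm)

theorem Isomorphic.symm {ι : Type*} {ω : MultiQuad ι k V} {ω' : MultiQuad ι k V'}
    (h : ω.Isomorphic ω') : ω'.Isomorphic ω := by
  obtain ⟨e, he⟩ := h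
  exact ⟨e.symm, fun i x y => by rw [← he, e.apply_symm_apply, e.apply_symm_apply]⟩

/-- The two copies of `A` and their identification are intrinsic, being read off from `ω_x = ω'_y`.
An isomorphism therefore induces a map `g` on the copies compatible with the four forms, and
relations pull back along it; linearity of `g` is not needed. -/
theorem IsDouble.relations_le {A A' : Type*} [AddCommGroup A] [Module k A] [AddCommGroup A']
    [Module k A'] {η : MultiQuad (Fin 4) k A} {η' : MultiQuad (Fin 4) k A'}
    {e : (A × A) ≃ₗ[k] V} {e' : (A' × A') ≃ₗ[k] V'} (hd : IsDouble ω η e) (hs : η.Separated)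
    (hd' : IsDouble ω' η' e') (hs' : η'.Separated) (hi : ω.Isomorphic ω') :
    η'.relations ≤ η.relations := by
  obtain ⟨f, hf⟩ := hi
  have hform : ∀ x y, ω.form 0 x = ω.form 1 y ↔ ω'.form 0 (f x) = ω'.form 1 (f y) := by
    intro x y
    constructor
    · intro h
      refine LinearMap.ext fun z => ?_
      obtain ⟨z, rfl⟩ := f.surjective z
      rw [hf, hf, h]
    · intro h
      refine LinearMap.ext fun z => ?_
      rw [← hf, ← hf, h]
  let g : A → A' := fun x => (e'.symm (f (e (x, 0)))).1
  have hg : ∀ x, f (e (x, 0)) = e' (g x, 0) ∧ f (e (0, x)) = e' (0, g x) := by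
    intro x
    have h1 := (hform _ _).1 ((hd.form_eq_iff_of_separated hs (x, 0) (0, x)).2 ⟨rfl, rfl⟩)
    obtain ⟨y, hy⟩ := e'.surjective (f (e (x, 0)))
    obtain ⟨z, hz⟩ := e'.surjective (f (e (0, x)))
    rw [← hy, ← hz, hd'.form_eq_iff_of_separated hs'] at h1
    have hgx : g x = y.1 := by simp only [g, ← hy, LinearEquiv.symm_apply_apply]
    rw [← hy, ← hz, hgx]
    exact ⟨congrArg e' (Prod.ext rfl h1.1), congrArg e' h1.2⟩
  have hη : ∀ i x y, η.form i x y = η'.form i (g x) (g y) := by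
    intro i x y
    have h0 := hf 0 (e (x, 0)) (e (y, 0))
    have h1 := hf 1 (e (x, 0)) (e (y, 0))
    have h2 := hf 0 (e (0, x)) (e (0, y))
    have h3 := hf 1 (e (0, x)) (e (0, y))
    rw [(hg x).1, (hg y).1, hd.form_zero, hd'.form_zero] at h0
    rw [(hg x).1, (hg y).1, hd.form_one, hd'.form_one] at h1
    rw [(hg x).2, (hg y).2, hd.form_zero, hd'.form_zero] at h2
    rw [(hg x).2, (hg y).2, hd.form_one, hd'.form_one] at h3
    simp only [map_zero, LinearMap.zero_apply, add_zero, zero_add] at h0 h1 h2 h3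
    fin_cases i
    · exact h0.symm
    · exact h1.symm
    · exact h2.symm
    · exact h3.symm
  intro c hc
  rw [mem_relations] at hc ⊢
  ext x y
  have := LinearMap.congr_fun (LinearMap.congr_fun hc (g x)) (g y)
  simp only [LinearMap.sum_apply, LinearMap.smul_apply, ← hη] at this ⊢
  exact this

theorem TypeIII.parameter_unique (hi : ω.Isomorphic ω') (h : ω.TypeIII E) (h' : ω'.TypeIII E') :
    E = E' := by
  obtain ⟨A, η, e, hd, hs, -, rfl⟩ := h.exists_isDouble
  obtain ⟨A', η', e', hd', hs', -, rfl⟩ := h'.exists_isDouble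
  exact le_antisymm (hd'.relations_le hs' hd hs hi.symm) (hd.relations_le hs hd' hs' hi)

theorem TypeIIb.commutant [IsAlgClosed k] (h2 : (2 : k) ≠ 0)
    (hr : Module.rank k V ≤ Cardinal.aleph0) (h : ω.TypeIIb p) :
    Nonempty (ω.Commutant ≃ₐ[k] k) :=
  have : Nontrivial V := not_subsingleton_iff_nontrivial.1 fun _ =>
    h.1.not_finiteDimensional inferInstance
  commutant_scalar fun _ hφ => (h.twoStep h2).exists_smul_of_commutes (ne_other p) hr hφ

theorem TypeIIc.commutant [IsAlgClosed k] (h2 : (2 : k) ≠ 0)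
    (hr : Module.rank k V ≤ Cardinal.aleph0) (h : ω.TypeIIc p) :
    Nonempty (ω.Commutant ≃ₐ[k] k) :=
  have : Nontrivial V := not_subsingleton_iff_nontrivial.1 fun _ =>
    h.1.not_finiteDimensional inferInstance
  commutant_scalar fun _ hφ => (h.twoStep h2).exists_smul_of_commutes (ne_other p) hr hφ

end Invariance

end MultiQuad

end

theorem theorem1p1 (k : Type u) [Field k] [IsAlgClosed k] [Uncountable k] (hchar : ringChar k ≠ 2) :
    -- classification: length two universal spaces are exactly the members of the seven families
    (∀ (V : Type v) [AddCommGroup V] [Module k V], Module.rank k V ≤ Cardinal.aleph0 →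
      ∀ ω : MultiQuad (Fin 2) k V,
        (ω.Universal ∧ ω.length = 2) ↔
          (∃ S, ω.TypeIa S) ∨ (∃ d p, ω.TypeIb d p) ∨ (∃ d, ω.TypeIc d) ∨
          (∃ p, ω.TypeIIa p) ∨ (∃ p, ω.TypeIIb p) ∨ (∃ p, ω.TypeIIc p) ∨
          (∃ E, ω.TypeIII E)) ∧
    -- the commutants
    (∀ (V : Type v) [AddCommGroup V] [Module k V], Module.rank k V ≤ Cardinal.aleph0 →
      ∀ ω : MultiQuad (Fin 2) k V,
        (∀ S, ω.TypeIa S → Nonempty (ω.Commutant ≃ₐ[k] k × k)) ∧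
        (∀ d p, ω.TypeIb d p → Nonempty (ω.Commutant ≃ₐ[k] k × k)) ∧
        (∀ d, ω.TypeIc d → Nonempty (ω.Commutant ≃ₐ[k] k)) ∧
        (∀ p, ω.TypeIIa p →
          Nonempty (ω.Commutant ≃ₐ[k]
            (Polynomial k ⧸ Ideal.span {(Polynomial.X ^ 2 : Polynomial k)}))) ∧
        (∀ p, ω.TypeIIb p → Nonempty (ω.Commutant ≃ₐ[k] k)) ∧
        (∀ p, ω.TypeIIc p → Nonempty (ω.Commutant ≃ₐ[k] k)) ∧
        (∀ E, ω.TypeIII E → Nonempty (ω.Commutant ≃ₐ[k] Matrix (Fin 2) (Fin 2) k))) ∧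
    -- within each family, the parameter is a complete isomorphism invariant
    (∀ (V : Type v) [AddCommGroup V] [Module k V] (V' : Type w) [AddCommGroup V'] [Module k V'],
      Module.rank k V ≤ Cardinal.aleph0 → Module.rank k V' ≤ Cardinal.aleph0 →
      ∀ (ω : MultiQuad (Fin 2) k V) (ω' : MultiQuad (Fin 2) k V'),
        (∀ S S', ω.TypeIa S → ω'.TypeIa S' → (ω.Isomorphic ω' ↔ S = S')) ∧
        (∀ d p d' p', ω.TypeIb d p → ω'.TypeIb d' p' →
          (ω.Isomorphic ω' ↔ d = d' ∧ p = p')) ∧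
        (∀ d d', ω.TypeIc d → ω'.TypeIc d' → (ω.Isomorphic ω' ↔ d = d')) ∧
        (∀ p p', ω.TypeIIa p → ω'.TypeIIa p' → (ω.Isomorphic ω' ↔ p = p')) ∧
        (∀ p p', ω.TypeIIb p → ω'.TypeIIb p' → (ω.Isomorphic ω' ↔ p = p')) ∧
        (∀ p p', ω.TypeIIc p → ω'.TypeIIc p' → (ω.Isomorphic ω' ↔ p = p')) ∧
        (∀ E E', ω.TypeIII E → ω'.TypeIII E' → (ω.Isomorphic ω' ↔ E = E'))) ∧
    -- the range of the parameters; every parameter is realized on the space with basis `ℕ`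
    ((∀ p q : OnePoint k, p ≠ q → ∃ ω : MultiQuad (Fin 2) k (ℕ →₀ k), ω.TypeIa {p, q}) ∧
      (∀ (d : ℕ∞) (p : OnePoint k), 1 ≤ d →
        ∃ ω : MultiQuad (Fin 2) k (ℕ →₀ k), ω.TypeIb d p) ∧
      (∀ d : ℕ∞, 1 ≤ d → ∃ ω : MultiQuad (Fin 2) k (ℕ →₀ k), ω.TypeIc d) ∧
      (∀ p : OnePoint k, ∃ ω : MultiQuad (Fin 2) k (ℕ →₀ k), ω.TypeIIa p) ∧
      (∀ p : OnePoint k, ∃ ω : MultiQuad (Fin 2) k (ℕ →₀ k), ω.TypeIIb p) ∧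
      (∀ p : OnePoint k, ∃ ω : MultiQuad (Fin 2) k (ℕ →₀ k), ω.TypeIIc p) ∧
      (∀ E : Submodule k (Fin 4 → k),
        (∃ ω : MultiQuad (Fin 2) k (ℕ →₀ k), ω.TypeIII E) ↔ GoodSubspace E)) := by
  have h2 : (2 : k) ≠ 0 := Ring.two_ne_zero hchar
  refine ⟨fun V _ _ hr ω => ⟨fun h => MultiQuad.exists_type_of_length_eq_two h2 hr h.1 h.2, ?_⟩,
    fun V _ _ hr ω => ⟨fun S h => h.commutant h2 hr, fun d p h => h.commutant h2 hr,
      fun d h => h.commutant h2 hr, fun p h => h.commutant h2 hr, fun p h => h.commutant h2 hr,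
      fun p h => h.commutant h2 hr, fun E h => h.commutant hr⟩,
    fun V _ _ V' _ _ hr hr' ω ω' => ⟨fun S S' h h' => ⟨fun hi => h.parameter_unique hi h', ?_⟩,
      fun d p d' p' h h' => ⟨fun hi => h.parameter_unique hi h', ?_⟩,
      fun d d' h h' => ⟨fun hi => h.parameter_unique hi h', ?_⟩,
      fun p p' h h' => ⟨fun hi => hi.point_unique h.2.1 fun r => h'.nullspace_eq_bot, ?_⟩,
      fun p p' h h' => ⟨fun hi => hi.point_unique h.2.1 fun r => h'.nullspace_eq_bot, ?_⟩,
      fun p p' h h' => ⟨fun hi => hi.point_unique h.2.1 fun r => h'.nullspace_eq_bot, ?_⟩,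
      fun E E' h h' => ⟨fun hi => h.parameter_unique hi h', ?_⟩⟩,
    fun p q hpq => MultiQuad.exists_typeIa hpq, fun d p hd => MultiQuad.exists_typeIb h2 hd p,
    fun d hd => MultiQuad.exists_typeIc h2 hd, fun p => MultiQuad.exists_typeIIa h2 p,
    fun p => MultiQuad.exists_typeIIb h2 p, fun p => MultiQuad.exists_typeIIc h2 p,
    fun E => ⟨fun ⟨ω, h⟩ => h.goodSubspace, MultiQuad.exists_typeIII_of_goodSubspace h2⟩⟩
  · rintro (⟨S, h⟩ | ⟨d, p, h⟩ | ⟨d, h⟩ | ⟨p, h⟩ | ⟨p, h⟩ | ⟨p, h⟩ | ⟨E, h⟩)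
    · exact ⟨h.universal h2, h.length_eq_two h2 hr⟩
    · exact ⟨h.universal, h.length_eq_two h2 hr⟩
    · exact ⟨h.universal, h.length_eq_two h2 hr⟩
    · exact ⟨h.1, h.length_eq_two h2 hr⟩
    · exact ⟨h.1, (h.twoStep h2).length_eq_two h2 (MultiQuad.ne_other p) hr⟩
    · exact ⟨h.1, (h.twoStep h2).length_eq_two h2 (MultiQuad.ne_other p) hr⟩
    · exact ⟨h.universal h2 hr, h.length_eq_two⟩
  · rintro rfl
    exact h.isomorphic h2 hr hr' h'
  · rintro ⟨rfl, rfl⟩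
    exact h.isomorphic h2 hr hr' h'
  · rintro rfl
    exact h.isomorphic h2 hr hr' h'
  · rintro rfl
    exact h.isomorphic h2 hr hr' h'
  · rintro rfl
    exact (h.twoStep h2).isomorphic (MultiQuad.ne_other p) (h'.twoStep h2) hr hr'
  · rintro rfl
    exact (h.twoStep h2).isomorphic (MultiQuad.ne_other p) (h'.twoStep h2) hr hr'
  · rintro rfl
    exact h.isomorphic h2 hr hr' h'
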